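/- **Setting.** Let $F$ be a non-archimedean local field of characteristic $0$ with ring of integers $\mathfrak o$, maximal ideal $\mathfrak p$, prime element $\varpi$, $q=\#(\mathfrak o/\mathfrak p)$, and $\mathrm{ord}$ the valuation with $\mathrm{ord}(\varpi)=1$, $\mathrm{ord}(0)=\infty$. Write $S[X]={}^tXSX$, $X\perp Y$ for the block diagonal matrix, $M_{m,n}(\mathfrak o)$ for the integral $m\times n$ matrices, and $\mathcal H_n(\mathfrak o)$ for the half-integral matrices of degree $n$ (symmetric over $F$, with $b_{ii}\in\mathfrak o$ and $2b_{ij}\in\mathfrak o$). Volumes are for Haar measures giving $M_{m,n}(\mathfrak o)$ (or a product of such groups) volume $1$. For symmetric $S$ of degree $m$ and $T$ of degree $n$ put $$\alpha(S,T)=\lim_{e\to\infty}q^{en(n+1)/2}\,\mathrm{vol}\{X\in M_{m,n}(\mathfrak o): S[X]-T\in\varpi^e\mathcal H_n(\mathfrak o)\},$$ and let $\beta(S,T)$ be the same limit with $X$ restricted to primitive matrices (those that can be completed to an element of $GL_m(\mathfrak o)$). For $T$ of degree $s$, $A$ of degree $r$ and $R$ of size $r\times s$, put $T(R,A,x)=\begin{pmatrix}T&{}^tR/2\\R/2&A\end{pmatrix}\left[\begin{pmatrix}1_s\\x\end{pmatrix}\right]$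 for $x\in M_{r,s}(\mathfrak o)$, and $$\alpha(S,T,R,A)=\lim_{e\to\infty}q^{es(s+1)/2}\,\mathrm{vol}\{(X_1,X_2)\in M_{m,s}(\mathfrak o)\times M_{r,s}(\mathfrak o): S[X_1]-T(R,A,X_2)\in\varpi^e\mathcal H_s(\mathfrak o)\}.$$ Let $H_k$ be the orthogonal sum of $k$ copies of $\begin{pmatrix}0&1/2\\1/2&0\end{pmatrix}$ ($H_k$ is the empty matrix if $k\le 0$). Let $\mathbf D_{2,1}=GL_2(\mathfrak o)(\varpi\perp 1)GL_2(\mathfrak o)$. Fix an additive character $\psi$ of $F$ of order zero, i.e. $\mathfrak o=\{a:\psi(ax)=1\ \forall x\in\mathfrak o\}$. For $B\in\mathcal H_n(\mathfrak o)$ with $\det B\ne0$ let $$b(B,X)=\sum_{R\in \mathrm{Sym}_n(F)/\mathrm{Sym}_n(\mathfrak o)}\psi(\mathrm{tr}(BR))X^{\nu(R)}\in\mathbb C[[X]],\qquad q^{\nu(R)}=[R\mathfrak o^n+\mathfrak o^n:\mathfrak o^n],$$ be its Siegel series. Let $D_B=(-4)^{[n/2]}\det B$, and let $\xi_B=1,-1,0$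 according as $D_B$ is a square in $F$, $F(\sqrt{D_B})/F$ is unramified quadratic, or $F(\sqrt{D_B})/F$ is ramified quadratic. Let $\gamma_q(B,X)=(1-X)\prod_{i=1}^{n/2}(1-q^{2i}X^2)\,(1-q^{n/2}\xi_BX)^{-1}$ for $n$ even, $\gamma_q(B,X)=(1-X)\prod_{i=1}^{(n-1)/2}(1-q^{2i}X^2)$ for $n$ odd, and $F(B,X)=b(B,X)/\gamma_q(B,X)$ in $\mathbb C[[X]]$ (it is known to be a polynomial). For $r\in\{1,2\}$ and $n\ge r$ write $B=\begin{pmatrix}B^{(n-r)}&{}^tR/2\\R/2&A\end{pmatrix}$ with $A$ of degree $r$ (so $R=(2b_{ij})_{n-r<i\le n,\,1\le j\le n-r}$), and for $x\in M_{r,n-r}(\mathfrak o)$ put $$B_x=B^{(n-r)}(\varpi R,\varpi^2A,x)=B\left[\begin{pmatrix}1_{n-r}\\ \varpi x\end{pmatrix}\right].$$ **Theorem.** Let $B\in\mathcal H_n(\mathfrak o)$ be non-degenerate, $r\in\{1,2\}$, $n\ge r$, and assume that there is a positive integer $l_0$ with $\mathrm{ord}(\det(2B_x))\le l_0$ for all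 $x\in M_{r,n-r}(\mathfrak o)$. Then there is a positive integer $m_0$, independent of $k$, such that, for $x$ running over any complete set of representatives of $M_{r,n-r}(\mathfrak o)/\mathfrak p^{m_0}M_{r,n-r}(\mathfrak o)$ and $W$ over any complete set of representatives of $\mathbf D_{2,1}/GL_2(\mathfrak o)$, and for every positive integer $k$ with $2k\ge n$, all the limits below exist and the following hold. (1) If $r=1$ (so that $A=b_{nn}$), then $$\alpha(H_k,B[1_{n-1}\perp\varpi])-q^{n-2k+1}\alpha(H_k,B)=\beta(H_k,\varpi^2b_{nn})\,\alpha(H_{k-1},B^{(n-1)},\varpi R,\varpi^2b_{nn})$$ $$=q^{-m_0(n-1)}(1-q^{-k})(1+q^{-k+1})\sum_x\alpha(H_{k-1},B_x),$$ and $$F(B[1_{n-1}\perp\varpi],X)=q^{n+1}X^2F(B,X)+q^{-m_0(n-1)}\sum_x\frac{(1-X)(1+qX)\gamma_q(B_x,qX)}{\gamma_q(B,X)}F(B_x,qX).$$ (2) If $r=2$, then $$\alpha(H_k,B[1_{n-2}\perp\varpi1_2])+q^{2n-4k+3}\alpha(H_k,B)-q^{n-2k+1}\sum_W\alpha(H_k,B[1_{n-2}\perp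 W])=\beta(H_k,\varpi^2A)\,\alpha(H_{k-2},B^{(n-2)},\varpi R,\varpi^2A)$$ $$=q^{-2m_0(n-2)}(1-q^{-k})(1-q^{-2k+2})(1+q^{-k+2})\sum_x\alpha(H_{k-2},B_x),$$ and $$F(B[1_{n-2}\perp\varpi1_2],X)=-q^{2n+3}X^4F(B,X)+q^{n+1}X^2\sum_WF(B[1_{n-2}\perp W],X)$$ $$+q^{-2m_0(n-2)}\sum_x\frac{(1-X)(1-q^2X^2)(1+q^2X)\gamma_q(B_x,q^2X)}{\gamma_q(B,X)}F(B_x,q^2X).$$ If $n=r$, $B_x$ is empty and $\alpha(H_{k-r},B_x)=F(B_x,\cdot)=\gamma_q(B_x,\cdot)=1$. -/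

import Mathlib

open ValuativeRel Filter Topology Matrix

noncomputable section LocalDensityDefs

/- Throughout, `F` is a non-archimedean local field with ring of integers `𝒪[F]`, maximal ideal
`𝓂[F]` and residue field `𝓀[F]`; `ϖ` is a prime element of `𝒪[F]`. The degree of a square matrix
is the cardinality of its index type. -/

/-- The number of elements of the residue field. -/
def residueCard (F : Type*) [Field F] [ValuativeRel F] : ℕ := Nat.card 𝓀[F]

/-- A matrix over the ring of integers, viewed as a matrix over the field. -/
def toField {F : Type*} [Field F] [ValuativeRel F] {m n : Type*} (X : Matrix m n 𝒪[F]) :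
    Matrix m n F :=
  X.map (fun a => (a : F))

/-- The notation `S[X] = ᵗX S X`. -/
def quadSubst {F : Type*} [Field F] {m n : Type*} [Fintype m]
    (S : Matrix m m F) (X : Matrix m n F) : Matrix n n F :=
  Xᵀ * S * X

/-- Half-integral matrices over the ring of integers of `F`. -/
def IsHalfIntegral {F : Type*} [Field F] [ValuativeRel F] {n : Type*} (B : Matrix n n F) : Prop :=
  B.IsSymm ∧ (∀ i, B i i ∈ 𝒪[F]) ∧ ∀ i j, i ≠ j → 2 * B i j ∈ 𝒪[F]

/-- `ord a ≤ l`, i.e. `|ϖ ^ l| ≤ |a|`; it fails for `a = 0`, whose order is infinite. -/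
def OrdLE {F : Type*} [Field F] [ValuativeRel F] (ϖ : 𝒪[F]) (a : F) (l : ℕ) : Prop :=
  valuation F ((ϖ : F) ^ l) ≤ valuation F a

/-- `M ∈ ϖ ^ e H_n`, where `H_n` is the module of half-integral matrices. -/
def MemPowHalfIntegral {F : Type*} [Field F] [ValuativeRel F] {n : Type*}
    (ϖ : 𝒪[F]) (e : ℕ) (M : Matrix n n F) : Prop :=
  ∃ Z : Matrix n n F, IsHalfIntegral Z ∧ M = ((ϖ : F) ^ e) • Z

/-- The volume of a subset of a compact group `G` (such as the group of integral `m × n` matrices)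
for the Haar measure of `G` normalized by `vol G = 1`. -/
def compactVol {G : Type*} [TopologicalSpace G] [AddGroup G] [IsTopologicalAddGroup G]
    [CompactSpace G] (C : Set G) : ℝ :=
  letI : MeasurableSpace G := borel G
  haveI : BorelSpace G := ⟨rfl⟩
  (MeasureTheory.Measure.addHaarMeasure (⊤ : TopologicalSpace.PositiveCompacts G) C).toReal

instance compactSpace_integralMatrix {F : Type*} [Field F] [ValuativeRel F] [TopologicalSpace F]
    [IsNonarchimedeanLocalField F] {m n : Type*} : CompactSpace (Matrix m n 𝒪[F]) :=
  inferInstanceAs (CompactSpace (m → n → 𝒪[F]))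

/-- `H_k = H ⊥ ⋯ ⊥ H` (`k` copies), `H = (0, 1/2; 1/2, 0)`. -/
def hyp (F : Type*) [Field F] (k : ℕ) : Matrix (Fin 2 × Fin k) (Fin 2 × Fin k) F :=
  Matrix.blockDiagonal (fun _ : Fin k => !![0, 1 / 2; 1 / 2, 0])

/-! ### Local densities -/

section Densities

variable {F : Type*} [Field F] [ValuativeRel F] [TopologicalSpace F]
  [IsNonarchimedeanLocalField F]

/-- The set `A_e(S,T)` of integral `X` with `S[X] ≡ T mod ϖ ^ e H_n`. -/
def solSet (ϖ : 𝒪[F]) (e : ℕ) {m n : Type*} [Fintype m] (S : Matrix m m F) (T : Matrix n n F) :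
    Set (Matrix m n 𝒪[F]) :=
  {X | MemPowHalfIntegral ϖ e (quadSubst S (toField X) - T)}

/-- The factor `q ^ (e n (n + 1) / 2)`. -/
def densityFactor (F : Type*) [Field F] [ValuativeRel F] (n e : ℕ) : ℝ :=
  (residueCard F : ℝ) ^ (e * (n * (n + 1) / 2))

/-- The sequence whose limit is the local density `α(S,T)`. -/
def localDensitySeq (ϖ : 𝒪[F]) {m n : Type*} [Fintype m] [Fintype n]
    (S : Matrix m m F) (T : Matrix n n F) (e : ℕ) : ℝ :=
  densityFactor F (Fintype.card n) e * compactVol (solSet ϖ e S T)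

/-- The local density `α(S,T)`. -/
def localDensity (ϖ : 𝒪[F]) {m n : Type*} [Fintype m] [Fintype n]
    (S : Matrix m m F) (T : Matrix n n F) : ℝ :=
  limUnder atTop (localDensitySeq ϖ S T)

/-- An integral `m × n` matrix `X` is primitive if `(X Y)` is invertible over the ring of integers
for some integral matrix `Y` with `m - n` columns. -/
def IsPrimitiveMatrix {m n : Type*} [Fintype m] [DecidableEq m] (X : Matrix m n 𝒪[F]) : Prop :=
  ∃ (d : ℕ) (σ : m ≃ n ⊕ Fin d) (Y : Matrix m (Fin d) 𝒪[F]),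
    IsUnit ((Matrix.fromCols X Y).submatrix id σ).det

/-- The sequence whose limit is the primitive local density `β(S,T)`. -/
def primitiveDensitySeq (ϖ : 𝒪[F]) {m n : Type*} [Fintype m] [DecidableEq m] [Fintype n]
    (S : Matrix m m F) (T : Matrix n n F) (e : ℕ) : ℝ :=
  densityFactor F (Fintype.card n) e *
    compactVol {X : Matrix m n 𝒪[F] | X ∈ solSet ϖ e S T ∧ IsPrimitiveMatrix X}

/-- The primitive local density `β(S,T)`. -/
def primitiveDensity (ϖ : 𝒪[F]) {m n : Type*} [Fintype m] [DecidableEq m] [Fintype n]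
    (S : Matrix m m F) (T : Matrix n n F) : ℝ :=
  limUnder atTop (primitiveDensitySeq ϖ S T)

/-- The matrix `T(R,A,X) = (T, ᵗR/2; R/2, A)[(1; X)]`. -/
def blockSubst {s r : Type*} [Fintype s] [DecidableEq s] [Fintype r]
    (T : Matrix s s F) (R : Matrix r s F) (A : Matrix r r F) (X : Matrix r s 𝒪[F]) :
    Matrix s s F :=
  quadSubst (Matrix.fromBlocks T ((1 / 2 : F) • Rᵀ) ((1 / 2 : F) • R) A)
    (Matrix.fromRows 1 (toField X))

/-- The set `A_e(S,T,R,A)` of pairs `(X₁, X₂)` of integral matrices with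
`S[X₁] ≡ T(R,A,X₂) mod ϖ ^ e H`. -/
def modifiedSolSet (ϖ : 𝒪[F]) (e : ℕ) {m s r : Type*} [Fintype m] [Fintype s] [DecidableEq s]
    [Fintype r] (S : Matrix m m F) (T : Matrix s s F) (R : Matrix r s F) (A : Matrix r r F) :
    Set (Matrix m s 𝒪[F] × Matrix r s 𝒪[F]) :=
  {X | MemPowHalfIntegral ϖ e (quadSubst S (toField X.1) - blockSubst T R A X.2)}

/-- The sequence whose limit is the modified local density `α(S,T,R,A)`. -/
def modifiedDensitySeq (ϖ : 𝒪[F]) {m s r : Type*} [Fintype m] [Fintype s] [DecidableEq s]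
    [Fintype r] (S : Matrix m m F) (T : Matrix s s F) (R : Matrix r s F) (A : Matrix r r F)
    (e : ℕ) : ℝ :=
  densityFactor F (Fintype.card s) e * compactVol (modifiedSolSet ϖ e S T R A)

/-- The modified local density `α(S,T,R,A)`. -/
def modifiedDensity (ϖ : 𝒪[F]) {m s r : Type*} [Fintype m] [Fintype s] [DecidableEq s]
    [Fintype r] (S : Matrix m m F) (T : Matrix s s F) (R : Matrix r s F) (A : Matrix r r F) : ℝ :=
  limUnder atTop (modifiedDensitySeq ϖ S T R A)

end Densities

/-- The sequence `u` has a limit in `ℝ`. -/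
def Converges (u : ℕ → ℝ) : Prop := ∃ a : ℝ, Tendsto u atTop (𝓝 a)

/-! ### The matrices in the induction formulas

A matrix `B` of degree `n = p + r` is indexed by `Fin p ⊕ Fin r`, so that its blocks are
`B^{(p)} = B.toBlocks₁₁`, `(b_{ij})_{i > p, j ≤ p} = B.toBlocks₂₁`,
`(b_{ij})_{i, j > p} = B.toBlocks₂₂`. -/

section Induction

variable {F : Type*} [Field F] [ValuativeRel F]

/-- `B[1_p ⊥ W]`. -/
def substLower {p r : ℕ} (B : Matrix (Fin p ⊕ Fin r) (Fin p ⊕ Fin r) F)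
    (W : Matrix (Fin r) (Fin r) 𝒪[F]) : Matrix (Fin p ⊕ Fin r) (Fin p ⊕ Fin r) F :=
  quadSubst B (Matrix.fromBlocks 1 0 0 (toField W))

/-- `R = (2 b_{ij})_{i > p, j ≤ p}`, so that `B = (B^{(p)}, ᵗR/2; R/2, A)`. -/
def lowerR {p r : ℕ} (B : Matrix (Fin p ⊕ Fin r) (Fin p ⊕ Fin r) F) :
    Matrix (Fin r) (Fin p) F :=
  (2 : F) • B.toBlocks₂₁

/-- The matrix `B_x = B^{(p)}(ϖ R, ϖ ^ 2 A, x)` of degree `p`. -/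
def shiftedBlock (ϖ : 𝒪[F]) {p r : ℕ} (B : Matrix (Fin p ⊕ Fin r) (Fin p ⊕ Fin r) F)
    (x : Matrix (Fin r) (Fin p) 𝒪[F]) : Matrix (Fin p) (Fin p) F :=
  blockSubst B.toBlocks₁₁ ((ϖ : F) • lowerR B) ((ϖ : F) ^ 2 • B.toBlocks₂₂) x

/-- `B_x = B[(1; ϖ x)]`. -/
theorem shiftedBlock_eq [CharZero F] (ϖ : 𝒪[F]) {p r : ℕ}
    (B : Matrix (Fin p ⊕ Fin r) (Fin p ⊕ Fin r) F) (hB : B.IsSymm)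
    (x : Matrix (Fin r) (Fin p) 𝒪[F]) :
    shiftedBlock ϖ B x = quadSubst B (Matrix.fromRows 1 ((ϖ : F) • toField x)) := by
  have h12 : B.toBlocks₁₂ = (B.toBlocks₂₁)ᵀ := by
    ext i j
    exact (hB.apply (Sum.inl i) (Sum.inr j)).symm
  conv_rhs => rw [← Matrix.fromBlocks_toBlocks B, h12]
  simp only [shiftedBlock, blockSubst, quadSubst, lowerR, Matrix.transpose_fromRows,
    Matrix.fromCols_mul_fromBlocks, Matrix.fromCols_mul_fromRows, Matrix.transpose_smul,
    smul_smul, Matrix.smul_mul, Matrix.mul_smul, Matrix.transpose_one, Matrix.one_mul,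
    Matrix.mul_one, Matrix.add_mul, smul_add]
  have h2 : (1 / 2 : F) * ((ϖ : F) * 2) = ϖ := by field_simp
  rw [h2, pow_two]

/-- `Ω` is a complete set of representatives of the integral `r × p` matrices modulo `𝔭 ^ m`. -/
def IsCosetReps {r p : ℕ} (m : ℕ) (Ω : Finset (Matrix (Fin r) (Fin p) 𝒪[F])) : Prop :=
  ∀ x : Matrix (Fin r) (Fin p) 𝒪[F], ∃! y, y ∈ Ω ∧ ∀ i j, x i j - y i j ∈ 𝓂[F] ^ m

/-- The double coset `D_{l,i} = GL_l (ϖ 1_i ⊥ 1_{l-i}) GL_l` over the ring of integers. -/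
def doubleCoset (ϖ : 𝒪[F]) (l i : ℕ) : Set (Matrix (Fin l) (Fin l) 𝒪[F]) :=
  {W | ∃ U V : GL (Fin l) 𝒪[F],
    W = U.val * Matrix.diagonal (fun a : Fin l => if a.val < i then ϖ else 1) * V.val}

/-- `Ω` is a complete set of representatives of `D_{l,i} / GL_l`. -/
def IsDoubleCosetReps (ϖ : 𝒪[F]) (l i : ℕ) (Ω : Finset (Matrix (Fin l) (Fin l) 𝒪[F])) : Prop :=
  (∀ W ∈ Ω, W ∈ doubleCoset ϖ l i) ∧
    ∀ W ∈ doubleCoset ϖ l i, ∃! W', W' ∈ Ω ∧ ∃ U : GL (Fin l) 𝒪[F], W = W' * U.val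

end Induction

/-! ### Existence of the systems of representatives -/

theorem exists_finset_reps {α β : Type*} [Finite β] (S : Set α) (rel : α → α → Prop)
    (hs : ∀ a b, rel a b → rel b a) (ht : ∀ a b c, rel a b → rel b c → rel a c)
    (f : α → β) (hf : ∀ a ∈ S, ∀ b ∈ S, f a = f b → rel a b) :
    ∃ Ω : Finset α, (∀ a ∈ Ω, a ∈ S) ∧ ∀ a ∈ S, ∃! b, b ∈ Ω ∧ rel a b := by
  classical
  have := Fintype.ofFinite β
  let T : Setoid S := ⟨fun a b => rel a b, fun a => hf _ a.2 _ a.2 rfl, fun h => hs _ _ h,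
    fun h h' => ht _ _ _ h h'⟩
  have hfin : Finite (Quotient T) := by
    refine Finite.of_injective (fun c : Quotient T => f c.out.1) fun c d h => ?_
    rw [← Quotient.out_eq c, ← Quotient.out_eq d]
    exact Quotient.sound (hf _ c.out.2 _ d.out.2 h)
  have := Fintype.ofFinite (Quotient T)
  refine ⟨Finset.univ.image fun c : Quotient T => c.out.1, ?_, fun a ha => ?_⟩
  · intro a h
    obtain ⟨c, -, rfl⟩ := Finset.mem_image.1 h
    exact c.out.2
  · refine ⟨(Quotient.mk T ⟨a, ha⟩).out.1, ⟨Finset.mem_image_of_mem _ (Finset.mem_univ _),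
      hs _ _ (Quotient.mk_out (s := T) ⟨a, ha⟩)⟩, ?_⟩
    rintro b ⟨hb, hab⟩
    obtain ⟨c, -, rfl⟩ := Finset.mem_image.1 hb
    have : Quotient.mk T ⟨a, ha⟩ = c := by
      rw [← Quotient.out_eq c]; exact Quotient.sound hab
    rw [this]

section Representatives

variable {F : Type*} [Field F] [ValuativeRel F] [TopologicalSpace F]
  [IsNonarchimedeanLocalField F]

theorem finite_quotient_maximalIdeal_pow (m : ℕ) : Finite (𝒪[F] ⧸ 𝓂[F] ^ m) := by
  have : Finite (𝒪[F] ⧸ 𝓂[F]) := inferInstanceAs (Finite 𝓀[F])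
  exact Ideal.finite_quotient_pow (IsNoetherian.noetherian _) m

/-- Complete sets of representatives modulo `𝔭 ^ m` exist. -/
theorem exists_isCosetReps (r p m : ℕ) :
    ∃ Ω : Finset (Matrix (Fin r) (Fin p) 𝒪[F]), IsCosetReps m Ω := by
  have := finite_quotient_maximalIdeal_pow (F := F) m
  obtain ⟨Ω, -, h⟩ := exists_finset_reps (α := Matrix (Fin r) (Fin p) 𝒪[F]) Set.univ
    (fun x y => ∀ i j, x i j - y i j ∈ 𝓂[F] ^ m)
    (fun a b h i j => by simpa using neg_mem (h i j))
    (fun a b c h h' i j => by simpa using add_mem (h i j) (h' i j))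
    (fun x => fun (i : Fin r) (j : Fin p) => (Ideal.Quotient.mk (𝓂[F] ^ m) (x i j)))
    (fun a _ b _ h i j => Ideal.Quotient.eq.1 (congrFun (congrFun h i) j))
  exact ⟨Ω, fun x => h x trivial⟩

/-- Complete sets of representatives of `D_{l,i} / GL_l` exist. -/
theorem exists_isDoubleCosetReps (ϖ : 𝒪[F]) (hϖ : Irreducible ϖ) (l i : ℕ) :
    ∃ Ω : Finset (Matrix (Fin l) (Fin l) 𝒪[F]), IsDoubleCosetReps ϖ l i Ω := by
  have := finite_quotient_maximalIdeal_pow (F := F) 2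
  refine exists_finset_reps (α := Matrix (Fin l) (Fin l) 𝒪[F]) _ _ ?_ ?_ 
    (fun x => fun (i : Fin l) (j : Fin l) => (Ideal.Quotient.mk (𝓂[F] ^ 2) (x i j))) ?_
  · rintro a b ⟨U, rfl⟩
    exact ⟨U⁻¹, by simp [Matrix.mul_assoc]⟩
  · rintro a b c ⟨U, rfl⟩ ⟨V, rfl⟩
    exact ⟨V * U, by simp [Matrix.mul_assoc]⟩
  · intro a _ b hb h
    obtain ⟨U, V, rfl⟩ := hb
    have h1 : ∀ s t, ∃ z, a s t - (U.val * Matrix.diagonal (fun a : Fin l => if a.val < i then ϖ else 1) * V.val) s t = ϖ * (ϖ * z) := by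
      intro s t
      have := Ideal.Quotient.eq.1 (congrFun (congrFun h s) t)
      rw [hϖ.maximalIdeal_eq, Ideal.span_singleton_pow, Ideal.mem_span_singleton] at this
      obtain ⟨z, hz⟩ := this
      exact ⟨z, by rw [hz]; ring⟩
    choose Z hZ using h1
    set D := Matrix.diagonal (fun a : Fin l => if a.val < i then ϖ else 1)
    set E := Matrix.diagonal (fun a : Fin l => if a.val < i then 1 else ϖ)
    have hDE : D * E = ϖ • 1 := by
      simp only [D, E, Matrix.diagonal_mul_diagonal]
      ext s t
      by_cases hst : s = t
      · subst hst; simp; split_ifs <;> simp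
      · simp [hst]
    have ha : a = U.val * D * V.val + (ϖ * ϖ) • (Matrix.of Z) := by
      ext s t : 2
      have := hZ s t
      simp only [Matrix.add_apply, Matrix.smul_apply, Matrix.of_apply, smul_eq_mul]
      rw [sub_eq_iff_eq_add] at this
      rw [this]; ring_nf
    let N := V⁻¹.val * E * U⁻¹.val * Matrix.of Z
    have hN : IsUnit (1 + ϖ • N) := by
      rw [Matrix.isUnit_iff_isUnit_det, ← IsLocalRing.residue_ne_zero_iff_isUnit]
      rw [RingHom.map_det]
      have : (IsLocalRing.residue 𝒪[F]).mapMatrix (1 + ϖ • N) = 1 := by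
        rw [map_add, map_one]
        have hz : (IsLocalRing.residue 𝒪[F]) ϖ = 0 := by
          rw [IsLocalRing.residue_eq_zero_iff]; exact (IsLocalRing.mem_maximalIdeal _).2 hϖ.not_isUnit
        ext s t : 2
        simp [hz]
      rw [this]; simp
    refine ⟨hN.unit, ?_⟩
    · rw [ha, IsUnit.unit_spec, Matrix.mul_add, Matrix.mul_one]
      congr 1
      have e1 : U.val * D * V.val * (ϖ • N) = ϖ • (U.val * (D * ((V.val * V⁻¹.val) * (E * (U⁻¹.val * Matrix.of Z))))) := by
        simp only [N, Matrix.mul_assoc, Matrix.mul_smul]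
      rw [e1, ← Units.val_mul, mul_inv_cancel, Units.val_one, Matrix.one_mul, ← Matrix.mul_assoc D, hDE]
      simp only [Matrix.smul_mul, Matrix.one_mul, Matrix.mul_smul, ← Matrix.mul_assoc]
      rw [← Units.val_mul, mul_inv_cancel, Units.val_one, Matrix.one_mul, smul_smul]

end Representatives

/-! ### Siegel series -/

section Siegel

variable {F : Type*} [Field F] [ValuativeRel F]

/-- An additive character of order zero. -/
def IsOrderZero (ψ : AddChar F ℂ) : Prop :=
  ∀ a : F, a ∈ 𝒪[F] ↔ ∀ x ∈ 𝒪[F], ψ (a * x) = 1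

/-- The group of symmetric matrices over `F`. -/
def symGroup (F : Type*) [Field F] (n : Type*) : AddSubgroup (Matrix n n F) where
  carrier := {R | R.IsSymm}
  zero_mem' := Matrix.isSymm_zero
  add_mem' := fun h₁ h₂ => Matrix.IsSymm.add h₁ h₂
  neg_mem' := fun h => Matrix.IsSymm.neg h

/-- The subgroup of integral symmetric matrices. -/
def symGroupInt (F : Type*) [Field F] [ValuativeRel F] (n : Type*) :
    AddSubgroup (symGroup F n) where
  carrier := {R | ∀ i j, R.val i j ∈ 𝒪[F]}
  zero_mem' := fun _ _ => zero_mem _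
  add_mem' := fun h₁ h₂ i j => add_mem (h₁ i j) (h₂ i j)
  neg_mem' := fun h i j => neg_mem (h i j)

/-- The standard lattice of integral vectors. -/
def stdLattice (F : Type*) [Field F] [ValuativeRel F] (n : Type*) : AddSubgroup (n → F) where
  carrier := {v | ∀ i, v i ∈ 𝒪[F]}
  zero_mem' := fun _ => zero_mem _
  add_mem' := fun h₁ h₂ i => add_mem (h₁ i) (h₂ i)
  neg_mem' := fun h i => neg_mem (h i)

/-- `μ(R) = [R L + L : L]`, where `L` is the standard lattice. -/
def latticeIndex {n : Type*} [Fintype n] (R : Matrix n n F) : ℕ :=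
  (stdLattice F n).relIndex
    (AddSubgroup.map R.mulVecLin.toAddMonoidHom (stdLattice F n) ⊔ stdLattice F n)

open scoped Classical in
/-- The Siegel series `b(B,s) = ∑ ψ(tr(BR)) μ(R) ^ (-s)`, `R` running over the symmetric matrices
over `F` modulo the integral ones, as a formal power series in `X = q ^ (-s)`: the coefficient of
`X ^ j` is the (finite) sum of `ψ(tr(BR))` over the classes with `μ(R) = q ^ j`. -/
def siegelSeries (ψ : AddChar F ℂ) {n : Type*} [Fintype n] (B : Matrix n n F) : PowerSeries ℂ :=
  PowerSeries.mk fun j =>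
    ∑ᶠ R : symGroup F n ⧸ symGroupInt F n,
      if latticeIndex R.out.val = residueCard F ^ j then ψ (Matrix.trace (B * R.out.val)) else 0

/-- `D_B = (-4) ^ [n/2] det B`. -/
def formDiscr {n : Type*} [Fintype n] [DecidableEq n] (B : Matrix n n F) : F :=
  (-4) ^ (Fintype.card n / 2) * B.det

/-- The field `F(√D)`, inside an algebraic closure of `F`. -/
def sqrtExt (D : F) : IntermediateField F (AlgebraicClosure F) :=
  IntermediateField.adjoin F {z | z ^ 2 = algebraMap F (AlgebraicClosure F) D}

open scoped Classical in
/-- `ξ_B`: it is `1` if `D_B` is a square, `-1` if `F(√D_B)/F` is an unramified quadratic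
extension, and `0` if it is a ramified one. The extension is unramified if the integral closure of
`𝒪[F]` in it is unramified over `𝒪[F]`. -/
def xiInv {n : Type*} [Fintype n] [DecidableEq n] (B : Matrix n n F) : ℂ :=
  if IsSquare (formDiscr B) then 1
  else if Algebra.FormallyUnramified 𝒪[F] (integralClosure 𝒪[F] (sqrtExt (formDiscr B))) then -1
  else 0

/-- `γ_q(B,X)`, as a power series in `X`. -/
def gammaPoly {n : Type*} [Fintype n] [DecidableEq n] (B : Matrix n n F) : PowerSeries ℂ :=
  if Even (Fintype.card n) then
    (1 - PowerSeries.X) *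
      (∏ i ∈ Finset.Icc 1 (Fintype.card n / 2),
        (1 - PowerSeries.C ((residueCard F : ℂ) ^ (2 * i)) * PowerSeries.X ^ 2)) *
      (1 - PowerSeries.C ((residueCard F : ℂ) ^ (Fintype.card n / 2) * xiInv B) *
        PowerSeries.X)⁻¹
  else
    (1 - PowerSeries.X) *
      ∏ i ∈ Finset.Icc 1 ((Fintype.card n - 1) / 2),
        (1 - PowerSeries.C ((residueCard F : ℂ) ^ (2 * i)) * PowerSeries.X ^ 2)

/-- `F(B,X) = b(B,X) / γ_q(B,X)`. It is in fact a polynomial; it is treated here as the element of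
`ℂ⟦X⟧` (where `γ_q(B,X)` is invertible, its constant term being `1`) which that polynomial is. -/
def siegelF (ψ : AddChar F ℂ) {n : Type*} [Fintype n] [DecidableEq n] (B : Matrix n n F) :
    PowerSeries ℂ :=
  siegelSeries ψ B * (gammaPoly B)⁻¹

end Siegel

end LocalDensityDefs

/-! Write n = p + r and T = B[1_p ⊥ ϖ1_r]. The solutions X of H_k[X] ≡ T mod ϖ^e are sorted by their
last r columns X₂. Both expressions in the density formula compute the contribution of the primitive
X₂: one by subtracting the imprimitive part, the other by fibring over X₂.

Imprimitive part. For r = 1 the column X₂ is divisible by ϖ, so X = Y(1 ⊥ ϖ) with H_k[Y] close to B.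
The substitution costs q^{-2k} in volume and gains q^{n+1} from the loosened congruences, which
leaves q^{n-2k+1} α(H_k, B) (`eventually_divisible_part`). For r = 2 the q + 1 lines of the residue
plane correspond to D_{2,1}/GL_2, and inclusion-exclusion on the rank of X₂ mod ϖ reads 1_prim = 1 -
Σ_W [ϖ | X₂W] + q[ϖ | X₂] (`indicator_isPrimitiveMatrix_two`).

Primitive part. An explicit isometry over the integers takes X₂ to (1, Q, 0) in a split form of rank
2r plus H_{k-r} (`exists_frame`); for r = 2 the pivots exist because T₂₂ = ϖ²A vanishes mod ϖ, so
that X₂ spans a totally singular plane there (`exists_minor_ne_zero`). If X₁ becomes (-x, b, c),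
then X₁ + X₂x is (0, b + Qx, c), so H_k[X₁ + X₂x] = H_{k-r}[c]. The congruence for X requires this
to be T[(1; x)] = T(R, A, x), and the off-diagonal block fixes b modulo ϖ^e. Hence all fibres have
the same volume (`compactVol_fibre`) and the primitive part is β times the modified density. The
number β is found by pairing the two isotropic halves of a column, and the modified density is
fibred over x.

Limits. One Newton step (`exists_quadSubst_sub_memPow`) shows that matrices T' close to T give equal
volumes, so every density sequence is stationary from e = 2l + 1 on, where l bounds ord det(2T). A
bound l uniform in x makes α(H, B_x) depend only on x modulo ϖ^{2l+1}; this is the origin of m₀ = 2l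
+ 1.

Siegel series. Fourier inversion modulo ϖ^e turns α(H_k, B) into a sum over symmetric R of a
character value times μ(R)^{-k}, because each hyperbolic plane contributes one factor
(`localDensitySeq_eq_sum_addChar`). Stationarity in e then makes b(B, X) a polynomial with value
α(H_k, B) at q^{-k} (`exists_siegelSeries_polynomial`). The density formula, valid at infinitely
many k, becomes an identity of polynomials in X = q^{-k}, with k - r corresponding to q^r X. Since
γ_q depends only on the degree and on the determinant modulo squares, it is the same for all B[1 ⊥
W], and division by it gives the formula for F(B, X). -/

set_option linter.unusedSectionVars false

/-! ### Normalized Haar volume on compact groups -/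

section CompactVolume

variable {G H : Type*} [TopologicalSpace G] [AddGroup G] [IsTopologicalAddGroup G]
  [CompactSpace G] [TopologicalSpace H] [AddGroup H] [IsTopologicalAddGroup H]
  [CompactSpace H]

/-- The normalized Haar measure of a compact group. -/
noncomputable abbrev compactHaar (G : Type*) [TopologicalSpace G] [AddGroup G]
    [IsTopologicalAddGroup G] [CompactSpace G] [MeasurableSpace G] [BorelSpace G] :
    MeasureTheory.Measure G :=
  MeasureTheory.Measure.addHaarMeasure (⊤ : TopologicalSpace.PositiveCompacts G)

instance compactHaar_isProbabilityMeasure [MeasurableSpace G] [BorelSpace G] :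
    MeasureTheory.IsProbabilityMeasure (compactHaar G) :=
  ⟨by simpa using MeasureTheory.Measure.addHaarMeasure_self (K₀ :=
      (⊤ : TopologicalSpace.PositiveCompacts G))⟩

theorem compactVol_eq [m : MeasurableSpace G] [h : BorelSpace G] (C : Set G) :
    compactVol C = (compactHaar G).real C := by
  obtain rfl := h.measurable_eq
  rfl

theorem compactVol_nonneg (C : Set G) : 0 ≤ compactVol C := by
  borelize G
  rw [compactVol_eq]
  exact MeasureTheory.measureReal_nonneg

theorem compactVol_univ : compactVol (Set.univ : Set G) = 1 := by
  borelize G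
  rw [compactVol_eq]
  simp

theorem compactVol_empty : compactVol (∅ : Set G) = 0 := by
  borelize G
  rw [compactVol_eq]
  simp

/-- The push-forward of a Haar probability measure under a continuous surjection is again one, and
such a measure is unique. -/
theorem compactVol_preimage_hom (f : G →+ H) (hf : Continuous f) (hs : Function.Surjective f)
    {C : Set H} (hC : IsOpen C) : compactVol (f ⁻¹' C) = compactVol C := by
  borelize G
  borelize H
  rw [compactVol_eq, compactVol_eq]
  have h1 : ((compactHaar G).map f).IsAddHaarMeasure :=
    MeasureTheory.Measure.isAddHaarMeasure_map_of_isFiniteMeasure _ f hf hs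
  have h2 : MeasureTheory.IsProbabilityMeasure ((compactHaar G).map f) :=
    MeasureTheory.Measure.isProbabilityMeasure_map hf.measurable.aemeasurable
  rw [← MeasureTheory.Measure.isAddHaarMeasure_eq_of_isProbabilityMeasure
    ((compactHaar G).map f) (compactHaar H), MeasureTheory.measureReal_def,
    MeasureTheory.measureReal_def, MeasureTheory.Measure.map_apply hf.measurable hC.measurableSet]

theorem compactVol_preimage_add_left (a : G) (C : Set G) :
    compactVol ((fun x => a + x) ⁻¹' C) = compactVol C := by
  borelize G
  rw [compactVol_eq, compactVol_eq, MeasureTheory.measureReal_def, MeasureTheory.measureReal_def,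
    MeasureTheory.measure_preimage_add]

/-- Finite additivity. Only the pieces inside `C` are required to be open, because the labelling `h`
will be a choice function with no regularity outside `C`. -/
theorem compactVol_eq_sum_fiber {W : Type*} [Fintype W] (h : G → W) {C : Set G}
    (hC : ∀ w, IsOpen (C ∩ h ⁻¹' {w})) :
    compactVol C = ∑ w, compactVol (C ∩ h ⁻¹' {w}) := by
  borelize G
  simp only [compactVol_eq]
  have : C = ⋃ w, (C ∩ h ⁻¹' {w}) := by
    ext x; simp
  conv_lhs => rw [this]
  rw [MeasureTheory.measureReal_iUnion_fintype]
  · intro a b hab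
    refine Set.disjoint_left.2 fun x hx hx' => hab ?_
    rw [← hx.2, ← hx'.2]
  · exact fun w => (hC w).measurableSet

/-- The fibres are translates of the open kernel and have equal volume, so volume is counting in the
quotient. -/
theorem compactVol_preimage_finite {A : Type*} [AddGroup A] [Finite A] (f : G →+ A)
    (hs : Function.Surjective f) (hf : IsOpen (f ⁻¹' {0})) (S : Set A) :
    compactVol (f ⁻¹' S) = S.ncard / Nat.card A := by
  classical
  have := Fintype.ofFinite A
  have hfib : ∀ a, ∃ g : G, f ⁻¹' {a} = (fun x => g + x) ⁻¹' (f ⁻¹' {0}) := by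
    intro a
    obtain ⟨g, hg⟩ := hs (-a)
    refine ⟨g, ?_⟩
    ext x
    simp only [Set.mem_preimage, Set.mem_singleton_iff, map_add, hg]
    rw [neg_add_eq_zero, eq_comm]
  have hopen : ∀ a, IsOpen (f ⁻¹' {a}) := by
    intro a
    obtain ⟨g, hg⟩ := hfib a
    rw [hg]
    exact hf.preimage (continuous_const.add continuous_id)
  have hvol : ∀ a, compactVol (f ⁻¹' {a}) = compactVol (f ⁻¹' {0}) := by
    intro a
    obtain ⟨g, hg⟩ := hfib a
    rw [hg, compactVol_preimage_add_left]
  have hsum : ∀ S : Set A, compactVol (f ⁻¹' S) = S.ncard * compactVol (f ⁻¹' {0}) := by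
    intro S
    rw [compactVol_eq_sum_fiber f (C := f ⁻¹' S)]
    · have : ∀ a : A, compactVol (f ⁻¹' S ∩ f ⁻¹' {a}) =
          if a ∈ S then compactVol (f ⁻¹' {0}) else 0 := by
        intro a
        split_ifs with h
        · rw [← hvol a, ← Set.preimage_inter, Set.inter_eq_self_of_subset_right]
          simpa using h
        · rw [← Set.preimage_inter]
          convert compactVol_empty (G := G)
          ext x
          simp only [Set.mem_preimage, Set.mem_inter_iff, Set.mem_singleton_iff,
            Set.mem_empty_iff_false, iff_false, not_and]
          rintro hx rfl
          exact h hx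
      simp only [this, ← Finset.sum_filter, Finset.sum_const, nsmul_eq_mul]
      congr 2
      rw [Set.ncard_eq_toFinset_card']
      congr 1
      ext; simp
    · intro a
      by_cases h : a ∈ S
      · rw [← Set.preimage_inter, Set.inter_eq_self_of_subset_right (by simpa using h)]
        exact hopen a
      · convert isOpen_empty
        ext x
        simp only [Set.mem_inter_iff, Set.mem_preimage, Set.mem_singleton_iff,
          Set.mem_empty_iff_false, iff_false, not_and]
        rintro hx rfl
        exact h hx
  have h1 := hsum Set.univ
  rw [Set.preimage_univ, compactVol_univ, Set.ncard_univ] at h1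
  have hA : (Nat.card A : ℝ) ≠ 0 := by
    exact_mod_cast Nat.card_pos.ne'
  rw [hsum S, eq_div_iff hA, mul_assoc, mul_comm (compactVol _), ← h1, mul_one]

/-- Fubini when all nonempty slices have the same volume; the product of the two Haar probability
measures is the Haar measure of the product. -/
theorem compactVol_prod [SecondCountableTopology H] {C : Set (G × H)} (hC : IsOpen C)
    {D : Set G} (hD : IsOpen D) {c : ℝ}
    (h : ∀ g ∈ D, compactVol {x | (g, x) ∈ C} = c)
    (h' : ∀ g ∉ D, {x | (g, x) ∈ C} = ∅) :
    compactVol C = compactVol D * c := by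
  borelize G
  borelize H
  by_cases hne : D.Nonempty
  · have hc : 0 ≤ c := by
      obtain ⟨g, hg⟩ := hne
      rw [← h g hg]; exact compactVol_nonneg _
    simp only [compactVol_eq] at h ⊢
    have h1 : ((compactHaar G).prod (compactHaar H)).IsAddHaarMeasure := inferInstance
    rw [← MeasureTheory.Measure.isAddHaarMeasure_eq_of_isProbabilityMeasure
      ((compactHaar G).prod (compactHaar H)) (compactHaar (G × H)),
      MeasureTheory.measureReal_def, MeasureTheory.Measure.prod_apply hC.measurableSet]
    have : ∀ g, compactHaar H (Prod.mk g ⁻¹' C) = D.indicator (fun _ => ENNReal.ofReal c) g := by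
      intro g
      by_cases hg : g ∈ D
      · rw [Set.indicator_of_mem hg, ← h g hg]
        simp [Set.preimage]
      · rw [Set.indicator_of_notMem hg]
        have := h' g hg
        change compactHaar H {x | (g, x) ∈ C} = 0
        rw [this]; simp
    simp only [this]
    rw [MeasureTheory.lintegral_indicator hD.measurableSet, MeasureTheory.setLIntegral_const,
      ENNReal.toReal_mul, ENNReal.toReal_ofReal hc, MeasureTheory.measureReal_def, mul_comm]
  · rw [Set.not_nonempty_iff_eq_empty] at hne
    subst hne
    have : C = ∅ := by
      ext ⟨g, x⟩
      have := h' g (by simp)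
      simpa using Set.ext_iff.1 this x
    rw [this, compactVol_empty, compactVol_empty, zero_mul]

/-- The measure pulled back along `f` is invariant, hence a multiple of Haar measure; the multiple
is read off on the whole group. -/
theorem compactVol_image (f : G →+ G) (hf : IsOpenEmbedding f) (C : Set G) :
    compactVol (f '' C) = compactVol (Set.range f) * compactVol C := by
  borelize G
  have h1 : ((compactHaar G).comap f).IsAddHaarMeasure :=
    MeasureTheory.Measure.IsAddHaarMeasure.comap (mH := inferInstance) _ hf
  have h2 := MeasureTheory.Measure.isAddInvariant_eq_smul_of_compactSpace
    ((compactHaar G).comap f) (compactHaar G)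
  have key : ∀ C : Set G, compactHaar G (f '' C) =
      ((compactHaar G).comap f).addHaarScalarFactor (compactHaar G) • compactHaar G C := by
    intro C
    rw [← hf.measurableEmbedding.comap_apply]
    exact congrArg (fun m => m C) h2
  simp only [compactVol_eq, MeasureTheory.measureReal_def]
  rw [← Set.image_univ, key C, key Set.univ]
  simp [ENNReal.smul_def]

end CompactVolume

/-! ### Topology and finite quotients of the ring of integers -/

section Integers

variable {F : Type*} [Field F] [ValuativeRel F] [TopologicalSpace F]
  [IsNonarchimedeanLocalField F]

/-- The rank one valuation gives a norm for which the locally compact field is proper. Second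
countability is what Fubini needs; separation makes injective continuous maps of the compact groups
closed embeddings. -/
theorem localField_topology : T2Space F ∧ SecondCountableTopology F := by
  let := IsTopologicalAddGroup.rightUniformSpace F
  have := isUniformAddGroup_of_addCommGroup (G := F)
  let : (Valued.v (R := F)).RankOne :=
  { hom' := IsRankLeOne.nonempty.some.emb (R := F).comp MonoidWithZeroHom.ValueGroup₀.embedding
    strictMono' := IsRankLeOne.nonempty.some.strictMono.comp
        MonoidWithZeroHom.ValueGroup₀.embedding_strictMono }
  open scoped Valued in
  have : ProperSpace F := .of_nontriviallyNormedField_of_weaklyLocallyCompactSpace F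
  open scoped Valued in
  exact ⟨inferInstance, secondCountable_of_proper (α := F)⟩

instance t2Space_localField : T2Space F := localField_topology.1

instance secondCountable_localField : SecondCountableTopology F := localField_topology.2

instance t2Space_integers : T2Space 𝒪[F] := inferInstanceAs (T2Space {x : F // x ∈ 𝒪[F]})

instance secondCountable_integers : SecondCountableTopology 𝒪[F] :=
  TopologicalSpace.Subtype.secondCountableTopology {x : F | x ∈ 𝒪[F]}

instance secondCountable_integralMatrix {m n : Type*} [Finite m] [Finite n] :
    SecondCountableTopology (Matrix m n 𝒪[F]) := by
  have := Fintype.ofFinite m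
  have := Fintype.ofFinite n
  exact inferInstanceAs (SecondCountableTopology (m → n → 𝒪[F]))

/-- A closed subgroup of finite index is open. -/
theorem isOpen_dvd_pow (ϖ : 𝒪[F]) (hϖ : Irreducible ϖ) (e : ℕ) :
    IsOpen {x : 𝒪[F] | ϖ ^ e ∣ x} := by
  have hfin := finite_quotient_maximalIdeal_pow (F := F) e
  have h0 : ((𝓂[F] ^ e : Ideal 𝒪[F]) : Set 𝒪[F]) = {x : 𝒪[F] | ϖ ^ e ∣ x} := by
    ext x
    rw [hϖ.maximalIdeal_eq, Ideal.span_singleton_pow, SetLike.mem_coe, Ideal.mem_span_singleton]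
    rfl
  rw [← h0]
  have : (𝓂[F] ^ e : Ideal 𝒪[F]).toAddSubgroup.FiniteIndex := by
    have : Finite (𝒪[F] ⧸ (𝓂[F] ^ e : Ideal 𝒪[F]).toAddSubgroup) := hfin
    exact AddSubgroup.finiteIndex_of_finite_quotient
  exact AddSubgroup.isOpen_of_isClosed_of_finiteIndex (𝓂[F] ^ e : Ideal 𝒪[F]).toAddSubgroup
    (IsNoetherianRing.isClosed_ideal (𝓂[F] ^ e))

theorem card_quotient_pow (ϖ : 𝒪[F]) (hϖ : Irreducible ϖ) (e : ℕ) :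
    Nat.card (𝒪[F] ⧸ Ideal.span {ϖ ^ e}) = residueCard F ^ e := by
  have := Ideal.IsMaximal.isPrime (inferInstance : (𝓂[F]).IsMaximal)
  have h := cardQuot_pow_of_prime (P := 𝓂[F]) (i := e)
    (by rw [hϖ.maximalIdeal_eq]; simpa using hϖ.ne_zero)
  rw [Submodule.cardQuot_apply, Submodule.cardQuot_apply] at h
  rw [← Ideal.span_singleton_pow, ← hϖ.maximalIdeal_eq]
  exact h

instance finite_quotient_span_pow (ϖ : 𝒪[F]) [h : Fact (Irreducible ϖ)] (e : ℕ) :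
    Finite (𝒪[F] ⧸ Ideal.span {ϖ ^ e}) := by
  have := finite_quotient_maximalIdeal_pow (F := F) e
  rwa [h.out.maximalIdeal_eq, Ideal.span_singleton_pow] at this

end Integers

/-! ### Half-integral matrices and the approximate solution of T[U] = T' -/

section MatrixBasics

variable {F : Type*} [Field F] [ValuativeRel F]

@[simp] theorem toField_apply {m n : Type*} (X : Matrix m n 𝒪[F]) (i : m) (j : n) :
    toField X i j = (X i j : F) := rfl

theorem toField_mul {l m n : Type*} [Fintype m] (X : Matrix l m 𝒪[F]) (Y : Matrix m n 𝒪[F]) :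
    toField (X * Y) = toField X * toField Y :=
  Matrix.map_mul (f := 𝒪[F].subtype)

theorem toField_add {m n : Type*} (X Y : Matrix m n 𝒪[F]) :
    toField (X + Y) = toField X + toField Y := by
  ext; simp

theorem toField_neg {m n : Type*} (X : Matrix m n 𝒪[F]) :
    toField (-X) = -toField X := by
  ext; simp

theorem toField_sub {m n : Type*} (X Y : Matrix m n 𝒪[F]) :
    toField (X - Y) = toField X - toField Y := by
  ext; simp

theorem toField_smul {m n : Type*} (a : 𝒪[F]) (X : Matrix m n 𝒪[F]) :
    toField (a • X) = (a : F) • toField X := by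
  ext; simp

theorem toField_transpose {m n : Type*} (X : Matrix m n 𝒪[F]) :
    toField Xᵀ = (toField X)ᵀ := rfl

theorem toField_one {n : Type*} [DecidableEq n] : toField (1 : Matrix n n 𝒪[F]) = 1 := by
  ext i j
  by_cases h : i = j
  · subst h; simp
  · simp [h]

theorem quadSubst_mul {m n l : Type*} [Fintype m] [Fintype n] (S : Matrix m m F)
    (X : Matrix m n F) (Y : Matrix n l F) :
    quadSubst S (X * Y) = quadSubst (quadSubst S X) Y := by
  simp only [quadSubst, Matrix.transpose_mul, Matrix.mul_assoc]

theorem quadSubst_sub {m n : Type*} [Fintype m] (S T : Matrix m m F) (X : Matrix m n F) :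
    quadSubst (S - T) X = quadSubst S X - quadSubst T X := by
  simp only [quadSubst, Matrix.mul_sub, Matrix.sub_mul]

theorem quadSubst_smul {m n : Type*} [Fintype m] (a : F) (S : Matrix m m F) (X : Matrix m n F) :
    quadSubst (a • S) X = a • quadSubst S X := by
  simp only [quadSubst, Matrix.mul_smul, Matrix.smul_mul]

theorem quadSubst_one {m : Type*} [Fintype m] [DecidableEq m] (S : Matrix m m F) :
    quadSubst S 1 = S := by
  simp [quadSubst]

theorem quadSubst_isSymm {m n : Type*} [Fintype m] {S : Matrix m m F} (hS : S.IsSymm)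
    (X : Matrix m n F) : (quadSubst S X).IsSymm := by
  simp only [quadSubst, Matrix.IsSymm, Matrix.transpose_mul, Matrix.transpose_transpose,
    hS.eq, Matrix.mul_assoc]

variable [CharZero F]

/-- A half-integral matrix is the symmetrization of an integral matrix. -/
theorem isHalfIntegral_iff {n : Type*} {Z : Matrix n n F} :
    IsHalfIntegral Z ↔
      ∃ V : Matrix n n 𝒪[F], Z = (1 / 2 : F) • (toField V + (toField V)ᵀ) := by
  classical
  constructor
  · rintro ⟨hs, hd, ho⟩
    -- An arbitrary linear order selects one triangle: `V` carries the diagonal, the doubled entries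
    -- on one side, and zero on the other.
    let r : n → n → Prop := WellOrderingRel
    have hr : ∀ i j, i ≠ j → (r i j ∧ ¬ r j i) ∨ (¬ r i j ∧ r j i) := by
      intro i j hij
      rcases trichotomous_of r i j with h | h | h
      · exact Or.inl ⟨h, fun h' => asymm_of r h h'⟩
      · exact absurd h hij
      · exact Or.inr ⟨fun h' => asymm_of r h h', h⟩
    refine ⟨Matrix.of fun i j => if h : i = j then ⟨Z i i, hd i⟩ else
      if r i j then ⟨2 * Z i j, ho i j h⟩ else 0, ?_⟩
    ext i j
    by_cases hij : i = j
    · subst hij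
      simp only [Matrix.smul_apply, Matrix.add_apply, toField_apply, Matrix.of_apply, dite_true,
        Matrix.transpose_apply, smul_eq_mul]
      ring
    · have hji : ¬ j = i := fun h => hij h.symm
      have hsym := hs.apply i j
      rcases hr i j hij with ⟨h, h'⟩ | ⟨h, h'⟩ <;>
      · simp only [Matrix.smul_apply, Matrix.add_apply, toField_apply, Matrix.of_apply, hij, hji,
          Matrix.transpose_apply, smul_eq_mul, dite_false, h, h', if_true, if_false,
          ZeroMemClass.coe_zero, hsym]
        ring
  · rintro ⟨V, rfl⟩
    refine ⟨?_, fun i => ?_, fun i j _ => ?_⟩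
    · ext i j
      simp only [Matrix.transpose_apply, Matrix.smul_apply, Matrix.add_apply, add_comm]
    · have : ((1 / 2 : F) • (toField V + (toField V)ᵀ)) i i = (V i i : F) := by
        simp only [Matrix.smul_apply, Matrix.add_apply, toField_apply, Matrix.transpose_apply,
          smul_eq_mul]
        ring
      rw [this]; exact (V i i).2
    · have : 2 * ((1 / 2 : F) • (toField V + (toField V)ᵀ)) i j = ((V i j + V j i : 𝒪[F]) : F) := by
        simp only [Matrix.smul_apply, Matrix.add_apply, toField_apply, Matrix.transpose_apply,
          smul_eq_mul]
        push_cast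
        ring
      rw [this]; exact (V i j + V j i).2

theorem memPowHalfIntegral_iff_exists {n : Type*} {ϖ : 𝒪[F]} {e : ℕ} {M : Matrix n n F} :
    MemPowHalfIntegral ϖ e M ↔
      ∃ V : Matrix n n 𝒪[F], M = (ϖ : F) ^ e • (1 / 2 : F) • (toField V + (toField V)ᵀ) := by
  constructor
  · rintro ⟨Z, hZ, rfl⟩
    obtain ⟨V, rfl⟩ := isHalfIntegral_iff.1 hZ
    exact ⟨V, rfl⟩
  · rintro ⟨V, rfl⟩
    exact ⟨_, isHalfIntegral_iff.2 ⟨V, rfl⟩, rfl⟩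

theorem memPowHalfIntegral_zero {n : Type*} {ϖ : 𝒪[F]} {M : Matrix n n F} :
    MemPowHalfIntegral ϖ 0 M ↔ IsHalfIntegral M := by
  constructor
  · rintro ⟨Z, hZ, rfl⟩
    simpa using hZ
  · exact fun h => ⟨M, h, by simp⟩

theorem MemPowHalfIntegral.add {n : Type*} {ϖ : 𝒪[F]} {e : ℕ} {M N : Matrix n n F}
    (hM : MemPowHalfIntegral ϖ e M) (hN : MemPowHalfIntegral ϖ e N) :
    MemPowHalfIntegral ϖ e (M + N) := by
  rw [memPowHalfIntegral_iff_exists] at *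
  obtain ⟨V, rfl⟩ := hM
  obtain ⟨W, rfl⟩ := hN
  refine ⟨V + W, ?_⟩
  rw [toField_add, Matrix.transpose_add, ← smul_add, ← smul_add]
  congr 2
  abel

theorem MemPowHalfIntegral.neg {n : Type*} {ϖ : 𝒪[F]} {e : ℕ} {M : Matrix n n F}
    (hM : MemPowHalfIntegral ϖ e M) : MemPowHalfIntegral ϖ e (-M) := by
  rw [memPowHalfIntegral_iff_exists] at *
  obtain ⟨V, rfl⟩ := hM
  refine ⟨-V, ?_⟩
  rw [toField_neg, Matrix.transpose_neg, ← smul_neg, ← smul_neg]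
  congr 2
  abel

theorem MemPowHalfIntegral.sub {n : Type*} {ϖ : 𝒪[F]} {e : ℕ} {M N : Matrix n n F}
    (hM : MemPowHalfIntegral ϖ e M) (hN : MemPowHalfIntegral ϖ e N) :
    MemPowHalfIntegral ϖ e (M - N) := by
  rw [sub_eq_add_neg]; exact hM.add hN.neg

theorem MemPowHalfIntegral.smul {n : Type*} {ϖ : 𝒪[F]} {e : ℕ} {M : Matrix n n F}
    (hM : MemPowHalfIntegral ϖ e M) (a : 𝒪[F]) : MemPowHalfIntegral ϖ e ((a : F) • M) := by
  rw [memPowHalfIntegral_iff_exists] at *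
  obtain ⟨V, rfl⟩ := hM
  refine ⟨a • V, ?_⟩
  rw [toField_smul, Matrix.transpose_smul, ← smul_add, smul_comm (a : F), smul_comm (a : F)]

theorem MemPowHalfIntegral.mono {n : Type*} {ϖ : 𝒪[F]} {d e : ℕ} (h : d ≤ e) {M : Matrix n n F}
    (hM : MemPowHalfIntegral ϖ e M) : MemPowHalfIntegral ϖ d M := by
  rw [memPowHalfIntegral_iff_exists] at *
  obtain ⟨V, rfl⟩ := hM
  obtain ⟨b, rfl⟩ := Nat.exists_eq_add_of_le h
  refine ⟨ϖ ^ b • V, ?_⟩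
  rw [toField_smul, Matrix.transpose_smul, ← smul_add, pow_add, mul_smul]
  push_cast
  rw [smul_comm (1 / 2 : F)]

theorem MemPowHalfIntegral.quadSubst {m n : Type*} [Fintype m] {ϖ : 𝒪[F]} {e : ℕ}
    {M : Matrix m m F} (hM : MemPowHalfIntegral ϖ e M) (U : Matrix m n 𝒪[F]) :
    MemPowHalfIntegral ϖ e (quadSubst M (toField U)) := by
  rw [memPowHalfIntegral_iff_exists] at *
  obtain ⟨V, rfl⟩ := hM
  refine ⟨Uᵀ * V * U, ?_⟩
  rw [quadSubst_smul, quadSubst_smul]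
  congr 2
  simp only [_root_.quadSubst, toField_mul, toField_transpose, Matrix.transpose_mul, Matrix.mul_add,
    Matrix.add_mul, Matrix.transpose_transpose, Matrix.mul_assoc]

theorem IsHalfIntegral.quadSubst {m n : Type*} [Fintype m] {M : Matrix m m F}
    (hM : IsHalfIntegral M) (U : Matrix m n 𝒪[F]) :
    IsHalfIntegral (quadSubst M (toField U)) := by
  rw [← memPowHalfIntegral_zero (ϖ := 0)] at *
  exact hM.quadSubst U

theorem memPowHalfIntegral_symmetrize {n : Type*} {ϖ : 𝒪[F]} (e : ℕ) (V : Matrix n n 𝒪[F]) :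
    MemPowHalfIntegral ϖ e ((ϖ : F) ^ e • (1 / 2 : F) • (toField V + (toField V)ᵀ)) :=
  memPowHalfIntegral_iff_exists.2 ⟨V, rfl⟩

/-- Twice a half-integral matrix is integral. -/
theorem IsHalfIntegral.exists_two_smul {n : Type*} {T : Matrix n n F} (hT : IsHalfIntegral T) :
    ∃ T' : Matrix n n 𝒪[F], (2 : F) • T = toField T' := by
  obtain ⟨V, rfl⟩ := isHalfIntegral_iff.1 hT
  exact ⟨V + Vᵀ, by rw [smul_smul, toField_add, toField_transpose]; norm_num⟩

/-- The cross terms are ϖ^e times the symmetrization of ᵗX(2S)Z, where 2S is integral, and the last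
term is ϖ^{2e}S[Z]. Consequently the condition S[X] ≡ T mod ϖ^e depends only on X modulo ϖ^e. -/
theorem memPowHalfIntegral_quadSubst_sub {m n : Type*} [Fintype m] {ϖ : 𝒪[F]}
    {S : Matrix m m F} (hS : IsHalfIntegral S) (e : ℕ) (X Z : Matrix m n 𝒪[F]) :
    MemPowHalfIntegral ϖ e
      (quadSubst S (toField (X + ϖ ^ e • Z)) - quadSubst S (toField X)) := by
  obtain ⟨S', hS'⟩ := hS.exists_two_smul
  have h1 : quadSubst S (toField (X + ϖ ^ e • Z)) - quadSubst S (toField X) =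
      (ϖ : F) ^ e • (1 / 2 : F) • (toField (Xᵀ * S' * Z) + (toField (Xᵀ * S' * Z))ᵀ) +
        ((ϖ ^ e * ϖ ^ e : 𝒪[F]) : F) • quadSubst S (toField Z) := by
    have hS2 : S = (1 / 2 : F) • toField S' := by rw [← hS', smul_smul]; norm_num
    have hS3 : (toField S')ᵀ = toField S' := by
      rw [← hS', Matrix.transpose_smul, hS.1.eq]
    rw [hS2]
    simp only [quadSubst, toField_add, toField_smul, toField_mul, toField_transpose,
      Matrix.transpose_add, Matrix.transpose_smul, Matrix.transpose_mul, hS3,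
      Matrix.transpose_transpose, Matrix.mul_add, Matrix.add_mul, Matrix.mul_smul,
      Matrix.smul_mul, smul_add, Matrix.mul_assoc]
    push_cast
    simp only [smul_smul, mul_comm (1 / 2 : F), mul_assoc]
    abel
  rw [h1]
  refine (memPowHalfIntegral_symmetrize e _).add ?_
  rw [Subring.coe_mul, mul_smul]
  have h2 := (memPowHalfIntegral_zero (ϖ := ϖ)).2 (hS.quadSubst Z)
  refine ⟨_, memPowHalfIntegral_zero.1 (h2.smul (ϖ ^ e)), ?_⟩
  push_cast; rfl

/-- An approximate solution of `T[U] = T'` with `U` close to the identity. -/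
theorem exists_quadSubst_sub_memPow {n : Type*} [Fintype n] [DecidableEq n] {ϖ : 𝒪[F]}
    (hu : ¬ IsUnit ϖ) {T T' : Matrix n n F} (hT : IsHalfIntegral T) {a l b : ℕ} {c : 𝒪[F]}
    (ha : 0 < a) (hc : (c : F) * ((2 : F) • T).det = (ϖ : F) ^ l) [IsLocalRing 𝒪[F]]
    (h : MemPowHalfIntegral ϖ (a + l + b) (T' - T)) :
    ∃ U : Matrix n n 𝒪[F], IsUnit U ∧
      MemPowHalfIntegral ϖ (2 * a) (quadSubst T (toField U) - T') := by
  obtain ⟨T2, hT2⟩ := hT.exists_two_smul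
  obtain ⟨V, hV⟩ := memPowHalfIntegral_iff_exists.1 h
  have hdet : ((2 : F) • T).det = (T2.det : F) := by
    rw [hT2]
    exact (RingHom.map_det 𝒪[F].subtype T2).symm
  rw [hdet] at hc
  have hc' : c * T2.det = ϖ ^ l := by
    apply Subtype.ext; push_cast; exact hc
  -- Cramer's rule for 2T·Y = ϖ^{l+b}V, using c·det(2T) = ϖ^l.
  let Y : Matrix n n 𝒪[F] := (ϖ ^ b * c) • (T2.adjugate * V)
  have hY : T2 * Y = ϖ ^ (l + b) • V := by
    simp only [Y, Matrix.mul_smul, ← Matrix.mul_assoc, Matrix.mul_adjugate, Matrix.smul_mul,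
      Matrix.one_mul, smul_smul]
    rw [mul_assoc, hc', ← pow_add, add_comm b l]
  have hTY : T * toField Y = (1 / 2 : F) • (ϖ : F) ^ (l + b) • toField V := by
    have : T = (1 / 2 : F) • toField T2 := by rw [← hT2, smul_smul]; norm_num
    rw [this, Matrix.smul_mul, ← toField_mul, hY, toField_smul]
    push_cast; rfl
  -- One Newton step: the part of T[1 + ϖ^a Y] linear in Y is exactly T' - T, so the error is the
  -- quadratic term ϖ^{2a}T[Y].
  refine ⟨1 + ϖ ^ a • Y, ?_, ?_⟩
  · rw [Matrix.isUnit_iff_isUnit_det, ← IsLocalRing.residue_ne_zero_iff_isUnit, RingHom.map_det]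
    have : (IsLocalRing.residue 𝒪[F]).mapMatrix (1 + ϖ ^ a • Y) = 1 := by
      rw [map_add, map_one]
      have hz : (IsLocalRing.residue 𝒪[F]) ϖ = 0 := by
        rw [IsLocalRing.residue_eq_zero_iff]; exact (IsLocalRing.mem_maximalIdeal _).2 hu
      ext s t : 2
      simp [hz, ha.ne']
    rw [this]; simp
  · have hYT : (toField Y)ᵀ * T = (1 / 2 : F) • (ϖ : F) ^ (l + b) • (toField V)ᵀ := by
      have := congrArg Matrix.transpose hTY
      rwa [Matrix.transpose_mul, hT.1.eq, Matrix.transpose_smul, Matrix.transpose_smul] at this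
    have h1 : quadSubst T (toField (1 + ϖ ^ a • Y)) - T' =
        ((ϖ ^ (2 * a) : 𝒪[F]) : F) • quadSubst T (toField Y) := by
      have h2 : T' = T + (ϖ : F) ^ (a + l + b) • (1 / 2 : F) • (toField V + (toField V)ᵀ) := by
        rw [← hV]; abel
      rw [h2]
      simp only [quadSubst, toField_add, toField_smul, toField_one, Matrix.transpose_add,
        Matrix.transpose_one, Matrix.transpose_smul, Matrix.add_mul, Matrix.mul_add,
        Matrix.one_mul, Matrix.mul_one, Matrix.smul_mul, Matrix.mul_smul, hTY, hYT]
      push_cast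
      simp only [smul_smul, smul_add]
      have e1 : (ϖ : F) ^ a * (1 / 2 * (ϖ : F) ^ (l + b)) = (ϖ : F) ^ (a + l + b) * (1 / 2) := by
        ring
      have e2 : (ϖ : F) ^ a * ((ϖ : F) ^ (a + l + b) * (1 / 2)) =
          (ϖ : F) ^ (2 * a) * (1 / 2 * (ϖ : F) ^ (l + b)) := by ring
      rw [e1, e2]
      abel
    rw [h1]
    exact ⟨_, hT.quadSubst Y, by push_cast; rfl⟩

end MatrixBasics

/-! ### Coordinates on symmetric matrices -/

section SymCoordinates

variable {F : Type*} [Field F] [ValuativeRel F]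

/-- The coordinates of a symmetric matrix: the diagonal entries and the doubled off-diagonal
entries. -/
def symCoord {n : Type*} [DecidableEq n] (M : Matrix n n F) (s : Sym2 n) : F :=
  Sym2.lift ⟨fun i j => if i = j then M i i else M i j + M j i, fun i j => by
    by_cases h : i = j
    · subst h; rfl
    · simp only [if_neg h, if_neg (Ne.symm h), add_comm]⟩ s

theorem symCoord_mk {n : Type*} [DecidableEq n] (M : Matrix n n F) (i j : n) :
    symCoord M s(i, j) = if i = j then M i i else M i j + M j i := rfl

/-- The symmetric matrix with given coordinates. -/
noncomputable def symMat {n : Type*} [DecidableEq n] (z : Sym2 n → F) : Matrix n n F :=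
  Matrix.of fun i j => if i = j then z s(i, j) else z s(i, j) / 2

theorem symMat_isSymm {n : Type*} [DecidableEq n] (z : Sym2 n → F) : (symMat z).IsSymm := by
  ext i j
  simp only [symMat, Matrix.transpose_apply, Matrix.of_apply, Sym2.eq_swap (a := j) (b := i),
    eq_comm (a := j) (b := i)]

theorem symCoord_smul {n : Type*} [DecidableEq n] (a : F) (M : Matrix n n F) :
    symCoord (a • M) = a • symCoord M := by
  ext s
  induction s with | _ i j
  simp only [symCoord_mk, Pi.smul_apply, Matrix.smul_apply, smul_eq_mul]
  split_ifs <;> ring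

theorem symCoord_sub {n : Type*} [DecidableEq n] (M N : Matrix n n F) :
    symCoord (M - N) = symCoord M - symCoord N := by
  ext s
  induction s with | _ i j
  simp only [symCoord_mk, Pi.sub_apply, Matrix.sub_apply]
  split_ifs <;> ring

variable [CharZero F]

theorem symCoord_symMat {n : Type*} [DecidableEq n] (z : Sym2 n → F) :
    symCoord (symMat z) = z := by
  ext s
  induction s with | _ i j
  simp only [symCoord_mk, symMat, Matrix.of_apply]
  split_ifs with h h'
  · subst h; rfl
  · exact absurd h'.symm h
  · rw [Sym2.eq_swap (a := j) (b := i)]; ring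

theorem symMat_symCoord {n : Type*} [DecidableEq n] {M : Matrix n n F} (hM : M.IsSymm) :
    symMat (symCoord M) = M := by
  ext i j
  simp only [symMat, symCoord_mk, Matrix.of_apply]
  split_ifs with h
  · subst h; rfl
  · rw [hM.apply i j]; ring

/-- Symmetric matrices whose coordinates are divisible by prescribed powers of `ϖ`. -/
def BoxMem (ϖ : 𝒪[F]) {n : Type*} [DecidableEq n] (ε : Sym2 n → ℕ) (M : Matrix n n F) : Prop :=
  M.IsSymm ∧ ∀ s, ∃ a : 𝒪[F], symCoord M s = (ϖ : F) ^ ε s * a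

/-- Diagonal entries and doubled off-diagonal entries are the coordinates in which H_n is the
standard lattice. Boxes with varying exponents appear when a diagonal matrix of powers of ϖ is
substituted. -/
theorem memPowHalfIntegral_iff_boxMem {ϖ : 𝒪[F]} {n : Type*} [DecidableEq n] {e : ℕ}
    {M : Matrix n n F} : MemPowHalfIntegral ϖ e M ↔ BoxMem ϖ (fun _ => e) M := by
  constructor
  · rintro ⟨Z, ⟨hs, hd, ho⟩, rfl⟩
    refine ⟨hs.smul _, fun s => ?_⟩
    rw [symCoord_smul]
    induction s with | _ i j
    by_cases h : i = j
    · exact ⟨⟨Z i i, hd i⟩, by simp [symCoord_mk, h]⟩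
    · refine ⟨⟨2 * Z i j, ho i j h⟩, ?_⟩
      simp only [Pi.smul_apply, symCoord_mk, h, if_false, smul_eq_mul, hs.apply i j]
      ring
  · rintro ⟨hs, h⟩
    choose a ha using h
    refine ⟨symMat fun s => (a s : F), ⟨symMat_isSymm _, fun i => ?_, fun i j hij => ?_⟩, ?_⟩
    · simp [symMat]
    · simp only [symMat, Matrix.of_apply, hij, if_false]
      rw [mul_div_cancel₀ _ two_ne_zero]
      exact (a _).2
    · rw [← symMat_symCoord hs]
      ext i j
      simp only [symMat, Matrix.of_apply, Matrix.smul_apply, smul_eq_mul, ha]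
      split_ifs
      · rfl
      · ring

end SymCoordinates

/-! ### Solution sets of S[X] ≡ T and invariance of their volume -/

section SolutionSets

variable {F : Type*} [Field F] [ValuativeRel F] [TopologicalSpace F]
  [IsNonarchimedeanLocalField F]

theorem isOpen_of_add_mem {G : Type*} [TopologicalSpace G] [AddGroup G]
    [IsTopologicalAddGroup G] {C K : Set G} (hK : IsOpen K) (h0 : (0 : G) ∈ K)
    (h : ∀ x ∈ C, ∀ k ∈ K, x + k ∈ C) : IsOpen C := by
  rw [isOpen_iff_mem_nhds]
  intro x hx
  have h1 : (fun y => -x + y) ⁻¹' K ∈ 𝓝 x :=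
    (hK.preimage (continuous_const.add continuous_id)).mem_nhds (by simpa using h0)
  refine Filter.mem_of_superset h1 fun y hy => ?_
  have := h x hx _ hy
  simpa using this

theorem isOpen_dvd_matrix (ϖ : 𝒪[F]) (hϖ : Irreducible ϖ) (e : ℕ) (m n : Type*) [Finite m]
    [Finite n] : IsOpen {X : Matrix m n 𝒪[F] | ∀ i j, ϖ ^ e ∣ X i j} := by
  have : {X : Matrix m n 𝒪[F] | ∀ i j, ϖ ^ e ∣ X i j} =
      ⋂ i, ⋂ j, (fun X : Matrix m n 𝒪[F] => X i j) ⁻¹' {x | ϖ ^ e ∣ x} := by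
    ext X; simp
  rw [this]
  refine isOpen_iInter_of_finite fun i => isOpen_iInter_of_finite fun j => ?_
  exact (isOpen_dvd_pow ϖ hϖ e).preimage (continuous_id.matrix_elem i j)

theorem dvd_matrix_iff {m n : Type*} {a : 𝒪[F]} {X : Matrix m n 𝒪[F]} :
    (∀ i j, a ∣ X i j) ↔ ∃ Y : Matrix m n 𝒪[F], X = a • Y := by
  constructor
  · intro h
    choose Y hY using h
    exact ⟨Matrix.of Y, by ext i j; simp [hY]⟩
  · rintro ⟨Y, rfl⟩ i j
    simp

/-- A set of integral matrices depending only on residues modulo a power of `ϖ` is open. -/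
theorem isOpen_of_add_smul_mem (ϖ : 𝒪[F]) (hϖ : Irreducible ϖ) (e : ℕ) {m n : Type*} [Finite m]
    [Finite n] {C : Set (Matrix m n 𝒪[F])} (h : ∀ X ∈ C, ∀ Z, X + ϖ ^ e • Z ∈ C) : IsOpen C := by
  refine isOpen_of_add_mem (isOpen_dvd_matrix ϖ hϖ e m n) (by simp) fun X hX K hK => ?_
  obtain ⟨Y, rfl⟩ := dvd_matrix_iff.1 hK
  exact h X hX Y

variable [CharZero F]

theorem solSet_add_smul_mem {m n : Type*} [Fintype m] {ϖ : 𝒪[F]} {S : Matrix m m F}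
    (hS : IsHalfIntegral S) {e : ℕ} {T : Matrix n n F} {X : Matrix m n 𝒪[F]}
    (hX : X ∈ solSet ϖ e S T) (Z : Matrix m n 𝒪[F]) : X + ϖ ^ e • Z ∈ solSet ϖ e S T := by
  have := (memPowHalfIntegral_quadSubst_sub (ϖ := ϖ) hS e X Z).add hX
  simpa [solSet] using this

theorem isOpen_solSet {m n : Type*} [Fintype m] [Finite n] (ϖ : 𝒪[F]) (hϖ : Irreducible ϖ)
    (e : ℕ) {S : Matrix m m F} (hS : IsHalfIntegral S) (T : Matrix n n F) :
    IsOpen (solSet ϖ e S T) :=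
  isOpen_of_add_smul_mem ϖ hϖ e fun _ hX Z => solSet_add_smul_mem hS hX Z

theorem solSet_congr {m n : Type*} [Fintype m] {ϖ : 𝒪[F]} {e : ℕ} {S : Matrix m m F}
    {T T' : Matrix n n F} (h : MemPowHalfIntegral ϖ e (T' - T)) :
    solSet ϖ e S T' = solSet ϖ e S T := by
  ext X
  simp only [solSet, Set.mem_ofPred_eq]
  constructor
  · intro hX
    have := hX.add h
    simpa using this
  · intro hX
    have := hX.sub h
    simpa using this

theorem mul_mem_solSet {m n l : Type*} [Fintype m] [Fintype n] {ϖ : 𝒪[F]} {e : ℕ}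
    {S : Matrix m m F} {T : Matrix n n F} {X : Matrix m n 𝒪[F]} (hX : X ∈ solSet ϖ e S T)
    (U : Matrix n l 𝒪[F]) : X * U ∈ solSet ϖ e S (quadSubst T (toField U)) := by
  simp only [solSet, Set.mem_ofPred_eq, toField_mul, quadSubst_mul, ← quadSubst_sub] at hX ⊢
  exact hX.quadSubst U

theorem mul_mem_solSet_iff {m n : Type*} [Fintype m] [Fintype n] [DecidableEq n] {ϖ : 𝒪[F]}
    {e : ℕ} {S : Matrix m m F} {T : Matrix n n F} {X : Matrix m n 𝒪[F]}
    {U : Matrix n n 𝒪[F]} (hU : IsUnit U) :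
    X * U ∈ solSet ϖ e S (quadSubst T (toField U)) ↔ X ∈ solSet ϖ e S T := by
  refine ⟨fun h => ?_, fun h => mul_mem_solSet h U⟩
  obtain ⟨u, rfl⟩ := hU
  have := mul_mem_solSet h (u⁻¹).val
  rwa [← quadSubst_mul, ← toField_mul, Matrix.mul_assoc, ← Units.val_mul, mul_inv_cancel,
    Units.val_one, Matrix.mul_one, toField_one, quadSubst_one] at this

theorem compactVol_preimage_mul_right {m n : Type*} [Finite m] [Fintype n] [DecidableEq n]
    {U : Matrix n n 𝒪[F]} (hU : IsUnit U) {C : Set (Matrix m n 𝒪[F])} (hC : IsOpen C) :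
    compactVol ((fun X : Matrix m n 𝒪[F] => X * U) ⁻¹' C) = compactVol C := by
  refine compactVol_preimage_hom
    (AddMonoidHom.mk' (fun X : Matrix m n 𝒪[F] => X * U) fun X Y => Matrix.add_mul X Y U) ?_ ?_ hC
  · exact continuous_id.matrix_mul continuous_const
  · intro Y
    obtain ⟨u, rfl⟩ := hU
    refine ⟨Y * (u⁻¹).val, ?_⟩
    simp [Matrix.mul_assoc]

/-- Right multiplication by U ∈ GL_n preserves volume and matches the solutions for T with those for
T[U]. -/
theorem compactVol_solSet_quadSubst {m n : Type*} [Fintype m] [Fintype n] [DecidableEq n]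
    (ϖ : 𝒪[F]) (hϖ : Irreducible ϖ) (e : ℕ) {S : Matrix m m F} (hS : IsHalfIntegral S)
    (T : Matrix n n F) {U : Matrix n n 𝒪[F]} (hU : IsUnit U) :
    compactVol (solSet ϖ e S (quadSubst T (toField U))) = compactVol (solSet ϖ e S T) := by
  have h := compactVol_preimage_mul_right hU
    (isOpen_solSet ϖ hϖ e hS (quadSubst T (toField U)))
  have h2 : (fun X : Matrix m n 𝒪[F] => X * U) ⁻¹' solSet ϖ e S (quadSubst T (toField U)) =
      solSet ϖ e S T := by
    ext X
    rw [Set.mem_preimage]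
    exact mul_mem_solSet_iff (ϖ := ϖ) (e := e) (S := S) (T := T) (X := X) hU
  rw [h2] at h
  exact h.symm

/-- `ord (det (2T)) ≤ l`. -/
def DetBound (ϖ : 𝒪[F]) {n : Type*} [Fintype n] [DecidableEq n] (T : Matrix n n F) (l : ℕ) :
    Prop :=
  ∃ c : 𝒪[F], (c : F) * ((2 : F) • T).det = (ϖ : F) ^ l

theorem exists_mul_eq_of_ordLE {ϖ : 𝒪[F]} (hϖ : ϖ ≠ 0) {a : F} {l : ℕ} (h : OrdLE ϖ a l) :
    ∃ c : 𝒪[F], (c : F) * a = (ϖ : F) ^ l := by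
  have hϖ' : (ϖ : F) ≠ 0 := by simpa using hϖ
  have ha : a ≠ 0 := by
    rintro rfl
    rw [OrdLE, map_zero] at h
    exact pow_ne_zero l hϖ' ((map_eq_zero _).1 (le_antisymm h zero_le))
  have hva : valuation F a ≠ 0 := (map_ne_zero _).2 ha
  refine ⟨⟨(ϖ : F) ^ l / a, ?_⟩, div_mul_cancel₀ _ ha⟩
  change valuation F _ ≤ 1
  rw [map_div₀]
  exact (div_le_one₀ (zero_lt_iff.2 hva)).2 h

theorem exists_mul_eq_pow {ϖ : 𝒪[F]} (hϖ : Irreducible ϖ) {a : F} (ha : a ≠ 0) :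
    ∃ (l : ℕ) (c : 𝒪[F]), (c : F) * a = (ϖ : F) ^ l := by
  have hϖ' : (ϖ : F) ≠ 0 := by simpa using hϖ.ne_zero
  by_cases h : valuation F a ≤ 1
  · have h0 : (⟨a, h⟩ : 𝒪[F]) ≠ 0 := by
      intro h'; exact ha (congrArg Subtype.val h')
    obtain ⟨l, u, hu⟩ := IsDiscreteValuationRing.eq_unit_mul_pow_irreducible h0 hϖ
    refine ⟨l, (u⁻¹ : 𝒪[F]ˣ).val, ?_⟩
    have := congrArg (fun z : 𝒪[F] => ((u⁻¹ : 𝒪[F]ˣ).val * z)) hu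
    simp only [← mul_assoc, Units.inv_mul, one_mul] at this
    exact congrArg Subtype.val this
  · refine ⟨0, ⟨a⁻¹, ?_⟩, by simp [ha]⟩
    change valuation F _ ≤ 1
    rw [map_inv₀]
    exact inv_le_one_of_one_le₀ (le_of_not_ge h)

theorem exists_detBound {ϖ : 𝒪[F]} (hϖ : Irreducible ϖ) {n : Type*} [Fintype n] [DecidableEq n]
    {T : Matrix n n F} (hT : T.det ≠ 0) : ∃ l, DetBound ϖ T l := by
  refine exists_mul_eq_pow hϖ ?_
  rw [Matrix.det_smul]
  exact mul_ne_zero (pow_ne_zero _ two_ne_zero) hT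

/-- If T' agrees with T modulo ϖ^{a+l}, then T' ≡ T[U] modulo ϖ^{2a} with U invertible: agreement to
precision about a forces equal volumes at the doubled precision 2a. -/
theorem compactVol_solSet_eq {m n : Type*} [Fintype m] [Fintype n] [DecidableEq n]
    {ϖ : 𝒪[F]} (hϖ : Irreducible ϖ) {S : Matrix m m F} (hS : IsHalfIntegral S)
    {T T' : Matrix n n F} (hT : IsHalfIntegral T) {l : ℕ} (hl : DetBound ϖ T l) {a E e : ℕ}
    (ha : 0 < a) (hE : a + l ≤ E) (he : e ≤ 2 * a) (h : MemPowHalfIntegral ϖ E (T' - T)) :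
    compactVol (solSet ϖ e S T') = compactVol (solSet ϖ e S T) := by
  obtain ⟨b, rfl⟩ := Nat.exists_eq_add_of_le hE
  obtain ⟨c, hc⟩ := hl
  obtain ⟨U, hU, h1⟩ := exists_quadSubst_sub_memPow hϖ.not_isUnit hT ha hc h
  rw [← solSet_congr (h1.mono he), compactVol_solSet_quadSubst ϖ hϖ e hS T hU]

/-- A box coarser than ϖ^e H_n is cut into q^{Σ(e - ε_s)} cosets of ϖ^e H_n. Each coset is the
solution set of a shifted target T', and all these targets are close enough to T to have the common
volume `v`. -/
theorem compactVol_boxMem {m n : Type*} [Fintype m] [Fintype n] [DecidableEq n]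
    {ϖ : 𝒪[F]} (hϖ : Irreducible ϖ) {S : Matrix m m F} (hS : IsHalfIntegral S)
    {T : Matrix n n F} {E e : ℕ} {v : ℝ}
    (hv : ∀ T', MemPowHalfIntegral ϖ E (T' - T) → compactVol (solSet ϖ e S T') = v)
    (ε : Sym2 n → ℕ) (h1 : ∀ s, E ≤ ε s) (h2 : ∀ s, ε s ≤ e) :
    compactVol {X : Matrix m n 𝒪[F] | BoxMem ϖ ε (quadSubst S (toField X) - T)} =
      (residueCard F : ℝ) ^ (∑ s, (e - ε s)) * v := by
  classical
  have hfact : Fact (Irreducible ϖ) := ⟨hϖ⟩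
  have hϖ0 : (ϖ : F) ≠ 0 := by simpa using hϖ.ne_zero
  let W := ∀ s : Sym2 n, 𝒪[F] ⧸ Ideal.span {ϖ ^ (e - ε s)}
  have : Fintype W := Fintype.ofFinite W
  -- The label of `X` is the class of its normalized coordinates modulo ϖ^{e - ε_s}; the value 0 off
  -- the box is irrelevant, since fibres are intersected with the box.
  let g : Matrix m n 𝒪[F] → W := fun X s =>
    if hX : BoxMem ϖ ε (quadSubst S (toField X) - T) then Ideal.Quotient.mk _ (hX.2 s).choose else 0
  let lift : W → Sym2 n → 𝒪[F] := fun w s => (w s).out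
  have hlift : ∀ w s, Ideal.Quotient.mk _ (lift w s) = w s := fun w s => Quotient.out_eq _
  let T' : W → Matrix n n F := fun w => T + symMat fun s => (ϖ : F) ^ ε s * lift w s
  have hT' : ∀ w, MemPowHalfIntegral ϖ E (T' w - T) := by
    intro w
    rw [memPowHalfIntegral_iff_boxMem]
    simp only [T', add_sub_cancel_left]
    refine ⟨symMat_isSymm _, fun s => ?_⟩
    rw [symCoord_symMat]
    refine ⟨ϖ ^ (ε s - E) * lift w s, ?_⟩
    push_cast
    rw [← mul_assoc, ← pow_add, Nat.add_sub_cancel' (h1 s)]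
  have hfib : ∀ w, {X : Matrix m n 𝒪[F] | BoxMem ϖ ε (quadSubst S (toField X) - T)} ∩ g ⁻¹' {w} =
      solSet ϖ e S (T' w) := by
    intro w
    ext X
    simp only [Set.mem_inter_iff, Set.mem_ofPred_eq, Set.mem_preimage, Set.mem_singleton_iff,
      solSet, memPowHalfIntegral_iff_boxMem]
    have hsub : quadSubst S (toField X) - T' w =
        (quadSubst S (toField X) - T) - symMat fun s => (ϖ : F) ^ ε s * lift w s := by
      simp only [T']; abel
    rw [hsub]
    constructor
    · rintro ⟨hX, hg⟩
      refine ⟨hX.1.sub (symMat_isSymm _), fun s => ?_⟩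
      have hs := congrFun hg s
      simp only [g, hX, dite_true] at hs
      rw [← hlift w s, Ideal.Quotient.eq, Ideal.mem_span_singleton] at hs
      obtain ⟨b, hb⟩ := hs
      refine ⟨b, ?_⟩
      rw [symCoord_sub, symCoord_symMat, Pi.sub_apply, (hX.2 s).choose_spec, ← mul_sub]
      have hb' := congrArg Subtype.val hb
      push_cast at hb'
      rw [hb', ← mul_assoc, ← pow_add, Nat.add_sub_cancel' (h2 s)]
    · rintro ⟨hs, hX⟩
      have hco : ∀ s, ∃ b : 𝒪[F], symCoord (quadSubst S (toField X) - T) s =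
          (ϖ : F) ^ ε s * ((lift w s + ϖ ^ (e - ε s) * b : 𝒪[F]) : F) := by
        intro s
        obtain ⟨b, hb⟩ := hX s
        refine ⟨b, ?_⟩
        rw [symCoord_sub, symCoord_symMat, Pi.sub_apply, sub_eq_iff_eq_add] at hb
        rw [hb]
        push_cast
        rw [mul_add, ← mul_assoc ((ϖ : F) ^ ε s) ((ϖ : F) ^ (e - ε s)), ← pow_add,
          Nat.add_sub_cancel' (h2 s), add_comm]
      have hbox : BoxMem ϖ ε (quadSubst S (toField X) - T) := by
        refine ⟨?_, fun s => ?_⟩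
        · have := hs.add (symMat_isSymm fun s => (ϖ : F) ^ ε s * (lift w s : F))
          simpa using this
        · obtain ⟨b, hb⟩ := hco s
          exact ⟨_, hb⟩
      refine ⟨hbox, ?_⟩
      funext s
      simp only [g, hbox, dite_true]
      obtain ⟨b, hb⟩ := hco s
      have h3 := (hbox.2 s).choose_spec
      have h4 := Subtype.ext (mul_left_cancel₀ (pow_ne_zero _ hϖ0) (hb.symm.trans h3))
      rw [← h4, ← hlift w s, Ideal.Quotient.eq, Ideal.mem_span_singleton]
      exact ⟨b, by ring⟩
  rw [compactVol_eq_sum_fiber g]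
  · simp only [hfib, hv _ (hT' _), Finset.sum_const, nsmul_eq_mul, Finset.card_univ]
    congr 1
    rw [← Nat.card_eq_fintype_card, Nat.card_pi]
    simp only [card_quotient_pow ϖ hϖ, Finset.prod_pow_eq_pow_sum]
    push_cast; rfl
  · intro w
    rw [hfib w]
    exact isOpen_solSet ϖ hϖ e hS _

end SolutionSets

/-! ### Stationarity of the density sequences; solutions with divisible columns -/

section Stabilization

variable {F : Type*} [Field F] [ValuativeRel F] [TopologicalSpace F]
  [IsNonarchimedeanLocalField F]

theorem one_lt_residueCard (F : Type*) [Field F] [ValuativeRel F] [TopologicalSpace F]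
    [IsNonarchimedeanLocalField F] : 1 < residueCard F :=
  Finite.one_lt_card

theorem residueCard_ne_zero (F : Type*) [Field F] [ValuativeRel F] [TopologicalSpace F]
    [IsNonarchimedeanLocalField F] : (residueCard F : ℝ) ≠ 0 := by
  have := one_lt_residueCard F
  positivity

/-- Reduction of integral matrices modulo powers of `ϖ` depending on the column. -/
noncomputable def columnReduction (ϖ : 𝒪[F]) (m : Type*) {n : Type*} (c : n → ℕ) :
    Matrix m n 𝒪[F] →+ (m → ∀ j : n, 𝒪[F] ⧸ Ideal.span {ϖ ^ c j}) where
  toFun X i j := Ideal.Quotient.mk _ (X i j)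
  map_zero' := by ext; simp
  map_add' X Y := by ext; simp

theorem columnReduction_surjective (ϖ : 𝒪[F]) (m : Type*) {n : Type*} (c : n → ℕ) :
    Function.Surjective (columnReduction ϖ m c) := by
  intro w
  refine ⟨Matrix.of fun i j => (w i j).out, ?_⟩
  ext i j
  exact Quotient.out_eq _

theorem columnReduction_eq_zero_iff {ϖ : 𝒪[F]} {m n : Type*} {c : n → ℕ}
    {X : Matrix m n 𝒪[F]} : columnReduction ϖ m c X = 0 ↔ ∀ i j, ϖ ^ c j ∣ X i j := by
  simp only [funext_iff, columnReduction, AddMonoidHom.coe_mk, ZeroHom.coe_mk, Pi.zero_apply,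
    Ideal.Quotient.eq_zero_iff_mem, Ideal.mem_span_singleton]

theorem isOpen_dvd_columns (ϖ : 𝒪[F]) (hϖ : Irreducible ϖ) (m : Type*) {n : Type*} [Finite m]
    [Finite n] (c : n → ℕ) : IsOpen {X : Matrix m n 𝒪[F] | ∀ i j, ϖ ^ c j ∣ X i j} := by
  have := Fintype.ofFinite n
  refine isOpen_of_add_smul_mem ϖ hϖ (∑ j, c j) fun X hX Z i j => ?_
  exact dvd_add (hX i j) ((pow_dvd_pow ϖ (Finset.single_le_sum (fun _ _ => Nat.zero_le _)
    (Finset.mem_univ j))).trans (by simp))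

theorem compactVol_dvd_columns (ϖ : 𝒪[F]) (hϖ : Irreducible ϖ) (m : Type*) {n : Type*}
    [Fintype m] [Fintype n] (c : n → ℕ) :
    compactVol {X : Matrix m n 𝒪[F] | ∀ i j, ϖ ^ c j ∣ X i j} =
      ((residueCard F : ℝ) ^ (Fintype.card m * ∑ j, c j))⁻¹ := by
  have hfact : Fact (Irreducible ϖ) := ⟨hϖ⟩
  have h0 : {X : Matrix m n 𝒪[F] | ∀ i j, ϖ ^ c j ∣ X i j} = columnReduction ϖ m c ⁻¹' {0} := by
    ext X
    exact columnReduction_eq_zero_iff.symm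
  have ho := isOpen_dvd_columns ϖ hϖ m c
  rw [h0] at ho ⊢
  rw [compactVol_preimage_finite _ (columnReduction_surjective ϖ m c) ho, Set.ncard_singleton,
    Nat.card_pi]
  simp only [Nat.card_pi, card_quotient_pow ϖ hϖ, Finset.prod_pow_eq_pow_sum, Finset.sum_const,
    Finset.card_univ, smul_eq_mul]
  push_cast
  rw [one_div]

theorem compactVol_dvd_sub (ϖ : 𝒪[F]) (hϖ : Irreducible ϖ) {m n : Type*} [Fintype m] [Fintype n]
    (e : ℕ) (Y : Matrix m n 𝒪[F]) :
    compactVol {X : Matrix m n 𝒪[F] | ∀ i j, ϖ ^ e ∣ X i j - Y i j} =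
      ((residueCard F : ℝ) ^ (Fintype.card m * (Fintype.card n * e)))⁻¹ := by
  have h := compactVol_dvd_columns ϖ hϖ m (fun _ : n => e)
  rw [Finset.sum_const, smul_eq_mul, Finset.card_univ] at h
  rw [← h, ← compactVol_preimage_add_left (-Y) {X : Matrix m n 𝒪[F] | ∀ i j, ϖ ^ e ∣ X i j}]
  congr 1
  ext X
  simp only [Set.mem_ofPred_eq, Set.mem_preimage, neg_add_eq_sub, Matrix.sub_apply]

/-- Each index lies once in every off-diagonal pair containing it and twice in its diagonal pair, n
+ 1 times in all. This produces the exponent n + 1 in the power of q in front of α(H_k, B). -/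
theorem sum_sym2_add {n : Type*} [Fintype n] [DecidableEq n] (c : n → ℕ) (w : Sym2 n → ℕ)
    (hw : ∀ i j, w s(i, j) = c i + c j) : ∑ s, w s = (Fintype.card n + 1) * ∑ i, c i := by
  classical
  let r : LinearOrder n := LinearOrder.lift' (Fintype.equivFin n) (Fintype.equivFin n).injective
  have h1 : ∑ s, w s = ∑ p : n × n with p.1 ≤ p.2, (c p.1 + c p.2) := by
    rw [← Finset.sum_subtype_eq_sum_filter]
    refine (Finset.sum_equiv Sym2.sortEquiv ?_ ?_)
    · simp
    · intro s _
      induction s with | _ i j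
      rcases le_total i j with h | h
      · simp [Sym2.sortEquiv, h, hw]
      · simp [Sym2.sortEquiv, h, hw, add_comm]
  have hcard : ∀ i : n, (Finset.univ.filter fun j => i ≤ j).card +
      (Finset.univ.filter fun j => j ≤ i).card = Fintype.card n + 1 := by
    intro i
    have := Finset.card_union_add_card_inter (Finset.univ.filter fun j => i ≤ j)
      (Finset.univ.filter fun j => j ≤ i)
    rw [← this]
    congr 1
    · rw [← Finset.filter_or, Finset.filter_true_of_mem, Finset.card_univ]
      exact fun j _ => le_total i j
    · rw [Finset.card_eq_one]
      refine ⟨i, ?_⟩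
      ext j
      simp only [Finset.mem_inter, Finset.mem_filter, Finset.mem_univ, true_and,
        Finset.mem_singleton]
      exact ⟨fun h => le_antisymm h.2 h.1, fun h => by simp [h]⟩
  rw [h1, Finset.sum_add_distrib, Finset.sum_filter, Finset.sum_filter, Fintype.sum_prod_type,
    Fintype.sum_prod_type_right, ← Finset.sum_add_distrib, Finset.mul_sum]
  refine Finset.sum_congr rfl fun i _ => ?_
  simp only [← Finset.sum_filter, Finset.sum_const, smul_eq_mul, ← add_mul, hcard]

theorem card_sym2 (n : Type*) [Fintype n] [DecidableEq n] :
    Fintype.card (Sym2 n) = Fintype.card n * (Fintype.card n + 1) / 2 := by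
  rw [Sym2.card, Nat.choose_two_right, mul_comm]
  rfl

variable [CharZero F]

/-- The solution set at level e splits into q^{n(n+1)/2} sets at level e + 1 of equal volume, which
the density factor compensates. -/
theorem localDensitySeq_succ {m n : Type*} [Fintype m] [Fintype n] [DecidableEq n]
    {ϖ : 𝒪[F]} (hϖ : Irreducible ϖ) {S : Matrix m m F} (hS : IsHalfIntegral S)
    {T : Matrix n n F} (hT : IsHalfIntegral T) {l e : ℕ} (hl : DetBound ϖ T l)
    (he : 2 * l + 1 ≤ e) : localDensitySeq ϖ S T (e + 1) = localDensitySeq ϖ S T e := by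
  -- With a = e - l the doubled precision must reach e + 1 ≤ 2(e - l), that is 2l + 1 ≤ e: this is
  -- the threshold used throughout.
  have h := compactVol_boxMem (T := T) (E := e) (e := e + 1) hϖ hS
    (fun T' h => compactVol_solSet_eq hϖ hS hT hl (a := e - l) (by omega) (by omega) (by omega) h)
    (fun _ => e) (fun _ => le_rfl) (fun _ => Nat.le_succ e)
  simp only [localDensitySeq, densityFactor]
  have h2 : solSet ϖ e S T =
      {X : Matrix m n 𝒪[F] | BoxMem ϖ (fun _ => e) (quadSubst S (toField X) - T)} := by
    ext X
    exact memPowHalfIntegral_iff_boxMem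
  rw [h2, h, ← mul_assoc, ← pow_add]
  simp only [add_tsub_cancel_left, Finset.sum_const, Finset.card_univ, card_sym2, smul_eq_mul]
  congr 2
  ring

theorem localDensitySeq_eq_of_le {m n : Type*} [Fintype m] [Fintype n] [DecidableEq n]
    {ϖ : 𝒪[F]} (hϖ : Irreducible ϖ) {S : Matrix m m F} (hS : IsHalfIntegral S)
    {T : Matrix n n F} (hT : IsHalfIntegral T) {l : ℕ} (hl : DetBound ϖ T l)
    {e : ℕ} (he : 2 * l + 1 ≤ e) :
    localDensitySeq ϖ S T e = localDensitySeq ϖ S T (2 * l + 1) := by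
  induction e, he using Nat.le_induction with
  | base => rfl
  | succ e he ih => rw [localDensitySeq_succ hϖ hS hT hl he, ih]

theorem limUnder_eq_of_eventually_const {u : ℕ → ℝ} {a : ℝ} {N : ℕ} (h : ∀ e, N ≤ e → u e = a) :
    Tendsto u atTop (𝓝 a) ∧ limUnder atTop u = a := by
  have : Tendsto u atTop (𝓝 a) :=
    tendsto_const_nhds.congr' (by
      filter_upwards [eventually_ge_atTop N] with e he using (h e he).symm)
  exact ⟨this, this.limUnder_eq⟩

theorem localDensitySeq_eq {m n : Type*} [Fintype m] [Fintype n] [DecidableEq n]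
    {ϖ : 𝒪[F]} (hϖ : Irreducible ϖ) {S : Matrix m m F} (hS : IsHalfIntegral S)
    {T : Matrix n n F} (hT : IsHalfIntegral T) {l : ℕ} (hl : DetBound ϖ T l)
    {e : ℕ} (he : 2 * l + 1 ≤ e) : localDensitySeq ϖ S T e = localDensity ϖ S T := by
  rw [localDensitySeq_eq_of_le hϖ hS hT hl he]
  exact ((limUnder_eq_of_eventually_const fun e he =>
    localDensitySeq_eq_of_le hϖ hS hT hl he).2).symm

theorem converges_localDensitySeq {m n : Type*} [Fintype m] [Fintype n] [DecidableEq n]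
    {ϖ : 𝒪[F]} (hϖ : Irreducible ϖ) {S : Matrix m m F} (hS : IsHalfIntegral S)
    {T : Matrix n n F} (hT : IsHalfIntegral T) {l : ℕ} (hl : DetBound ϖ T l) :
    Converges (localDensitySeq ϖ S T) :=
  ⟨_, (limUnder_eq_of_eventually_const fun _ he =>
    localDensitySeq_eq_of_le hϖ hS hT hl he).1⟩

/-- The contribution to the local density of `T[D]`, `D = diag(ϖ ^ c_i)`, of the solutions
divisible by `D` on the right. -/
theorem densityFactor_mul_compactVol_dvd_columns {m n : Type*} [Fintype m] [Fintype n]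
    [DecidableEq n] {ϖ : 𝒪[F]} (hϖ : Irreducible ϖ) {S : Matrix m m F} (hS : IsHalfIntegral S)
    {T : Matrix n n F} (hT : IsHalfIntegral T) {l e : ℕ} (hl : DetBound ϖ T l)
    (he : 2 * l + 4 ≤ e) (c : n → ℕ) (hc : ∀ i, c i ≤ 1) :
    densityFactor F (Fintype.card n) e *
      compactVol {X : Matrix m n 𝒪[F] | (∀ i j, ϖ ^ c j ∣ X i j) ∧
        X ∈ solSet ϖ e S (quadSubst T (toField (Matrix.diagonal fun i => ϖ ^ c i)))} =
      (residueCard F : ℝ) ^ (((Fintype.card n : ℤ) + 1 - Fintype.card m) * ∑ i, (c i : ℤ)) *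
        localDensity ϖ S T := by
  have hϖ0 : (ϖ : F) ≠ 0 := by simpa using hϖ.ne_zero
  set D : Matrix n n 𝒪[F] := Matrix.diagonal fun i => ϖ ^ c i with hD
  let w : Sym2 n → ℕ := Sym2.lift ⟨fun i j => c i + c j, fun i j => add_comm _ _⟩
  have hw : ∀ i j, w s(i, j) = c i + c j := fun i j => rfl
  have hw2 : ∀ s, w s ≤ 2 := by
    intro s
    induction s with | _ i j
    rw [hw]
    have := hc i
    have := hc j
    omega
  -- Substituting D multiplies the coordinate at {i, j} by ϖ^{c_i + c_j}, so the congruence loosens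
  -- to precision e - c_i - c_j there.
  have hbox : ∀ M : Matrix n n F, M.IsSymm →
      (MemPowHalfIntegral ϖ e (quadSubst M (toField D)) ↔ BoxMem ϖ (fun s => e - w s) M) := by
    intro M hM
    have hcoord : ∀ s, symCoord (quadSubst M (toField D)) s = (ϖ : F) ^ w s * symCoord M s := by
      have hDf : toField D = Matrix.diagonal fun i => (ϖ : F) ^ c i := by
        ext i j
        by_cases h : i = j
        · subst h; simp [D]
        · simp [D, h]
      intro s
      induction s with | _ i j
      simp only [symCoord_mk, quadSubst, hDf, Matrix.diagonal_transpose, Matrix.mul_diagonal,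
        Matrix.diagonal_mul, hw, pow_add]
      split_ifs with h
      · subst h; ring
      · ring
    rw [memPowHalfIntegral_iff_boxMem]
    simp only [BoxMem, quadSubst_isSymm hM, hM, true_and]
    refine forall_congr' fun s => exists_congr fun a => ?_
    rw [hcoord]
    have : (ϖ : F) ^ e = (ϖ : F) ^ w s * (ϖ : F) ^ (e - w s) := by
      rw [← pow_add, Nat.add_sub_cancel' ((hw2 s).trans (by omega))]
    rw [this, mul_assoc]
    exact ⟨fun h => mul_left_cancel₀ (pow_ne_zero _ hϖ0) h, fun h => by rw [h]⟩
  let f : Matrix m n 𝒪[F] →+ Matrix m n 𝒪[F] :=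
    AddMonoidHom.mk' (fun X : Matrix m n 𝒪[F] => X * D) fun X Y => Matrix.add_mul X Y D
  have hfapp : ∀ X i j, f X i j = X i j * ϖ ^ c j := by
    intro X i j
    simp [f, D]
  have hrange : Set.range f = {X : Matrix m n 𝒪[F] | ∀ i j, ϖ ^ c j ∣ X i j} := by
    ext X
    constructor
    · rintro ⟨Y, rfl⟩ i j
      rw [hfapp]; exact Dvd.intro_left _ rfl
    · intro h
      choose Y hY using h
      refine ⟨Matrix.of Y, ?_⟩
      ext i j : 2
      rw [hfapp, hY i j, mul_comm]; rfl
  have hfinj : Function.Injective f := by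
    intro X Y h
    refine Matrix.ext fun i j => ?_
    have := congrFun (congrFun h i) j
    rw [hfapp, hfapp] at this
    exact mul_right_cancel₀ (pow_ne_zero (c j) hϖ.ne_zero) this
  have hfcont : Continuous f := continuous_id.matrix_mul continuous_const
  have hfopen : IsOpenEmbedding f :=
    ⟨(hfcont.isClosedEmbedding hfinj).toIsEmbedding, by
      rw [hrange]; exact isOpen_dvd_columns ϖ hϖ m c⟩
  have himage : {X : Matrix m n 𝒪[F] | (∀ i j, ϖ ^ c j ∣ X i j) ∧
        X ∈ solSet ϖ e S (quadSubst T (toField D))} =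
      f '' {X : Matrix m n 𝒪[F] | BoxMem ϖ (fun s => e - w s) (quadSubst S (toField X) - T)} := by
    have hmem : ∀ Y, f Y ∈ solSet ϖ e S (quadSubst T (toField D)) ↔
        BoxMem ϖ (fun s => e - w s) (quadSubst S (toField Y) - T) := by
      intro Y
      rw [← hbox _ ((quadSubst_isSymm hS.1 _).sub hT.1), quadSubst_sub, ← quadSubst_mul,
        ← toField_mul]
      rfl
    ext X
    constructor
    · rintro ⟨h1, h2⟩
      have : X ∈ Set.range f := by rw [hrange]; exact h1
      obtain ⟨Y, rfl⟩ := this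
      exact ⟨Y, (hmem Y).1 h2, rfl⟩
    · rintro ⟨Y, hY, rfl⟩
      refine ⟨?_, (hmem Y).2 hY⟩
      have : f Y ∈ Set.range f := ⟨Y, rfl⟩
      rwa [hrange] at this
  -- The box exponents are at least e - 2, so the choice is a = e - 2 - l, and e ≤ 2a becomes 2l + 4
  -- ≤ e.
  have hv := compactVol_boxMem (T := T) (E := e - 2) (e := e) hϖ hS
    (fun T' h => compactVol_solSet_eq hϖ hS hT hl (a := e - 2 - l) (by omega) (by omega)
      (by omega) h)
    (fun s => e - w s) (fun s => Nat.sub_le_sub_left (hw2 s) e) (fun s => Nat.sub_le _ _)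
  have hsum : ∑ s, (e - (e - w s)) = (Fintype.card n + 1) * ∑ i, c i := by
    rw [← sum_sym2_add c w hw]
    refine Finset.sum_congr rfl fun s _ => ?_
    have := hw2 s
    omega
  rw [himage, compactVol_image f hfopen, hrange, compactVol_dvd_columns ϖ hϖ, hv, hsum,
    ← localDensitySeq_eq hϖ hS hT hl (show 2 * l + 1 ≤ e by omega), localDensitySeq]
  have hq := residueCard_ne_zero F
  -- The loosened congruences give q^{(n+1)Σc}; the volume of the matrices divisible by D gives
  -- q^{-mΣc}.
  rw [sub_mul, zpow_sub₀ hq]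
  have e1 : ((Fintype.card n : ℤ) + 1) * ∑ i, (c i : ℤ) =
      (((Fintype.card n + 1) * ∑ i, c i : ℕ) : ℤ) := by push_cast; rfl
  have e2 : (Fintype.card m : ℤ) * ∑ i, (c i : ℤ) =
      ((Fintype.card m * ∑ i, c i : ℕ) : ℤ) := by push_cast; rfl
  rw [e1, e2, zpow_natCast, zpow_natCast]
  field_simp

end Stabilization

/-! ### Primitive matrices and reduction to the residue field -/

section Primitive

variable {F : Type*} [Field F] [ValuativeRel F] [TopologicalSpace F]
  [IsNonarchimedeanLocalField F]

/-- The reduction of an integral matrix to the residue field. -/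
noncomputable def residueMatrix {m n : Type*} (X : Matrix m n 𝒪[F]) : Matrix m n 𝓀[F] :=
  X.map (IsLocalRing.residue 𝒪[F])

theorem residueMatrix_mul {l m n : Type*} [Fintype m] (X : Matrix l m 𝒪[F])
    (Y : Matrix m n 𝒪[F]) : residueMatrix (X * Y) = residueMatrix X * residueMatrix Y :=
  Matrix.map_mul (f := IsLocalRing.residue 𝒪[F])

theorem residueMatrix_one {n : Type*} [DecidableEq n] :
    residueMatrix (1 : Matrix n n 𝒪[F]) = 1 := by
  ext i j
  by_cases h : i = j
  · subst h; simp [residueMatrix]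
  · simp [residueMatrix, h]

theorem residueMatrix_eq_zero_iff {m n : Type*} {X : Matrix m n 𝒪[F]} {ϖ : 𝒪[F]}
    (hϖ : Irreducible ϖ) : residueMatrix X = 0 ↔ ∀ i j, ϖ ∣ X i j := by
  simp only [← Matrix.ext_iff, residueMatrix, Matrix.map_apply, Matrix.zero_apply,
    IsLocalRing.residue_eq_zero_iff, hϖ.maximalIdeal_eq, Ideal.mem_span_singleton]

theorem isUnit_det_iff_residue {n : Type*} [Fintype n] [DecidableEq n] {X : Matrix n n 𝒪[F]} :
    IsUnit X.det ↔ (residueMatrix X).det ≠ 0 := by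
  rw [← IsLocalRing.residue_ne_zero_iff_isUnit, RingHom.map_det]
  rfl

/-- A matrix is primitive if and only if its reduction has independent columns. -/
theorem isPrimitiveMatrix_iff {m n : Type*} [Fintype m] [DecidableEq m] [Fintype n]
    [DecidableEq n] {X : Matrix m n 𝒪[F]} :
    IsPrimitiveMatrix X ↔ ∀ u : n → 𝓀[F], residueMatrix X *ᵥ u = 0 → u = 0 := by
  constructor
  · rintro ⟨d, σ, Y, h⟩ u hu
    rw [isUnit_det_iff_residue] at h
    set M := residueMatrix ((Matrix.fromCols X Y).submatrix id σ) with hM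
    have h1 : M *ᵥ (Sum.elim u 0 ∘ σ) = 0 := by
      funext i
      have hi := congrFun hu i
      simp only [Matrix.mulVec, dotProduct, Pi.zero_apply] at hi ⊢
      rw [← σ.symm.sum_comp, Fintype.sum_sum_type]
      simp only [hM, residueMatrix, Matrix.map_apply, Matrix.submatrix_apply, id_eq,
        Function.comp_apply, Equiv.apply_symm_apply, Matrix.fromCols_apply_inl,
        Matrix.fromCols_apply_inr, Sum.elim_inl, Sum.elim_inr, Pi.zero_apply, mul_zero,
        Finset.sum_const_zero, add_zero]
      exact hi
    have h2 := Matrix.eq_zero_of_mulVec_eq_zero h h1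
    funext j
    have := congrFun h2 (σ.symm (Sum.inl j))
    simpa using this
  · intro h
    have hli : LinearIndependent 𝓀[F] (residueMatrix X).col := by
      rw [← Matrix.mulVec_injective_iff]
      intro u v huv
      rw [← sub_eq_zero]
      apply h
      rw [Matrix.mulVec_sub, sub_eq_zero]
      exact huv
    -- The independent columns are completed to a basis of the residue space and the new vectors are
    -- lifted; a determinant with nonzero residue is a unit.
    obtain ⟨κ, hκ, b, hb⟩ : ∃ (κ : Type _) (_ : Finite κ) (b : Module.Basis (n ⊕ κ) 𝓀[F] (m →
        𝓀[F])),
        ∀ t, b (Sum.inl t) = (residueMatrix X).col t := by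
      refine ⟨Module.Basis.sumExtendIndex hli, ?_, Module.Basis.sumExtend hli, fun t => ?_⟩
      · have := Module.Finite.finite_basis (Module.Basis.sumExtend hli)
        exact Finite.of_injective (Sum.inr : _ → n ⊕ Module.Basis.sumExtendIndex hli)
          Sum.inr_injective
      · simp only [Module.Basis.sumExtend, Module.Basis.coe_reindex, Function.comp_apply,
          Module.Basis.extend_apply_self]
        rfl
    have := Fintype.ofFinite κ
    let ε := Fintype.equivFin κ
    let τ := b.indexEquiv (Pi.basisFun 𝓀[F] m)
    let σ : m ≃ n ⊕ Fin (Fintype.card κ) := τ.symm.trans (Equiv.sumCongr (Equiv.refl _) ε)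
    have hY : ∀ i j, ∃ y : 𝒪[F], IsLocalRing.residue 𝒪[F] y = b (Sum.inr (ε.symm j)) i :=
      fun i j => IsLocalRing.residue_surjective (b (Sum.inr (ε.symm j)) i)
    choose Y hY using hY
    refine ⟨_, σ, Matrix.of Y, ?_⟩
    rw [isUnit_det_iff_residue, ← isUnit_iff_ne_zero, ← Matrix.isUnit_iff_isUnit_det,
      ← Matrix.linearIndependent_cols_iff_isUnit]
    have hcol : (residueMatrix ((Matrix.fromCols X (Matrix.of Y)).submatrix id σ)).col =
        b ∘ τ.symm := by
      funext j
      obtain ⟨t, rfl⟩ := τ.surjective j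
      funext i
      have hσ : σ (τ t) = Sum.map id ε t := by simp [σ]
      rw [Function.comp_apply, Equiv.symm_apply_apply]
      change IsLocalRing.residue 𝒪[F] (Matrix.fromCols X (Matrix.of Y) i (σ (τ t))) = b t i
      rw [hσ]
      rcases t with t | t
      · rw [hb]; rfl
      · change IsLocalRing.residue 𝒪[F] (Y i (ε t)) = _
        rw [hY, Equiv.symm_apply_apply]
    rw [hcol]
    exact b.linearIndependent.comp _ (Equiv.injective _)

theorem isPrimitiveMatrix_mul_left_iff {m m' n : Type*} [Fintype m] [DecidableEq m] [Fintype m']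
    [DecidableEq m'] [Fintype n] [DecidableEq n] {U : Matrix m' m 𝒪[F]} {V : Matrix m m' 𝒪[F]}
    (h : V * U = 1) (X : Matrix m n 𝒪[F]) :
    IsPrimitiveMatrix (U * X) ↔ IsPrimitiveMatrix X := by
  simp only [isPrimitiveMatrix_iff, residueMatrix_mul]
  have h' := congrArg residueMatrix h
  rw [residueMatrix_mul, residueMatrix_one] at h'
  refine forall_congr' fun u => imp_congr_left ⟨fun hu => ?_, fun hu => ?_⟩
  · have := congrArg (fun v => residueMatrix V *ᵥ v) hu
    simpa only [Matrix.mulVec_mulVec, ← Matrix.mul_assoc, h', Matrix.one_mul,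
      Matrix.mulVec_zero] using this
  · rw [← Matrix.mulVec_mulVec, hu, Matrix.mulVec_zero]

theorem isPrimitiveMatrix_add_smul {m n : Type*} [Fintype m] [DecidableEq m] [Fintype n]
    [DecidableEq n] {ϖ : 𝒪[F]} (hϖ : Irreducible ϖ) {X : Matrix m n 𝒪[F]}
    (hX : IsPrimitiveMatrix X) (Z : Matrix m n 𝒪[F]) : IsPrimitiveMatrix (X + ϖ • Z) := by
  rw [isPrimitiveMatrix_iff] at *
  have hz : (IsLocalRing.residue 𝒪[F]) ϖ = 0 := by
    rw [IsLocalRing.residue_eq_zero_iff]; exact (IsLocalRing.mem_maximalIdeal _).2 hϖ.not_isUnit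
  have : residueMatrix (X + ϖ • Z) = residueMatrix X := by
    ext i j
    simp [residueMatrix, hz]
  rwa [this]

theorem isOpen_isPrimitiveMatrix {ϖ : 𝒪[F]} (hϖ : Irreducible ϖ) (m n : Type*) [Fintype m]
    [DecidableEq m] [Fintype n] [DecidableEq n] :
    IsOpen {X : Matrix m n 𝒪[F] | IsPrimitiveMatrix X} :=
  isOpen_of_add_smul_mem ϖ hϖ 1 fun _ hX Z => by
    rw [pow_one]; exact isPrimitiveMatrix_add_smul hϖ hX Z

theorem isPrimitiveMatrix_column_iff {m : Type*} [Fintype m] [DecidableEq m]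
    {X : Matrix m (Fin 1) 𝒪[F]} : IsPrimitiveMatrix X ↔ ∃ i, IsUnit (X i 0) := by
  rw [isPrimitiveMatrix_iff]
  constructor
  · intro h
    by_contra! hne
    have h1 := h (fun _ => 1) (by
      funext i
      have := hne i
      rw [← IsLocalRing.residue_ne_zero_iff_isUnit, not_not] at this
      simp [Matrix.mulVec, dotProduct, residueMatrix, this])
    exact one_ne_zero (congrFun h1 0)
  · rintro ⟨i, hi⟩ u hu
    have := congrFun hu i
    rw [← IsLocalRing.residue_ne_zero_iff_isUnit] at hi
    simp only [Matrix.mulVec, dotProduct, residueMatrix, Matrix.map_apply, Fin.sum_univ_one,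
        Pi.zero_apply,
      mul_eq_zero, hi, false_or] at this
    funext j
    rw [Subsingleton.elim j 0, this]; rfl

theorem not_isPrimitiveMatrix_column_iff {m : Type*} [Fintype m] [DecidableEq m] {ϖ : 𝒪[F]}
    (hϖ : Irreducible ϖ) {X : Matrix m (Fin 1) 𝒪[F]} :
    ¬ IsPrimitiveMatrix X ↔ ∀ i j, ϖ ∣ X i j := by
  rw [isPrimitiveMatrix_column_iff, ← residueMatrix_eq_zero_iff hϖ]
  push Not
  simp only [← IsLocalRing.residue_ne_zero_iff_isUnit, not_not]
  constructor
  · intro h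
    ext i j
    rw [Subsingleton.elim j 0]; exact h i
  · intro h i
    exact congrFun (congrFun h i) 0

end Primitive

/-! ### Hyperbolic bases adapted to a matrix with an invertible minor -/

section Frame

variable {A : Type*} [CommRing A]

/-- The polar form of the orthogonal sum of `k` hyperbolic planes. -/
def polarForm (A : Type*) [CommRing A] (k : ℕ) : Matrix (Fin 2 × Fin k) (Fin 2 × Fin k) A :=
  Matrix.of fun s t => if s.1 ≠ t.1 ∧ s.2 = t.2 then 1 else 0

/-- The orthogonal sum of the split form of rank `2r` and `k` hyperbolic planes. -/
def splitForm (A : Type*) [CommRing A] (r k : ℕ) :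
    Matrix ((Fin r ⊕ Fin r) ⊕ (Fin 2 × Fin k)) ((Fin r ⊕ Fin r) ⊕ (Fin 2 × Fin k)) A :=
  Matrix.fromBlocks (Matrix.fromBlocks 0 1 1 0) 0 0 (polarForm A k)

/-- The form exchanges the two isotropic vectors of each plane; in `Fin 2` the other index is `c +
1`. -/
theorem polarForm_mul_apply {k : ℕ} {n : Type*} (X : Matrix (Fin 2 × Fin k) n A) (s : Fin 2 × Fin k)
    (j : n) : (polarForm A k * X) s j = X (s.1 + 1, s.2) j := by
  obtain ⟨c, l⟩ := s
  simp only [Matrix.mul_apply, polarForm, Matrix.of_apply, ite_mul, one_mul, zero_mul]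
  rw [Finset.sum_eq_single (c + 1, l)]
  · rw [if_pos]
    refine ⟨?_, rfl⟩
    have : ∀ c : Fin 2, c ≠ c + 1 := by decide
    exact this c
  · rintro ⟨c', l'⟩ _ hne
    rw [if_neg]
    rintro ⟨h1, h2⟩
    apply hne
    simp only at h1 h2
    subst h2
    congr 1
    revert h1
    fin_cases c <;> fin_cases c' <;> decide
  · simp

theorem polarForm_transpose (k : ℕ) : (polarForm A k)ᵀ = polarForm A k := by
  ext s t
  simp only [polarForm, Matrix.transpose_apply, Matrix.of_apply, eq_comm (a := t.1),
    eq_comm (a := t.2), ne_eq]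

theorem polarForm_mul_self (k : ℕ) : polarForm A k * polarForm A k = 1 := by
  ext ⟨c, l⟩ ⟨c', l'⟩
  rw [polarForm_mul_apply]
  simp only [polarForm, Matrix.of_apply, Matrix.one_apply, Prod.mk.injEq]
  congr 1
  rw [eq_iff_iff]
  refine and_congr_left fun _ => ?_
  fin_cases c <;> fin_cases c' <;> decide

theorem transpose_mul_polarForm_mul {k : ℕ} {m n : Type*} (X : Matrix (Fin 2 × Fin k) m A)
    (Y : Matrix (Fin 2 × Fin k) n A) :
    Xᵀ * polarForm A k * Y =
      (X.submatrix (fun l => ((0 : Fin 2), l)) id)ᵀ * Y.submatrix (fun l => ((1 : Fin 2), l)) id +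
      (X.submatrix (fun l => ((1 : Fin 2), l)) id)ᵀ *
        Y.submatrix (fun l => ((0 : Fin 2), l)) id := by
  ext i j
  rw [Matrix.mul_assoc, Matrix.mul_apply, Fintype.sum_prod_type, Fin.sum_univ_two]
  simp only [polarForm_mul_apply, Matrix.add_apply, Matrix.transpose_apply]
  rfl

/-- The relabelling of the hyperbolic basis adapted to an injection and a choice of isotropic
vectors. -/
theorem exists_frame_equiv {k r : ℕ} (ι : Fin r → Fin k) (hι : Function.Injective ι)
    (sw : Fin r → Fin 2) : ∃ τ : (Fin r ⊕ Fin r) ⊕ (Fin 2 × Fin (k - r)) ≃ Fin 2 × Fin k,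
      (∀ a, τ (Sum.inl (Sum.inl a)) = (sw a, ι a)) ∧
      (polarForm A k).submatrix τ τ = splitForm A r (k - r) := by
  classical
  have hrk : r ≤ k := by simpa using Fintype.card_le_of_injective ι hι
  have hcard : Fintype.card ((Set.range ι)ᶜ : Set (Fin k)) = k - r := by
    rw [Fintype.card_compl_set, Fintype.card_fin, Set.card_range_of_injective hι, Fintype.card_fin]
  let e := (Fintype.equivFinOfCardEq hcard).symm
  -- Chosen isotropic vectors, then their partners in the same planes, then the planes left over.
  let f : (Fin r ⊕ Fin r) ⊕ (Fin 2 × Fin (k - r)) → Fin 2 × Fin k :=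
    Sum.elim (Sum.elim (fun a => (sw a, ι a)) (fun a => (sw a + 1, ι a)))
      (fun s => (s.1, (e s.2).1))
  have he : ∀ a b, ι a ≠ (e b).1 := fun a b h => (e b).2 ⟨a, h⟩
  have hadd : ∀ c : Fin 2, c ≠ c + 1 := by decide
  have hinj : Function.Injective f := by
    rintro ((a | a) | ⟨c, b⟩) ((a' | a') | ⟨c', b'⟩) h <;>
      simp only [f, Sum.elim_inl, Sum.elim_inr, Prod.mk.injEq] at h
    · rw [hι h.2]
    · rw [hι h.2] at h; exact absurd h.1 (hadd _)
    · exact absurd h.2 (he _ _)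
    · rw [hι h.2] at h; exact absurd h.1.symm (hadd _)
    · rw [hι h.2]
    · exact absurd h.2 (he _ _)
    · exact absurd h.2.symm (he _ _)
    · exact absurd h.2.symm (he _ _)
    · rw [h.1, e.injective (Subtype.ext h.2)]
  have hbij : Function.Bijective f := by
    rw [Fintype.bijective_iff_injective_and_card]
    refine ⟨hinj, ?_⟩
    simp only [Fintype.card_sum, Fintype.card_prod, Fintype.card_fin]
    omega
  refine ⟨Equiv.ofBijective f hbij, fun a => rfl, ?_⟩
  have hadd2 : ∀ c : Fin 2, c + 1 ≠ c := by decide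
  have hc : ∀ a b, (e a).1 = (e b).1 ↔ a = b := fun a b =>
    ⟨fun h => e.injective (Subtype.ext h), fun h => by rw [h]⟩
  have key : ∀ c c' : Fin 2, c ≠ c' ↔ c + 1 = c' := by decide
  ext s t
  rw [Matrix.submatrix_apply, Equiv.ofBijective_apply, Equiv.ofBijective_apply]
  rcases s with (a | a) | ⟨c, b⟩ <;> rcases t with (a' | a') | ⟨c', b'⟩ <;>
    simp only [f, polarForm, splitForm, Matrix.of_apply, Sum.elim_inl, Sum.elim_inr,
      Matrix.fromBlocks_apply₁₁, Matrix.fromBlocks_apply₁₂, Matrix.fromBlocks_apply₂₁,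
      Matrix.fromBlocks_apply₂₂, Matrix.zero_apply, hι.eq_iff, Matrix.one_apply, he,
      (he _ _).symm, and_false, if_false, hc]
  · rw [if_neg]; rintro ⟨h1, rfl⟩; exact h1 rfl
  · refine if_congr ⟨fun h => h.2, ?_⟩ rfl rfl
    rintro rfl; exact ⟨hadd _, rfl⟩
  · refine if_congr ⟨fun h => h.2, ?_⟩ rfl rfl
    rintro rfl; exact ⟨hadd2 _, rfl⟩
  · rw [if_neg]; rintro ⟨h1, rfl⟩; exact h1 rfl

/-- A matrix with an invertible minor consisting of rows in distinct hyperbolic planes has a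
normal form in a suitable hyperbolic basis. -/
theorem exists_frame {k r : ℕ} (X : Matrix (Fin 2 × Fin k) (Fin r) A) (ι : Fin r → Fin k)
    (hι : Function.Injective ι) (sw : Fin r → Fin 2)
    (hdet : IsUnit (Matrix.of fun a b => X (sw a, ι a) b).det) :
    ∃ (U : Matrix ((Fin r ⊕ Fin r) ⊕ (Fin 2 × Fin (k - r))) (Fin 2 × Fin k) A)
      (Q : Matrix (Fin r) (Fin r) A),
      Uᵀ * splitForm A r (k - r) * U = polarForm A k ∧
      U * X = Matrix.fromRows (Matrix.fromRows 1 Q) 0 := by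
  classical
  obtain ⟨τ, hτ, hform⟩ := exists_frame_equiv (A := A) ι hι sw
  set P1 : Matrix (Fin r) (Fin r) A := Matrix.of fun a b => X (sw a, ι a) b with hP1
  obtain ⟨g, hg⟩ := (Matrix.isUnit_iff_isUnit_det _).2 hdet
  set G : Matrix (Fin r) (Fin r) A := (g⁻¹ : (Matrix (Fin r) (Fin r) A)ˣ).val with hG
  have hGP : G * P1 = 1 := by rw [hG, ← hg]; exact Units.inv_mul g
  let Pτ : Matrix ((Fin r ⊕ Fin r) ⊕ (Fin 2 × Fin (k - r))) (Fin 2 × Fin k) A :=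
    (1 : Matrix _ _ A).submatrix τ id
  have hPτ : Pτᵀ * splitForm A r (k - r) * Pτ = polarForm A k := by
    rw [← hform]
    simp only [Pτ, Matrix.transpose_submatrix, Matrix.transpose_one]
    rw [Matrix.submatrix_mul_equiv, Matrix.submatrix_mul_equiv, Matrix.one_mul, Matrix.mul_one,
      Matrix.submatrix_id_id]
  let Q0 : Matrix (Fin r) (Fin r) A := Matrix.of fun a b => X (τ (Sum.inl (Sum.inr a))) b
  let C : Matrix (Fin 2 × Fin (k - r)) (Fin r) A := Matrix.of fun s b => X (τ (Sum.inr s)) b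
  have hPX : Pτ * X = Matrix.fromRows (Matrix.fromRows P1 Q0) C := by
    have h1 : Pτ * X = X.submatrix τ id := by
      simp only [Pτ]
      have := Matrix.submatrix_mul_equiv (1 : Matrix _ _ A) X τ (Equiv.refl _) id
      rw [Matrix.one_mul] at this
      exact this
    rw [h1]
    ext s b
    rcases s with (a | a) | s
    · simp [hP1, hτ]
    · simp [Q0]
    · simp [C]
  -- A Levi element: P₁⁻¹ on the chosen isotropic space and the dual action ᵗP₁ on its partner,
  -- normalizing the pivot block to 1.
  let L : Matrix ((Fin r ⊕ Fin r) ⊕ (Fin 2 × Fin (k - r)))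
      ((Fin r ⊕ Fin r) ⊕ (Fin 2 × Fin (k - r))) A :=
    Matrix.fromBlocks (Matrix.fromBlocks G 0 0 P1ᵀ) 0 0 1
  have hGP' : Gᵀ * P1ᵀ = 1 := by
    rw [← Matrix.transpose_mul, mul_eq_one_comm.1 hGP, Matrix.transpose_one]
  have hL : Lᵀ * splitForm A r (k - r) * L = splitForm A r (k - r) := by
    simp [L, splitForm, Matrix.fromBlocks_multiply, Matrix.fromBlocks_transpose, hGP',
        mul_eq_one_comm.1 hGP]
  let C0 : Matrix (Fin (k - r)) (Fin r) A := C.submatrix (fun l => ((0 : Fin 2), l)) id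
  let C1 : Matrix (Fin (k - r)) (Fin r) A := C.submatrix (fun l => ((1 : Fin 2), l)) id
  have hC : Cᵀ * polarForm A (k - r) * C = C0ᵀ * C1 + C1ᵀ * C0 :=
    transpose_mul_polarForm_mul C C
  -- A unipotent isometry clearing C. Its corner must have symmetrization -ᵗC J C, with J the polar
  -- form of the remaining planes; the choice -ᵗC₀C₁ achieves this without dividing by 2, so residue
  -- characteristic 2 is included.
  let N : Matrix ((Fin r ⊕ Fin r) ⊕ (Fin 2 × Fin (k - r)))
      ((Fin r ⊕ Fin r) ⊕ (Fin 2 × Fin (k - r))) A :=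
    Matrix.fromBlocks (Matrix.fromBlocks 1 0 (-(C0ᵀ * C1)) 1)
      (Matrix.fromRows 0 (Cᵀ * polarForm A (k - r))) (Matrix.fromCols (-C) 0) 1
  have hN : Nᵀ * splitForm A r (k - r) * N = splitForm A r (k - r) := by
    simp only [N, splitForm, Matrix.fromBlocks_multiply, Matrix.fromBlocks_transpose,
      Matrix.transpose_fromRows, Matrix.transpose_fromCols, Matrix.fromCols_mul_fromBlocks,
      Matrix.fromBlocks_mul_fromRows, Matrix.fromCols_mul_fromRows,
      Matrix.transpose_one, Matrix.transpose_zero, Matrix.transpose_neg, Matrix.transpose_mul,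
      Matrix.transpose_transpose, polarForm_transpose, Matrix.mul_zero, Matrix.zero_mul,
      Matrix.mul_one, Matrix.one_mul, add_zero, zero_add, Matrix.fromRows_mul,
      Matrix.mul_fromCols, Matrix.neg_mul, Matrix.mul_neg]
    rw [hC]
    refine Matrix.fromBlocks_inj.2 ⟨?_, ?_, ?_, rfl⟩
    · ext (i | i) (j | j)
      · simp only [Matrix.add_apply, Matrix.fromBlocks_apply₁₁, Matrix.fromCols_apply_inl,
          Matrix.neg_apply, Matrix.fromRows_apply_inl, Matrix.zero_apply]
        ring
      · simp
      · simp
      · simp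
    · ext (i | i) j <;> simp
    · ext i (j | j) <;> simp
  refine ⟨N * (L * Pτ), -(C0ᵀ * C1) + P1ᵀ * Q0 + Cᵀ * polarForm A (k - r) * C, ?_, ?_⟩
  · calc (N * (L * Pτ))ᵀ * splitForm A r (k - r) * (N * (L * Pτ))
        = Pτᵀ * (Lᵀ * (Nᵀ * splitForm A r (k - r) * N) * L) * Pτ := by
          simp only [Matrix.transpose_mul, Matrix.mul_assoc]
      _ = _ := by rw [hN, hL, hPτ]
  · have h1 : L * Matrix.fromRows (Matrix.fromRows P1 Q0) C =
        Matrix.fromRows (Matrix.fromRows 1 (P1ᵀ * Q0)) C := by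
      simp [L, Matrix.fromBlocks_mul_fromRows, hGP]
    rw [Matrix.mul_assoc, Matrix.mul_assoc, hPX, h1]
    simp only [N, Matrix.fromBlocks_mul_fromRows, Matrix.fromRows_mul, Matrix.fromCols_mul_fromRows,
      Matrix.one_mul, Matrix.zero_mul, Matrix.mul_one, add_zero, neg_add_cancel]
    congr 1
    ext (i | i) j <;> simp

end Frame

/-! ### Solutions with prescribed last columns -/

section Fibres

variable {F : Type*} [Field F] [ValuativeRel F] [TopologicalSpace F]
  [IsNonarchimedeanLocalField F]

theorem hyp_eq (k : ℕ) : hyp F k = (1 / 2 : F) • toField (polarForm 𝒪[F] k) := by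
  ext ⟨c, l⟩ ⟨c', l'⟩
  simp only [hyp, Matrix.blockDiagonal_apply, Matrix.smul_apply, toField_apply, polarForm,
    Matrix.of_apply, smul_eq_mul]
  by_cases h : l = l'
  · subst h
    fin_cases c <;> fin_cases c' <;> simp
  · simp [h]

variable [CharZero F]

theorem isHalfIntegral_hyp (k : ℕ) : IsHalfIntegral (hyp F k) := by
  rw [hyp_eq]
  refine ⟨?_, fun i => ?_, fun i j _ => ?_⟩
  · rw [Matrix.IsSymm, Matrix.transpose_smul, ← toField_transpose, polarForm_transpose]
  · have : ((1 / 2 : F) • toField (polarForm 𝒪[F] k)) i i = 0 := by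
      simp [polarForm]
    rw [this]; exact zero_mem _
  · have : 2 * ((1 / 2 : F) • toField (polarForm 𝒪[F] k)) i j = (polarForm 𝒪[F] k i j : F) := by
      simp only [Matrix.smul_apply, toField_apply, smul_eq_mul]
      ring
    rw [this]; exact (polarForm 𝒪[F] k i j).2

theorem memPowHalfIntegral_blocks {m n : Type*} {ϖ : 𝒪[F]} {e : ℕ}
    {M : Matrix (m ⊕ n) (m ⊕ n) F} (hM : M.IsSymm) :
    MemPowHalfIntegral ϖ e M ↔ MemPowHalfIntegral ϖ e M.toBlocks₁₁ ∧
      MemPowHalfIntegral ϖ e M.toBlocks₂₂ ∧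
      ∃ Z : Matrix n m 𝒪[F], (2 : F) • M.toBlocks₂₁ = (ϖ : F) ^ e • toField Z := by
  constructor
  · rintro ⟨Z, ⟨hs, hd, ho⟩, rfl⟩
    refine ⟨⟨Z.toBlocks₁₁, ⟨?_, fun i => hd _, fun i j hij => ho _ _ (by simpa using hij)⟩, rfl⟩,
      ⟨Z.toBlocks₂₂, ⟨?_, fun i => hd _, fun i j hij => ho _ _ (by simpa using hij)⟩, rfl⟩,
      Matrix.of fun i j => ⟨2 * Z (Sum.inr i) (Sum.inl j), ho _ _ (by simp)⟩, ?_⟩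
    · ext i j; exact hs.apply _ _
    · ext i j; exact hs.apply _ _
    · ext i j
      simp only [Matrix.smul_apply, Matrix.toBlocks₂₁, Matrix.of_apply, toField_apply, smul_eq_mul]
      ring
  · rintro ⟨⟨Z1, ⟨hs1, hd1, ho1⟩, h1⟩, ⟨Z2, ⟨hs2, hd2, ho2⟩, h2⟩, Z, hZ⟩
    have h21 : M.toBlocks₂₁ = (ϖ : F) ^ e • (1 / 2 : F) • toField Z := by
      rw [smul_comm, ← hZ, smul_smul]; norm_num
    have h12 : M.toBlocks₁₂ = (M.toBlocks₂₁)ᵀ := by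
      ext i j
      exact (hM.apply (Sum.inl i) (Sum.inr j)).symm
    refine ⟨Matrix.fromBlocks Z1 ((1 / 2 : F) • (toField Z)ᵀ) ((1 / 2 : F) • toField Z) Z2,
      ⟨?_, ?_, ?_⟩, ?_⟩
    · rw [Matrix.IsSymm, Matrix.fromBlocks_transpose, hs1.eq, hs2.eq]
      simp
    · rintro (i | i)
      · exact hd1 i
      · exact hd2 i
    · rintro (i | i) (j | j) hij
      · exact ho1 i j (by simpa using hij)
      · simp only [Matrix.fromBlocks_apply₁₂, Matrix.smul_apply, Matrix.transpose_apply,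
          toField_apply, smul_eq_mul]
        rw [← mul_assoc]; norm_num
      · simp only [Matrix.fromBlocks_apply₂₁, Matrix.smul_apply,
          toField_apply, smul_eq_mul]
        rw [← mul_assoc]; norm_num
      · exact ho2 i j (by simpa using hij)
    · rw [← Matrix.fromBlocks_toBlocks M, h12, h21, h1, h2, Matrix.fromBlocks_smul]
      simp only [Matrix.transpose_smul]

theorem toField_fromCols {l m n : Type*} (X : Matrix l m 𝒪[F]) (Y : Matrix l n 𝒪[F]) :
    toField (Matrix.fromCols X Y) = Matrix.fromCols (toField X) (toField Y) := by
  ext i (j | j) <;> rfl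

theorem quadSubst_fromCols {l m n : Type*} [Fintype l] (S : Matrix l l F) (X : Matrix l m F)
    (Y : Matrix l n F) : quadSubst S (Matrix.fromCols X Y) =
      Matrix.fromBlocks (quadSubst S X) (Xᵀ * S * Y) (Yᵀ * S * X) (quadSubst S Y) := by
  simp only [quadSubst, Matrix.transpose_fromCols, Matrix.fromRows_mul, Matrix.mul_fromCols]
  ext (i | i) (j | j) <;> simp

theorem blockSubst_eq {s r : Type*} [Fintype s] [DecidableEq s] [Fintype r]
    (T : Matrix s s F) (R : Matrix r s F) (A : Matrix r r F) (X : Matrix r s 𝒪[F]) :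
    blockSubst T R A X =
      T + (1 / 2 : F) • ((toField X)ᵀ * R + Rᵀ * toField X) + quadSubst A (toField X) := by
  simp only [blockSubst, quadSubst, Matrix.transpose_fromRows,
    Matrix.fromCols_mul_fromBlocks, Matrix.fromCols_mul_fromRows,
    Matrix.smul_mul, Matrix.mul_smul, Matrix.transpose_one, Matrix.one_mul,
    Matrix.mul_one, Matrix.add_mul, smul_add]
  abel

variable {k r p : ℕ} {ϖ : 𝒪[F]}

/-- Solutions with prescribed last columns, in coordinates with respect to an adapted hyperbolic
basis. -/
theorem fromCols_mem_solSet_iff {e : ℕ} {T : Matrix (Fin p ⊕ Fin r) (Fin p ⊕ Fin r) F}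
    (hT : IsHalfIntegral T) {R : Matrix (Fin r) (Fin p) 𝒪[F]}
    (hR : (2 : F) • T.toBlocks₂₁ = toField R) {X₂ : Matrix (Fin 2 × Fin k) (Fin r) 𝒪[F]}
    (hX₂ : X₂ ∈ solSet ϖ e (hyp F k) T.toBlocks₂₂)
    {U : Matrix ((Fin r ⊕ Fin r) ⊕ (Fin 2 × Fin (k - r))) (Fin 2 × Fin k) 𝒪[F]}
    {Q : Matrix (Fin r) (Fin r) 𝒪[F]} (hU : Uᵀ * splitForm 𝒪[F] r (k - r) * U = polarForm 𝒪[F] k)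
    (hUX : U * X₂ = Matrix.fromRows (Matrix.fromRows 1 Q) 0)
    {X₁ : Matrix (Fin 2 × Fin k) (Fin p) 𝒪[F]} {x b : Matrix (Fin r) (Fin p) 𝒪[F]}
    {c : Matrix (Fin 2 × Fin (k - r)) (Fin p) 𝒪[F]}
    (hX₁ : U * X₁ = Matrix.fromRows (Matrix.fromRows (-x) b) c) :
    Matrix.fromCols X₁ X₂ ∈ solSet ϖ e (hyp F k) T ↔
      (c, x) ∈ modifiedSolSet ϖ e (hyp F (k - r)) T.toBlocks₁₁ ((2 : F) • T.toBlocks₂₁)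
        T.toBlocks₂₂ ∧ ∀ i j, ϖ ^ e ∣ b i j - (R + Qᵀ * x) i j := by
  have hpol : ∀ {m n : Type} (Y : Matrix (Fin 2 × Fin k) m 𝒪[F]) (Z : Matrix (Fin 2 × Fin k) n 𝒪[F]),
      Yᵀ * polarForm 𝒪[F] k * Z = (U * Y)ᵀ * splitForm 𝒪[F] r (k - r) * (U * Z) := by
    intro m n Y Z
    rw [← hU]
    simp only [Matrix.transpose_mul, Matrix.mul_assoc]
  -- The three polar Gram blocks of (X₁, X₂) are computed in the frame, where X₂ = (1, Q, 0) and X₁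
  -- = (-x, b, c).
  have h22 : X₂ᵀ * polarForm 𝒪[F] k * X₂ = Q + Qᵀ := by
    rw [hpol, hUX]
    simp [splitForm, Matrix.transpose_fromRows, Matrix.fromCols_mul_fromBlocks,
      Matrix.fromCols_mul_fromRows, add_comm]
  have h21 : X₂ᵀ * polarForm 𝒪[F] k * X₁ = b - Qᵀ * x := by
    rw [hpol, hUX, hX₁]
    simp [splitForm, Matrix.transpose_fromRows, Matrix.fromCols_mul_fromBlocks,
      Matrix.fromCols_mul_fromRows]
    abel
  have h11 : X₁ᵀ * polarForm 𝒪[F] k * X₁ =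
      -(xᵀ * b) - bᵀ * x + cᵀ * polarForm 𝒪[F] (k - r) * c := by
    rw [hpol, hX₁]
    simp [splitForm, Matrix.transpose_fromRows, Matrix.fromCols_mul_fromBlocks,
      Matrix.fromCols_mul_fromRows]
    abel
  have hq : ∀ {n : Type} (j : ℕ) (Y : Matrix (Fin 2 × Fin j) n 𝒪[F]),
      quadSubst (hyp F j) (toField Y) =
      (1 / 2 : F) • toField (Yᵀ * polarForm 𝒪[F] j * Y) := by
    intro n j Y
    rw [hyp_eq, quadSubst_smul, toField_mul, toField_mul]
    rfl
  have hsymm : (quadSubst (hyp F k) (toField (Matrix.fromCols X₁ X₂)) - T).IsSymm :=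
    (quadSubst_isSymm (isHalfIntegral_hyp k).1 _).sub hT.1
  change MemPowHalfIntegral ϖ e _ ↔ MemPowHalfIntegral ϖ e _ ∧ _
  rw [memPowHalfIntegral_blocks hsymm, toField_fromCols, quadSubst_fromCols]
  have hb11 : (Matrix.fromBlocks (quadSubst (hyp F k) (toField X₁))
      ((toField X₁)ᵀ * hyp F k * toField X₂) ((toField X₂)ᵀ * hyp F k * toField X₁)
      (quadSubst (hyp F k) (toField X₂)) - T).toBlocks₁₁ =
      quadSubst (hyp F k) (toField X₁) - T.toBlocks₁₁ := by
    ext i j; simp [Matrix.toBlocks₁₁]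
  have hb22 : (Matrix.fromBlocks (quadSubst (hyp F k) (toField X₁))
      ((toField X₁)ᵀ * hyp F k * toField X₂) ((toField X₂)ᵀ * hyp F k * toField X₁)
      (quadSubst (hyp F k) (toField X₂)) - T).toBlocks₂₂ =
      quadSubst (hyp F k) (toField X₂) - T.toBlocks₂₂ := by
    ext i j; simp [Matrix.toBlocks₂₂]
  have hb21 : (2 : F) • (Matrix.fromBlocks (quadSubst (hyp F k) (toField X₁))
      ((toField X₁)ᵀ * hyp F k * toField X₂) ((toField X₂)ᵀ * hyp F k * toField X₁)
      (quadSubst (hyp F k) (toField X₂)) - T).toBlocks₂₁ =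
      toField (b - (R + Qᵀ * x)) := by
    have h1 : (2 : F) • ((toField X₂)ᵀ * hyp F k * toField X₁) = toField (b - Qᵀ * x) := by
      rw [← h21, hyp_eq, Matrix.mul_smul, Matrix.smul_mul, smul_smul, toField_mul, toField_mul]
      norm_num
      rfl
    have h2 : b - (R + Qᵀ * x) = (b - Qᵀ * x) - R := by abel
    rw [h2, toField_sub, ← h1, ← hR, ← smul_sub]
    congr 1
  rw [hb11, hb22, hb21]
  have hdvd : (∃ Z : Matrix (Fin r) (Fin p) 𝒪[F],
      toField (b - (R + Qᵀ * x)) = (ϖ : F) ^ e • toField Z) ↔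
      ∀ i j, ϖ ^ e ∣ b i j - (R + Qᵀ * x) i j := by
    have : (∀ i j, ϖ ^ e ∣ b i j - (R + Qᵀ * x) i j) ↔
        ∃ Z : Matrix (Fin r) (Fin p) 𝒪[F], b - (R + Qᵀ * x) = ϖ ^ e • Z := dvd_matrix_iff
    rw [this]
    refine exists_congr fun Z => ?_
    constructor
    · intro h
      refine Matrix.ext fun i j => Subtype.ext ?_
      have := congrFun (congrFun h i) j
      simpa using this
    · intro h
      rw [h, toField_smul]; push_cast; rfl
  rw [hdvd]
  have h22' : MemPowHalfIntegral ϖ e (quadSubst (hyp F k) (toField X₂) - T.toBlocks₂₂) := hX₂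
  rw [and_iff_right h22']
  refine and_congr_left fun hb => ?_
  obtain ⟨Z, hZ⟩ : ∃ Z, b - (R + Qᵀ * x) = ϖ ^ e • Z := dvd_matrix_iff.1 hb
  -- X₁ + X₂x has coordinates (0, b + Qx, c), so its value is that of c. With b = R + ᵗQx + ϖ^e Z,
  -- the two congruences differ by the error of X₂ evaluated at x and by the symmetrization of ϖ^e
  -- ᵗxZ, both harmless.
  have hdiff : MemPowHalfIntegral ϖ e ((quadSubst (hyp F k) (toField X₁) - T.toBlocks₁₁) -
      (quadSubst (hyp F (k - r)) (toField c) -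
        blockSubst T.toBlocks₁₁ ((2 : F) • T.toBlocks₂₁) T.toBlocks₂₂ x)) := by
    have h3 := (h22'.quadSubst x).neg.add (memPowHalfIntegral_symmetrize (ϖ := ϖ) e (-(xᵀ * Z)))
    convert h3 using 1
    have hbeq : b = R + Qᵀ * x + ϖ ^ e • Z := by rw [← hZ]; abel
    rw [blockSubst_eq, hR, hq k X₁, hq k X₂, hq _ c, h11, h22, hbeq]
    simp only [quadSubst, toField_add, toField_sub, toField_neg, toField_mul, toField_smul,
      toField_transpose, Matrix.transpose_add, Matrix.transpose_smul, Matrix.transpose_mul,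
      Matrix.transpose_transpose, Matrix.mul_add, Matrix.add_mul, Matrix.mul_sub, Matrix.sub_mul,
      Matrix.mul_smul, Matrix.smul_mul, smul_add, smul_sub, smul_neg, Matrix.mul_assoc,
      Matrix.transpose_neg]
    push_cast
    simp only [smul_smul, mul_comm (1 / 2 : F)]
    abel
  constructor
  · intro h
    have := h.sub hdiff
    simpa using this
  · intro h
    have := h.add hdiff
    simpa using this

theorem toField_fromRows {l m n : Type*} (X : Matrix l n 𝒪[F]) (Y : Matrix m n 𝒪[F]) :
    toField (Matrix.fromRows X Y) = Matrix.fromRows (toField X) (toField Y) := by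
  ext (i | i) j <;> rfl

theorem blockSubst_toBlocks {s r : Type*} [Fintype s] [DecidableEq s] [Fintype r]
    {T : Matrix (s ⊕ r) (s ⊕ r) F} (hT : T.IsSymm) (x : Matrix r s 𝒪[F]) :
    blockSubst T.toBlocks₁₁ ((2 : F) • T.toBlocks₂₁) T.toBlocks₂₂ x =
      quadSubst T (toField (Matrix.fromRows 1 x)) := by
  have h12 : T.toBlocks₁₂ = (T.toBlocks₂₁)ᵀ := by
    ext i j
    exact (hT.apply (Sum.inl i) (Sum.inr j)).symm
  conv_rhs => rw [← Matrix.fromBlocks_toBlocks T, h12]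
  rw [blockSubst, toField_fromRows, toField_one, Matrix.transpose_smul, smul_smul, smul_smul]
  norm_num

theorem blockSubst_sub_mem {s r : Type*} [Fintype s] [DecidableEq s] [Fintype r]
    {T : Matrix (s ⊕ r) (s ⊕ r) F} (hT : IsHalfIntegral T) (e : ℕ) (x z : Matrix r s 𝒪[F]) :
    MemPowHalfIntegral ϖ e
      (blockSubst T.toBlocks₁₁ ((2 : F) • T.toBlocks₂₁) T.toBlocks₂₂ (x + ϖ ^ e • z) -
        blockSubst T.toBlocks₁₁ ((2 : F) • T.toBlocks₂₁) T.toBlocks₂₂ x) := by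
  rw [blockSubst_toBlocks hT.1, blockSubst_toBlocks hT.1]
  have : Matrix.fromRows 1 (x + ϖ ^ e • z) = Matrix.fromRows 1 x +
      ϖ ^ e • Matrix.fromRows (0 : Matrix s s 𝒪[F]) z := by
    ext (i | i) j <;> simp
  rw [this]
  exact memPowHalfIntegral_quadSubst_sub hT e _ _

theorem isOpen_modifiedSolSet {m s r : Type*} [Fintype m] [Fintype s] [DecidableEq s] [Fintype r]
    (hϖ : Irreducible ϖ) {S : Matrix m m F} (hS : IsHalfIntegral S)
    {T : Matrix (s ⊕ r) (s ⊕ r) F} (hT : IsHalfIntegral T) (e : ℕ) :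
    IsOpen (modifiedSolSet ϖ e S T.toBlocks₁₁ ((2 : F) • T.toBlocks₂₁) T.toBlocks₂₂) := by
  refine isOpen_of_add_mem ((isOpen_dvd_matrix ϖ hϖ e m s).prod (isOpen_dvd_matrix ϖ hϖ e r s))
    (by simp) ?_
  rintro ⟨c, x⟩ hX ⟨z, w⟩ ⟨hz, hw⟩
  obtain ⟨z, rfl⟩ := dvd_matrix_iff.1 hz
  obtain ⟨w, rfl⟩ := dvd_matrix_iff.1 hw
  have h1 := memPowHalfIntegral_quadSubst_sub (ϖ := ϖ) hS e c z
  have h2 := blockSubst_sub_mem (ϖ := ϖ) hT e x w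
  have h3 : MemPowHalfIntegral ϖ e (quadSubst S (toField c) -
    blockSubst T.toBlocks₁₁ ((2 : F) • T.toBlocks₂₁) T.toBlocks₂₂ x) := hX
  have := (h1.sub h2).add h3
  change MemPowHalfIntegral ϖ e _
  refine Eq.mp (congrArg (MemPowHalfIntegral ϖ e) ?_) this
  simp only [Prod.mk_add_mk]
  abel

/-- The coordinates of a matrix with respect to an adapted hyperbolic basis. -/
noncomputable def frameCoord
    (U : Matrix ((Fin r ⊕ Fin r) ⊕ (Fin 2 × Fin (k - r))) (Fin 2 × Fin k) 𝒪[F]) (p : ℕ) :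
    Matrix (Fin 2 × Fin k) (Fin p) 𝒪[F] →+
      (Matrix (Fin 2 × Fin (k - r)) (Fin p) 𝒪[F] × Matrix (Fin r) (Fin p) 𝒪[F]) ×
        Matrix (Fin r) (Fin p) 𝒪[F] where
  toFun X := (((U * X).submatrix Sum.inr id, -(U * X).submatrix (Sum.inl ∘ Sum.inl) id),
    (U * X).submatrix (Sum.inl ∘ Sum.inr) id)
  map_zero' := by simp
  map_add' X Y := by
    simp only [Matrix.mul_add, Matrix.submatrix_add, Pi.add_apply, Prod.mk_add_mk, neg_add]

theorem mul_eq_frameCoord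
    (U : Matrix ((Fin r ⊕ Fin r) ⊕ (Fin 2 × Fin (k - r))) (Fin 2 × Fin k) 𝒪[F])
    (X : Matrix (Fin 2 × Fin k) (Fin p) 𝒪[F]) :
    U * X = Matrix.fromRows (Matrix.fromRows (-(frameCoord U p X).1.2) (frameCoord U p X).2)
      (frameCoord U p X).1.1 := by
  ext ((i | i) | i) j <;> simp [frameCoord]

/-- The polar form J is its own inverse, so ᵗU S U = J exhibits JᵗU S as a left inverse of U. It is
two-sided because the index sets have equal size, which is where r ≤ k enters. -/
theorem frame_mul_inverse
    {U : Matrix ((Fin r ⊕ Fin r) ⊕ (Fin 2 × Fin (k - r))) (Fin 2 × Fin k) 𝒪[F]}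
    (hU : Uᵀ * splitForm 𝒪[F] r (k - r) * U = polarForm 𝒪[F] k) (hrk : r ≤ k) :
    ∃ V : Matrix (Fin 2 × Fin k) ((Fin r ⊕ Fin r) ⊕ (Fin 2 × Fin (k - r))) 𝒪[F],
      V * U = 1 ∧ U * V = 1 := by
  have h1 : (polarForm 𝒪[F] k * Uᵀ * splitForm 𝒪[F] r (k - r)) * U = 1 := by
    rw [Matrix.mul_assoc, Matrix.mul_assoc, ← Matrix.mul_assoc Uᵀ, hU, polarForm_mul_self]
  refine ⟨_, h1, (Matrix.mul_eq_one_comm_of_card_eq _ _ _ ?_).1 h1⟩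
  simp only [Fintype.card_sum, Fintype.card_prod, Fintype.card_fin]
  omega

theorem frameCoord_surjective
    {U : Matrix ((Fin r ⊕ Fin r) ⊕ (Fin 2 × Fin (k - r))) (Fin 2 × Fin k) 𝒪[F]}
    (hU : Uᵀ * splitForm 𝒪[F] r (k - r) * U = polarForm 𝒪[F] k) (hrk : r ≤ k) :
    Function.Surjective (frameCoord U p) := by
  obtain ⟨V, -, hV⟩ := frame_mul_inverse hU hrk
  rintro ⟨⟨c, x⟩, b⟩
  refine ⟨V * Matrix.fromRows (Matrix.fromRows (-x) b) c, ?_⟩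
  simp only [frameCoord, AddMonoidHom.coe_mk, ZeroHom.coe_mk, ← Matrix.mul_assoc, hV,
    Matrix.one_mul]
  refine Prod.ext (Prod.ext ?_ ?_) ?_
  · ext i j; simp
  · ext i j; simp
  · ext i j; simp

theorem continuous_frameCoord
    (U : Matrix ((Fin r ⊕ Fin r) ⊕ (Fin 2 × Fin (k - r))) (Fin 2 × Fin k) 𝒪[F]) :
    Continuous (frameCoord U p) := by
  have h : Continuous fun X : Matrix (Fin 2 × Fin k) (Fin p) 𝒪[F] => U * X :=
    continuous_const.matrix_mul continuous_id
  exact ((h.matrix_submatrix _ _).prodMk (h.matrix_submatrix _ _).neg).prodMk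
    (h.matrix_submatrix _ _)

/-- The volume of the solutions with prescribed last columns. -/
theorem compactVol_fibre (hϖ : Irreducible ϖ) {e : ℕ} {T : Matrix (Fin p ⊕ Fin r) (Fin p ⊕ Fin r) F}
    (hT : IsHalfIntegral T) {X₂ : Matrix (Fin 2 × Fin k) (Fin r) 𝒪[F]}
    (hX₂ : X₂ ∈ solSet ϖ e (hyp F k) T.toBlocks₂₂)
    {U : Matrix ((Fin r ⊕ Fin r) ⊕ (Fin 2 × Fin (k - r))) (Fin 2 × Fin k) 𝒪[F]}
    {Q : Matrix (Fin r) (Fin r) 𝒪[F]} (hrk : r ≤ k)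
    (hU : Uᵀ * splitForm 𝒪[F] r (k - r) * U = polarForm 𝒪[F] k)
    (hUX : U * X₂ = Matrix.fromRows (Matrix.fromRows 1 Q) 0)
    {Ψ : Set (Matrix (Fin 2 × Fin (k - r)) (Fin p) 𝒪[F] × Matrix (Fin r) (Fin p) 𝒪[F])}
    (hΨ : IsOpen Ψ) :
    compactVol {X₁ : Matrix (Fin 2 × Fin k) (Fin p) 𝒪[F] |
        Matrix.fromCols X₁ X₂ ∈ solSet ϖ e (hyp F k) T ∧ (frameCoord U p X₁).1 ∈ Ψ} =
      compactVol (modifiedSolSet ϖ e (hyp F (k - r)) T.toBlocks₁₁ ((2 : F) • T.toBlocks₂₁)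
        T.toBlocks₂₂ ∩ Ψ) * ((residueCard F : ℝ) ^ (r * (p * e)))⁻¹ := by
  obtain ⟨T2, hT2⟩ := hT.exists_two_smul
  have hR : (2 : F) • T.toBlocks₂₁ = toField T2.toBlocks₂₁ := by
    ext i j
    exact congrFun (congrFun hT2 (Sum.inr i)) (Sum.inl j)
  have hD := isOpen_modifiedSolSet hϖ (isHalfIntegral_hyp (F := F) (k - r)) hT e
  -- For each admissible (c, x) the block b runs through a single class modulo ϖ^e, of volume
  -- q^{-rpe}. The set Ψ later carries primitivity of c.
  let C : Set ((Matrix (Fin 2 × Fin (k - r)) (Fin p) 𝒪[F] × Matrix (Fin r) (Fin p) 𝒪[F]) ×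
      Matrix (Fin r) (Fin p) 𝒪[F]) :=
    {y | y.1 ∈ modifiedSolSet ϖ e (hyp F (k - r)) T.toBlocks₁₁ ((2 : F) • T.toBlocks₂₁)
        T.toBlocks₂₂ ∩ Ψ ∧ ∀ i j, ϖ ^ e ∣ y.2 i j - (T2.toBlocks₂₁ + Qᵀ * y.1.2) i j}
  have hC : IsOpen C := by
    refine ((hD.inter hΨ).preimage continuous_fst).inter ?_
    have : Continuous fun y : (Matrix (Fin 2 × Fin (k - r)) (Fin p) 𝒪[F] ×
        Matrix (Fin r) (Fin p) 𝒪[F]) × Matrix (Fin r) (Fin p) 𝒪[F] =>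
        y.2 - (T2.toBlocks₂₁ + Qᵀ * y.1.2) :=
      continuous_snd.sub (continuous_const.add
        (continuous_const.matrix_mul (continuous_snd.comp continuous_fst)))
    exact (isOpen_dvd_matrix ϖ hϖ e (Fin r) (Fin p)).preimage this
  have hpre : {X₁ : Matrix (Fin 2 × Fin k) (Fin p) 𝒪[F] |
        Matrix.fromCols X₁ X₂ ∈ solSet ϖ e (hyp F k) T ∧ (frameCoord U p X₁).1 ∈ Ψ} =
      frameCoord U p ⁻¹' C := by
    ext X₁
    have := fromCols_mem_solSet_iff hT hR hX₂ hU hUX (mul_eq_frameCoord U X₁)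
    rw [Set.mem_ofPred_eq, this]
    constructor
    · rintro ⟨⟨h1, h2⟩, h3⟩
      exact ⟨⟨h1, h3⟩, h2⟩
    · rintro ⟨⟨h1, h3⟩, h2⟩
      exact ⟨⟨h1, h2⟩, h3⟩
  rw [hpre, compactVol_preimage_hom _ (continuous_frameCoord U) (frameCoord_surjective hU hrk) hC]
  refine compactVol_prod hC (hD.inter hΨ) (fun y hy => ?_) (fun y hy => ?_)
  · have h := compactVol_dvd_sub ϖ hϖ e (T2.toBlocks₂₁ + Qᵀ * y.2)
    simp only [Fintype.card_fin] at h
    rw [← h]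
    congr 1
    ext b
    exact and_iff_right hy
  · ext b
    simp only [Set.mem_ofPred_eq, Set.mem_empty_iff_false, iff_false]
    exact fun h => hy h.1

end Fibres

/-! ### Existence of pivots in distinct hyperbolic planes -/

section Pivot

/-- Two independent vectors spanning a totally singular plane have a nonzero minor formed from two
distinct hyperbolic planes. -/
theorem exists_minor_ne_zero {K : Type*} [Field K] {k : ℕ} (v w : Fin 2 × Fin k → K)
    (hind : ∀ a b : K, (∀ s, a * v s + b * w s = 0) → a = 0 ∧ b = 0)
    (hvv : ∑ l, v (0, l) * v (1, l) = 0)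
    (hvw : ∑ l, (v (0, l) * w (1, l) + v (1, l) * w (0, l)) = 0) :
    ∃ (i j : Fin k) (c c' : Fin 2), i ≠ j ∧ v (c, i) * w (c', j) - v (c', j) * w (c, i) ≠ 0 := by
  by_contra! hcon
  obtain ⟨s, hs⟩ : ∃ s, v s ≠ 0 := by
    by_contra! h
    exact one_ne_zero (hind 1 0 (by simp [h])).1
  obtain ⟨t, ht⟩ : ∃ t, w s * v t - v s * w t ≠ 0 := by
    by_contra! h
    have := (hind (w s) (-v s) (fun t => by rw [← h t]; ring)).2
    exact hs (neg_eq_zero.1 this)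
  obtain ⟨c, i⟩ := s
  obtain ⟨c', i'⟩ := t
  -- Minors across two planes vanish by assumption, so the nonzero minor lies inside one plane.
  have hii : i = i' := by
    by_contra hne
    apply ht
    have := hcon i i' c c' hne
    linear_combination -this
  subst hii
  have hdet : v (0, i) * w (1, i) - v (1, i) * w (0, i) ≠ 0 := by
    intro h0
    apply ht
    fin_cases c <;> fin_cases c' <;> simp only [Fin.zero_eta, Fin.mk_one] <;>
      first | ring1 | linear_combination h0 | linear_combination -h0
  -- The rows of another plane pair to zero with two independent rows, so they vanish, and v, w both
  -- live in the plane i.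
  have hz : ∀ j, i ≠ j → ∀ c, v (c, j) = 0 ∧ w (c, j) = 0 := by
    intro j hj c
    have h0 := hcon i j 0 c hj
    have h1 := hcon i j 1 c hj
    constructor
    · refine (mul_eq_zero.1 (?_ : (v (0, i) * w (1, i) - v (1, i) * w (0, i)) * v (c, j) =
        0)).resolve_left hdet
      linear_combination v (1, i) * h0 - v (0, i) * h1
    · refine (mul_eq_zero.1 (?_ : (v (0, i) * w (1, i) - v (1, i) * w (0, i)) * w (c, j) =
        0)).resolve_left hdet
      linear_combination w (1, i) * h0 - w (0, i) * h1
  rw [Finset.sum_eq_single i (fun j _ hj => by simp [hz j hj.symm]) (by simp)] at hvv hvw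
  apply hdet
  -- In a single plane, v₀v₁ = 0 and v₀w₁ + v₁w₀ = 0 make the two products negatives of each other
  -- with product zero; both vanish, against the nonzero minor. No division by 2 occurs.
  have hprod : (v (0, i) * w (1, i)) * (v (1, i) * w (0, i)) = 0 := by
    linear_combination w (1, i) * w (0, i) * hvv
  rcases mul_eq_zero.1 hprod with h | h
  · linear_combination 2 * h - hvw
  · linear_combination hvw - 2 * h

variable {F : Type*} [Field F] [ValuativeRel F] [TopologicalSpace F]
  [IsNonarchimedeanLocalField F] [CharZero F] {ϖ : 𝒪[F]}

theorem polarForm_quadratic_apply {A : Type*} [CommRing A] {k : ℕ} {n : Type*}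
    (X : Matrix (Fin 2 × Fin k) n A) (i j : n) :
    (Xᵀ * polarForm A k * X) i j =
      ∑ l, (X (0, l) i * X (1, l) j + X (1, l) i * X (0, l) j) := by
  rw [transpose_mul_polarForm_mul, Finset.sum_add_distrib]
  rfl

theorem quadSubst_hyp {n : Type*} {k : ℕ} (X : Matrix (Fin 2 × Fin k) n 𝒪[F]) :
    quadSubst (hyp F k) (toField X) =
      (1 / 2 : F) • toField (Xᵀ * polarForm 𝒪[F] k * X) := by
  rw [hyp_eq, quadSubst_smul, toField_mul, toField_mul]
  rfl

theorem quadSubst_hyp_diag {n : Type*} {k : ℕ} (X : Matrix (Fin 2 × Fin k) n 𝒪[F]) (i : n) :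
    quadSubst (hyp F k) (toField X) i i = ((∑ l, X (0, l) i * X (1, l) i : 𝒪[F]) : F) := by
  have h : (∑ l, (X (0, l) i * X (1, l) i + X (1, l) i * X (0, l) i)) =
      2 * ∑ l, X (0, l) i * X (1, l) i := by
    rw [Finset.mul_sum]
    exact Finset.sum_congr rfl fun l _ => by ring
  rw [quadSubst_hyp, Matrix.smul_apply, toField_apply, polarForm_quadratic_apply, h, smul_eq_mul,
    Subring.coe_mul]
  have h2 : ((2 : 𝒪[F]) : F) = 2 := rfl
  rw [h2]
  ring

theorem quadSubst_hyp_two_mul {n : Type*} {k : ℕ} (X : Matrix (Fin 2 × Fin k) n 𝒪[F]) (i j : n) :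
    2 * quadSubst (hyp F k) (toField X) i j =
      ((∑ l, (X (0, l) i * X (1, l) j + X (1, l) i * X (0, l) j) : 𝒪[F]) : F) := by
  rw [quadSubst_hyp, Matrix.smul_apply, toField_apply, polarForm_quadratic_apply, smul_eq_mul,
    ← mul_assoc]
  norm_num

/-- Any unit entry serves as pivot, whatever number the column represents. -/
theorem exists_frame_of_isPrimitive_one {k : ℕ} {X : Matrix (Fin 2 × Fin k) (Fin 1) 𝒪[F]}
    (hX : IsPrimitiveMatrix X) : 1 ≤ k ∧
    ∃ (U : Matrix ((Fin 1 ⊕ Fin 1) ⊕ (Fin 2 × Fin (k - 1))) (Fin 2 × Fin k) 𝒪[F])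
      (Q : Matrix (Fin 1) (Fin 1) 𝒪[F]),
      Uᵀ * splitForm 𝒪[F] 1 (k - 1) * U = polarForm 𝒪[F] k ∧
      U * X = Matrix.fromRows (Matrix.fromRows 1 Q) 0 := by
  obtain ⟨⟨c, i⟩, h⟩ := isPrimitiveMatrix_column_iff.1 hX
  refine ⟨(Nat.zero_le _).trans_lt i.2, ?_⟩
  exact exists_frame X (fun _ => i) (fun a b _ => Subsingleton.elim a b) (fun _ => c)
    (by simpa using h)

/-- Since T is divisible by ϖ and 1 ≤ e, the reduced columns span a totally singular plane; this
excludes that the only unit minors sit inside one hyperbolic plane. -/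
theorem exists_frame_of_isPrimitive_two {k e : ℕ} (hϖ : Irreducible ϖ) (he : 1 ≤ e)
    {X : Matrix (Fin 2 × Fin k) (Fin 2) 𝒪[F]} {T : Matrix (Fin 2) (Fin 2) F}
    (hT : MemPowHalfIntegral ϖ 1 T) (hXT : X ∈ solSet ϖ e (hyp F k) T)
    (hX : IsPrimitiveMatrix X) : 2 ≤ k ∧
    ∃ (U : Matrix ((Fin 2 ⊕ Fin 2) ⊕ (Fin 2 × Fin (k - 2))) (Fin 2 × Fin k) 𝒪[F])
      (Q : Matrix (Fin 2) (Fin 2) 𝒪[F]),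
      Uᵀ * splitForm 𝒪[F] 2 (k - 2) * U = polarForm 𝒪[F] k ∧
      U * X = Matrix.fromRows (Matrix.fromRows 1 Q) 0 := by
  have hmem : MemPowHalfIntegral ϖ 1 (quadSubst (hyp F k) (toField X)) := by
    have h1 : MemPowHalfIntegral ϖ e (quadSubst (hyp F k) (toField X) - T) := hXT
    simpa using (h1.mono he).add hT
  have hres : ∀ a : 𝒪[F], (∃ z ∈ 𝒪[F], (a : F) = (ϖ : F) * z) →
      IsLocalRing.residue 𝒪[F] a = 0 := by
    rintro a ⟨z, hz, h⟩
    rw [IsLocalRing.residue_eq_zero_iff, hϖ.maximalIdeal_eq, Ideal.mem_span_singleton]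
    exact ⟨⟨z, hz⟩, Subtype.ext h⟩
  obtain ⟨Z, ⟨-, hd, ho⟩, hZ⟩ := hmem
  rw [pow_one] at hZ
  have hdiag : ∀ i, ∑ l, IsLocalRing.residue 𝒪[F] (X (0, l) i) *
      IsLocalRing.residue 𝒪[F] (X (1, l) i) = 0 := by
    intro i
    have := hres (∑ l, X (0, l) i * X (1, l) i) ⟨Z i i, hd i, by
      rw [← quadSubst_hyp_diag, hZ]; rfl⟩
    simpa only [map_sum, map_mul] using this
  have hoff : ∑ l, (IsLocalRing.residue 𝒪[F] (X (0, l) 0) * IsLocalRing.residue 𝒪[F] (X (1, l) 1) +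
      IsLocalRing.residue 𝒪[F] (X (1, l) 0) * IsLocalRing.residue 𝒪[F] (X (0, l) 1)) = 0 := by
    have := hres (∑ l, (X (0, l) 0 * X (1, l) 1 + X (1, l) 0 * X (0, l) 1))
      ⟨2 * Z 0 1, ho 0 1 (by decide), by
        rw [← quadSubst_hyp_two_mul, hZ, Matrix.smul_apply, smul_eq_mul]; ring⟩
    simpa only [map_sum, map_mul, map_add] using this
  obtain ⟨i, j, c, c', hij, hne⟩ := exists_minor_ne_zero
    (fun s => IsLocalRing.residue 𝒪[F] (X s 0)) (fun s => IsLocalRing.residue 𝒪[F] (X s 1))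
    (by
      intro a b hab
      have := isPrimitiveMatrix_iff.1 hX ![a, b] (by
        funext s
        simp only [Matrix.mulVec, dotProduct, Fin.sum_univ_two, residueMatrix, Matrix.map_apply,
          Matrix.cons_val_zero, Matrix.cons_val_one, Pi.zero_apply]
        rw [← hab s]; ring)
      exact ⟨congrFun this 0, congrFun this 1⟩)
    (hdiag 0) hoff
  have hinj : Function.Injective ![i, j] := by
    intro a b
    fin_cases a <;> fin_cases b <;> simp [hij, hij.symm]
  refine ⟨by simpa using Fintype.card_le_of_injective _ hinj, ?_⟩
  refine exists_frame X ![i, j] hinj ![c, c'] ?_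
  rw [← IsLocalRing.residue_ne_zero_iff_isUnit, Matrix.det_fin_two]
  simp only [Matrix.of_apply, Matrix.cons_val_zero, Matrix.cons_val_one, map_sub, map_mul]
  intro h
  apply hne
  rw [← h]; ring

end Pivot

/-! ### The volume of solutions with primitive last columns -/

section PrimitivePart

variable {F : Type*} [Field F] [ValuativeRel F] [TopologicalSpace F]
  [IsNonarchimedeanLocalField F] [CharZero F] {ϖ : 𝒪[F]}

theorem compactVol_inter_add_diff {G : Type*} [TopologicalSpace G] [AddGroup G]
    [IsTopologicalAddGroup G] [CompactSpace G] (C : Set G) {D : Set G} (hD : IsOpen D) :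
    compactVol (C ∩ D) + compactVol (C \ D) = compactVol C := by
  borelize G
  simp only [compactVol_eq]
  exact MeasureTheory.measureReal_inter_add_sdiff hD.measurableSet

theorem fromCols_mem_solSet {m n l : Type*} [Fintype m] {S : Matrix m m F} {e : ℕ}
    (hS : S.IsSymm) {T : Matrix (n ⊕ l) (n ⊕ l) F} (hT : T.IsSymm) {X : Matrix m n 𝒪[F]}
    {Y : Matrix m l 𝒪[F]} (h : Matrix.fromCols X Y ∈ solSet ϖ e S T) :
    Y ∈ solSet ϖ e S T.toBlocks₂₂ := by
  have h1 : MemPowHalfIntegral ϖ e (quadSubst S (toField (Matrix.fromCols X Y)) - T) := h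
  rw [memPowHalfIntegral_blocks ((quadSubst_isSymm hS _).sub hT), toField_fromCols,
    quadSubst_fromCols] at h1
  have h2 := h1.2.1
  change MemPowHalfIntegral ϖ e _
  convert h2 using 1
  ext i j
  simp [Matrix.toBlocks₂₂]

/-- Splitting off the last columns. -/
def splitCols (m n l : Type*) : Matrix m (n ⊕ l) 𝒪[F] →+ Matrix m l 𝒪[F] × Matrix m n 𝒪[F] where
  toFun X := (X.toCols₂, X.toCols₁)
  map_zero' := rfl
  map_add' _ _ := rfl

theorem compactVol_splitCols {m n l : Type*} [Finite m] [Finite n] [Finite l]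
    {C : Set (Matrix m l 𝒪[F] × Matrix m n 𝒪[F])} (hC : IsOpen C) :
    compactVol {X : Matrix m (n ⊕ l) 𝒪[F] | (X.toCols₂, X.toCols₁) ∈ C} = compactVol C := by
  refine compactVol_preimage_hom (splitCols m n l) ?_ ?_ hC
  · exact (continuous_id.matrix_submatrix id Sum.inr).prodMk
      (continuous_id.matrix_submatrix id Sum.inl)
  · rintro ⟨Y, X⟩
    exact ⟨Matrix.fromCols X Y, Prod.ext (by ext i j; rfl) (by ext i j; rfl)⟩

variable {k r p e : ℕ}

/-- The volume of the solutions with primitive last columns. -/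
theorem compactVol_primitive_part (hϖ : Irreducible ϖ)
    {T : Matrix (Fin p ⊕ Fin r) (Fin p ⊕ Fin r) F} (hT : IsHalfIntegral T)
    (hframe : ∀ X₂ : Matrix (Fin 2 × Fin k) (Fin r) 𝒪[F],
      X₂ ∈ solSet ϖ e (hyp F k) T.toBlocks₂₂ → IsPrimitiveMatrix X₂ → r ≤ k ∧
      ∃ (U : Matrix ((Fin r ⊕ Fin r) ⊕ (Fin 2 × Fin (k - r))) (Fin 2 × Fin k) 𝒪[F])
        (Q : Matrix (Fin r) (Fin r) 𝒪[F]),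
        Uᵀ * splitForm 𝒪[F] r (k - r) * U = polarForm 𝒪[F] k ∧
        U * X₂ = Matrix.fromRows (Matrix.fromRows 1 Q) 0) :
    compactVol {X : Matrix (Fin 2 × Fin k) (Fin p ⊕ Fin r) 𝒪[F] |
        X ∈ solSet ϖ e (hyp F k) T ∧ IsPrimitiveMatrix X.toCols₂} =
      compactVol {X₂ : Matrix (Fin 2 × Fin k) (Fin r) 𝒪[F] |
        X₂ ∈ solSet ϖ e (hyp F k) T.toBlocks₂₂ ∧ IsPrimitiveMatrix X₂} *
      (compactVol (modifiedSolSet ϖ e (hyp F (k - r)) T.toBlocks₁₁ ((2 : F) • T.toBlocks₂₁)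
        T.toBlocks₂₂) * ((residueCard F : ℝ) ^ (r * (p * e)))⁻¹) := by
  have hH := isHalfIntegral_hyp (F := F) k
  let C : Set (Matrix (Fin 2 × Fin k) (Fin r) 𝒪[F] × Matrix (Fin 2 × Fin k) (Fin p) 𝒪[F]) :=
    {Y | Matrix.fromCols Y.2 Y.1 ∈ solSet ϖ e (hyp F k) T ∧ IsPrimitiveMatrix Y.1}
  have hC : IsOpen C := by
    refine IsOpen.inter ?_ ((isOpen_isPrimitiveMatrix hϖ _ _).preimage continuous_fst)
    have : Continuous fun Y : Matrix (Fin 2 × Fin k) (Fin r) 𝒪[F] ×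
        Matrix (Fin 2 × Fin k) (Fin p) 𝒪[F] => Matrix.fromCols Y.2 Y.1 := by
      refine continuous_matrix fun i j => ?_
      rcases j with j | j
      · exact continuous_snd.matrix_elem i j
      · exact continuous_fst.matrix_elem i j
    exact (isOpen_solSet ϖ hϖ e hH T).preimage this
  have h1 : {X : Matrix (Fin 2 × Fin k) (Fin p ⊕ Fin r) 𝒪[F] |
        X ∈ solSet ϖ e (hyp F k) T ∧ IsPrimitiveMatrix X.toCols₂} =
      {X | (X.toCols₂, X.toCols₁) ∈ C} := by
    ext X
    simp only [Set.mem_ofPred_eq, C, Matrix.fromCols_toCols]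
  rw [h1, compactVol_splitCols hC]
  refine compactVol_prod hC ((isOpen_solSet ϖ hϖ e hH _).inter (isOpen_isPrimitiveMatrix hϖ _ _))
    (fun X₂ hX₂ => ?_) (fun X₂ hX₂ => ?_)
  · obtain ⟨hrk, U, Q, hU, hUX⟩ := hframe X₂ hX₂.1 hX₂.2
    have := compactVol_fibre hϖ hT hX₂.1 hrk hU hUX isOpen_univ
    rw [Set.inter_univ] at this
    rw [← this]
    congr 1
    ext X₁
    simp only [Set.mem_ofPred_eq, Set.mem_univ, and_true, C]
    exact and_iff_left hX₂.2
  · ext X₁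
    simp only [Set.mem_ofPred_eq, Set.mem_empty_iff_false, iff_false, C]
    exact fun h => hX₂ ⟨fromCols_mem_solSet hH.1 hT.1 h.1, h.2⟩

end PrimitivePart

/-! ### Primitive representations of one number by a hyperbolic space -/

section PrimitiveDensity

variable {F : Type*} [Field F] [ValuativeRel F] [TopologicalSpace F]
  [IsNonarchimedeanLocalField F] {ϖ : 𝒪[F]}

theorem compactVol_isPrimitive_column (hϖ : Irreducible ϖ) (m : Type*) [Fintype m]
    [DecidableEq m] : compactVol {x : Matrix m (Fin 1) 𝒪[F] | IsPrimitiveMatrix x} =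
      1 - ((residueCard F : ℝ) ^ Fintype.card m)⁻¹ := by
  have h := compactVol_inter_add_diff Set.univ (isOpen_isPrimitiveMatrix hϖ m (Fin 1))
  rw [compactVol_univ, Set.univ_inter] at h
  have h1 : (Set.univ \ {x : Matrix m (Fin 1) 𝒪[F] | IsPrimitiveMatrix x}) =
      {x : Matrix m (Fin 1) 𝒪[F] | ∀ i j, ϖ ^ 1 ∣ x i j} := by
    ext x
    simp only [Set.mem_sdiff, Set.mem_univ, true_and, Set.mem_ofPred_eq, pow_one]
    exact not_isPrimitiveMatrix_column_iff hϖ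
  rw [h1, compactVol_dvd_columns ϖ hϖ m (fun _ : Fin 1 => 1)] at h
  simp only [Finset.univ_unique, Finset.sum_const, Finset.card_singleton, smul_eq_mul, mul_one] at h
  linarith

/-- The pairing with a fixed column, reduced modulo a power of `ϖ`. -/
noncomputable def columnPairing (ϖ : 𝒪[F]) (e : ℕ) {m : Type*} [Fintype m]
    (y : Matrix m (Fin 1) 𝒪[F]) : Matrix m (Fin 1) 𝒪[F] →+ 𝒪[F] ⧸ Ideal.span {ϖ ^ e} where
  toFun x := Ideal.Quotient.mk _ (∑ l, x l 0 * y l 0)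
  map_zero' := by simp
  map_add' a b := by simp [add_mul, Finset.sum_add_distrib]

theorem isOpen_dvd_pairing (hϖ : Irreducible ϖ) {m : Type*} [Fintype m] (e : ℕ)
    (y : Matrix m (Fin 1) 𝒪[F]) (t : 𝒪[F]) :
    IsOpen {x : Matrix m (Fin 1) 𝒪[F] | ϖ ^ e ∣ ∑ l, x l 0 * y l 0 - t} := by
  refine (isOpen_dvd_pow ϖ hϖ e).preimage (f := fun x : Matrix m (Fin 1) 𝒪[F] =>
    ∑ l, x l 0 * y l 0 - t) ?_
  exact (continuous_finsetSum _ fun l _ =>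
    (continuous_id.matrix_elem l 0).mul continuous_const).sub continuous_const

/-- Pairing with a primitive vector maps onto the integers modulo ϖ^e, already through the
coordinate where that vector is a unit. -/
theorem compactVol_dvd_pairing (hϖ : Irreducible ϖ) {m : Type*} [Fintype m] [DecidableEq m]
    (e : ℕ) {y : Matrix m (Fin 1) 𝒪[F]} (hy : IsPrimitiveMatrix y) (t : 𝒪[F]) :
    compactVol {x : Matrix m (Fin 1) 𝒪[F] | ϖ ^ e ∣ ∑ l, x l 0 * y l 0 - t} =
      ((residueCard F : ℝ) ^ e)⁻¹ := by
  have hfact : Fact (Irreducible ϖ) := ⟨hϖ⟩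
  obtain ⟨i, hi⟩ := isPrimitiveMatrix_column_iff.1 hy
  have hpre : ∀ t, {x : Matrix m (Fin 1) 𝒪[F] | ϖ ^ e ∣ ∑ l, x l 0 * y l 0 - t} =
      columnPairing ϖ e y ⁻¹' {Ideal.Quotient.mk _ t} := by
    intro t
    ext x
    simp only [Set.mem_ofPred_eq, Set.mem_preimage, Set.mem_singleton_iff, columnPairing,
      AddMonoidHom.coe_mk, ZeroHom.coe_mk, Ideal.Quotient.eq, Ideal.mem_span_singleton]
  have hsurj : Function.Surjective (columnPairing ϖ e y) := by
    intro w
    obtain ⟨a, rfl⟩ := Ideal.Quotient.mk_surjective w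
    obtain ⟨u, hu⟩ := hi
    refine ⟨Matrix.of fun l _ => if l = i then a * (u⁻¹ : 𝒪[F]ˣ).val else 0, ?_⟩
    simp only [columnPairing, AddMonoidHom.coe_mk, ZeroHom.coe_mk, Matrix.of_apply, ite_mul,
      zero_mul, Finset.sum_ite_eq', Finset.mem_univ, if_true, ← hu]
    rw [mul_assoc, Units.inv_mul, mul_one]
  have ho := isOpen_dvd_pairing hϖ e y 0
  rw [hpre, map_zero] at ho
  rw [hpre, compactVol_preimage_finite _ hsurj ho, Set.ncard_singleton, card_quotient_pow ϖ hϖ]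
  push_cast
  rw [one_div]

/-- Writing x = ϖx' divides the congruence by ϖ; the substitution accounts for the factor q^{-m}. -/
theorem compactVol_dvd_pairing_dvd (hϖ : Irreducible ϖ) {m : Type*} [Fintype m] [DecidableEq m]
    (e : ℕ) {y : Matrix m (Fin 1) 𝒪[F]} (hy : IsPrimitiveMatrix y) (z : 𝒪[F]) :
    compactVol {x : Matrix m (Fin 1) 𝒪[F] | (∀ i j, ϖ ∣ x i j) ∧
        ϖ ^ (e + 1) ∣ ∑ l, x l 0 * y l 0 - ϖ * z} =
      ((residueCard F : ℝ) ^ Fintype.card m)⁻¹ * ((residueCard F : ℝ) ^ e)⁻¹ := by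
  let f : Matrix m (Fin 1) 𝒪[F] →+ Matrix m (Fin 1) 𝒪[F] :=
    AddMonoidHom.mk' (fun X : Matrix m (Fin 1) 𝒪[F] => ϖ • X) fun X Y => smul_add _ _ _
  have hfapp : ∀ X, f X = ϖ • X := fun X => rfl
  have hrange : Set.range f = {X : Matrix m (Fin 1) 𝒪[F] | ∀ i j, ϖ ^ 1 ∣ X i j} := by
    ext X
    rw [Set.mem_ofPred_eq, pow_one, dvd_matrix_iff]
    exact ⟨fun ⟨Y, hY⟩ => ⟨Y, hY.symm⟩, fun ⟨Y, hY⟩ => ⟨Y, hY.symm⟩⟩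
  have hfinj : Function.Injective f := by
    intro X Y h
    refine Matrix.ext fun i j => ?_
    exact mul_left_cancel₀ hϖ.ne_zero (congrFun (congrFun h i) j)
  have hfcont : Continuous f := continuous_const_smul ϖ
  have hfopen : IsOpenEmbedding f :=
    ⟨(hfcont.isClosedEmbedding hfinj).toIsEmbedding, by
      rw [hrange]; exact isOpen_dvd_columns ϖ hϖ m fun _ => 1⟩
  have hmem : ∀ X : Matrix m (Fin 1) 𝒪[F], ϖ ^ (e + 1) ∣ ∑ l, (ϖ • X) l 0 * y l 0 - ϖ * z ↔
      ϖ ^ e ∣ ∑ l, X l 0 * y l 0 - z := by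
    intro X
    have : ∑ l, (ϖ • X) l 0 * y l 0 - ϖ * z = ϖ * (∑ l, X l 0 * y l 0 - z) := by
      simp only [Matrix.smul_apply, smul_eq_mul, mul_assoc, ← Finset.mul_sum, mul_sub]
    rw [this, pow_succ', mul_dvd_mul_iff_left hϖ.ne_zero]
  have himage : {x : Matrix m (Fin 1) 𝒪[F] | (∀ i j, ϖ ∣ x i j) ∧
        ϖ ^ (e + 1) ∣ ∑ l, x l 0 * y l 0 - ϖ * z} =
      f '' {x : Matrix m (Fin 1) 𝒪[F] | ϖ ^ e ∣ ∑ l, x l 0 * y l 0 - z} := by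
    ext X
    constructor
    · rintro ⟨h1, h2⟩
      obtain ⟨Y, rfl⟩ := dvd_matrix_iff.1 h1
      exact ⟨Y, (hmem Y).1 h2, rfl⟩
    · rintro ⟨Y, hY, rfl⟩
      exact ⟨dvd_matrix_iff.2 ⟨Y, rfl⟩, (hmem Y).2 hY⟩
  rw [himage, compactVol_image f hfopen, hrange, compactVol_dvd_columns ϖ hϖ m fun _ => 1,
    compactVol_dvd_pairing hϖ e hy]
  simp

variable [CharZero F]

theorem mem_solSet_hyp_column_iff {k e : ℕ} {T : Matrix (Fin 1) (Fin 1) F} {t : 𝒪[F]}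
    (ht : T 0 0 = t) {X : Matrix (Fin 2 × Fin k) (Fin 1) 𝒪[F]} :
    X ∈ solSet ϖ e (hyp F k) T ↔ ϖ ^ e ∣ ∑ l, X (0, l) 0 * X (1, l) 0 - t := by
  have h0 : (quadSubst (hyp F k) (toField X) - T) 0 0 =
      ((∑ l, X (0, l) 0 * X (1, l) 0 - t : 𝒪[F]) : F) := by
    rw [Matrix.sub_apply, quadSubst_hyp_diag, ht]; rfl
  constructor
  · rintro ⟨Z, ⟨-, hd, -⟩, hZ⟩
    refine ⟨⟨Z 0 0, hd 0⟩, Subtype.ext ?_⟩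
    rw [← h0, hZ]
    simp
  · rintro ⟨a, ha⟩
    refine ⟨Matrix.of fun _ _ => (a : F), ⟨?_, fun i => a.2, fun i j hij =>
      absurd (Subsingleton.elim i j) hij⟩, ?_⟩
    · ext i j; rfl
    · refine Matrix.ext fun i j => ?_
      rw [Subsingleton.elim i 0, Subsingleton.elim j 0, h0, ha]
      simp

/-- The two isotropic halves of a column. -/
def hyperbolicRows (k : ℕ) (c c' : Fin 2) : Matrix (Fin 2 × Fin k) (Fin 1) 𝒪[F] →+
    Matrix (Fin k) (Fin 1) 𝒪[F] × Matrix (Fin k) (Fin 1) 𝒪[F] where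
  toFun X := (X.submatrix (fun l => (c, l)) id, X.submatrix (fun l => (c', l)) id)
  map_zero' := rfl
  map_add' _ _ := rfl

theorem compactVol_preimage_hyperbolicRows {k : ℕ} {c c' : Fin 2} (hc : c ≠ c')
    {C : Set (Matrix (Fin k) (Fin 1) 𝒪[F] × Matrix (Fin k) (Fin 1) 𝒪[F])} (hC : IsOpen C) :
    compactVol (hyperbolicRows k c c' ⁻¹' C) = compactVol C := by
  refine compactVol_preimage_hom _ ?_ ?_ hC
  · exact (continuous_id.matrix_submatrix _ _).prodMk (continuous_id.matrix_submatrix _ _)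
  · rintro ⟨x, y⟩
    refine ⟨Matrix.of fun s j => if s.1 = c then x s.2 j else y s.2 j, Prod.ext ?_ ?_⟩
    · exact Matrix.ext fun i j => if_pos rfl
    · exact Matrix.ext fun i j => if_neg hc.symm

/-- The volume of the primitive representations by a hyperbolic space of a number divisible by
`ϖ`. -/
theorem compactVol_primitive_one (hϖ : Irreducible ϖ) {k e : ℕ} (he : 1 ≤ e)
    {T : Matrix (Fin 1) (Fin 1) F} (hT : MemPowHalfIntegral ϖ 1 T) :
    compactVol {X : Matrix (Fin 2 × Fin k) (Fin 1) 𝒪[F] |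
        X ∈ solSet ϖ e (hyp F k) T ∧ IsPrimitiveMatrix X} =
      ((residueCard F : ℝ) ^ e)⁻¹ * ((1 - ((residueCard F : ℝ) ^ k)⁻¹) *
        (1 + residueCard F * ((residueCard F : ℝ) ^ k)⁻¹)) := by
  obtain ⟨e, rfl⟩ := Nat.exists_eq_add_of_le' he
  obtain ⟨Z, ⟨-, hd, -⟩, hZ⟩ := hT
  set z : 𝒪[F] := ⟨Z 0 0, hd 0⟩ with hz
  have ht : T 0 0 = ((ϖ * z : 𝒪[F]) : F) := by
    rw [hZ]; simp [hz]
  let pair : Matrix (Fin k) (Fin 1) 𝒪[F] × Matrix (Fin k) (Fin 1) 𝒪[F] → Prop :=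
    fun Y => ϖ ^ (e + 1) ∣ ∑ l, Y.2 l 0 * Y.1 l 0 - ϖ * z
  have hpair : IsOpen {Y | pair Y} := by
    refine (isOpen_dvd_pow ϖ hϖ (e + 1)).preimage (f := fun Y : Matrix (Fin k) (Fin 1) 𝒪[F] ×
      Matrix (Fin k) (Fin 1) 𝒪[F] => ∑ l, Y.2 l 0 * Y.1 l 0 - ϖ * z) ?_
    exact (continuous_finsetSum _ fun l _ => (continuous_snd.matrix_elem l 0).mul
      (continuous_fst.matrix_elem l 0)).sub continuous_const
  have hprim := isOpen_isPrimitiveMatrix hϖ (Fin k) (Fin 1)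
  have hvol := compactVol_isPrimitive_column hϖ (Fin k)
  rw [Fintype.card_fin] at hvol
  -- Two cases: the half with index 0 is primitive (`C₁`), or it is divisible by ϖ and the half with
  -- index 1 is primitive (`C₂`). In both, the first component of the pair is the primitive half,
  -- and the volumes add to (1 - q^{-k})(q^{-(e+1)} + q^{-k}q^{-e}).
  let C₁ := {Y : Matrix (Fin k) (Fin 1) 𝒪[F] × Matrix (Fin k) (Fin 1) 𝒪[F] |
    IsPrimitiveMatrix Y.1 ∧ pair Y}
  let C₂ := {Y : Matrix (Fin k) (Fin 1) 𝒪[F] × Matrix (Fin k) (Fin 1) 𝒪[F] |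
    IsPrimitiveMatrix Y.1 ∧ (∀ i j, ϖ ∣ Y.2 i j) ∧ pair Y}
  have hC₁ : IsOpen C₁ := (hprim.preimage continuous_fst).inter hpair
  have hdvd : IsOpen {Y : Matrix (Fin k) (Fin 1) 𝒪[F] | ∀ i j, ϖ ∣ Y i j} := by
    have := isOpen_dvd_matrix ϖ hϖ 1 (Fin k) (Fin 1)
    simpa only [pow_one] using this
  have hC₂ : IsOpen C₂ :=
    (hprim.preimage continuous_fst).inter ((hdvd.preimage continuous_snd).inter hpair)
  have h1 : compactVol C₁ = (1 - ((residueCard F : ℝ) ^ k)⁻¹) *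
      ((residueCard F : ℝ) ^ (e + 1))⁻¹ := by
    rw [← hvol]
    refine compactVol_prod hC₁ hprim (fun y hy => ?_) (fun y hy => ?_)
    · rw [← compactVol_dvd_pairing hϖ (e + 1) hy (ϖ * z)]
      congr 1
      ext x
      exact and_iff_right hy
    · ext x
      simp only [Set.mem_ofPred_eq, Set.mem_empty_iff_false, iff_false]
      exact fun h => hy h.1
  have h2 : compactVol C₂ = (1 - ((residueCard F : ℝ) ^ k)⁻¹) *
      (((residueCard F : ℝ) ^ k)⁻¹ * ((residueCard F : ℝ) ^ e)⁻¹) := by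
    rw [← hvol]
    refine compactVol_prod hC₂ hprim (fun y hy => ?_) (fun y hy => ?_)
    · have := compactVol_dvd_pairing_dvd hϖ e hy z
      rw [Fintype.card_fin] at this
      rw [← this]
      congr 1
      ext x
      exact and_iff_right hy
    · ext x
      simp only [Set.mem_ofPred_eq, Set.mem_empty_iff_false, iff_false]
      exact fun h => hy h.1
  have hD : IsOpen {X : Matrix (Fin 2 × Fin k) (Fin 1) 𝒪[F] |
      IsPrimitiveMatrix (X.submatrix (fun l => ((0 : Fin 2), l)) id)} :=
    hprim.preimage (continuous_id.matrix_submatrix _ _)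
  have hXprim : ∀ X : Matrix (Fin 2 × Fin k) (Fin 1) 𝒪[F], IsPrimitiveMatrix X ↔
      IsPrimitiveMatrix (X.submatrix (fun l => ((0 : Fin 2), l)) id) ∨
      IsPrimitiveMatrix (X.submatrix (fun l => ((1 : Fin 2), l)) id) := by
    intro X
    simp only [isPrimitiveMatrix_column_iff, Prod.exists, Fin.exists_fin_two]
    rfl
  rw [← compactVol_inter_add_diff _ hD]
  have e1 : {X : Matrix (Fin 2 × Fin k) (Fin 1) 𝒪[F] |
        X ∈ solSet ϖ (e + 1) (hyp F k) T ∧ IsPrimitiveMatrix X} ∩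
      {X | IsPrimitiveMatrix (X.submatrix (fun l => ((0 : Fin 2), l)) id)} =
      hyperbolicRows k 0 1 ⁻¹' C₁ := by
    ext X
    change (_ ∧ _) ∧ _ ↔ IsPrimitiveMatrix (X.submatrix (fun l => ((0 : Fin 2), l)) id) ∧
      ϖ ^ (e + 1) ∣ ∑ l, X (1, l) 0 * X (0, l) 0 - ϖ * z
    simp only [mem_solSet_hyp_column_iff ht, hXprim, Set.mem_ofPred_eq, mul_comm (X (0, _) 0)]
    tauto
  have e2 : {X : Matrix (Fin 2 × Fin k) (Fin 1) 𝒪[F] |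
        X ∈ solSet ϖ (e + 1) (hyp F k) T ∧ IsPrimitiveMatrix X} \
      {X | IsPrimitiveMatrix (X.submatrix (fun l => ((0 : Fin 2), l)) id)} =
      hyperbolicRows k 1 0 ⁻¹' C₂ := by
    ext X
    change (_ ∧ _) ∧ ¬ _ ↔ IsPrimitiveMatrix (X.submatrix (fun l => ((1 : Fin 2), l)) id) ∧
      (∀ i j, ϖ ∣ X.submatrix (fun l => ((0 : Fin 2), l)) id i j) ∧
      ϖ ^ (e + 1) ∣ ∑ l, X (0, l) 0 * X (1, l) 0 - ϖ * z
    rw [← not_isPrimitiveMatrix_column_iff hϖ]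
    simp only [mem_solSet_hyp_column_iff ht, hXprim, Set.mem_ofPred_eq]
    tauto
  rw [e1, e2, compactVol_preimage_hyperbolicRows (by decide) hC₁,
    compactVol_preimage_hyperbolicRows (by decide) hC₂, h1, h2]
  have := residueCard_ne_zero F
  rw [pow_succ]
  field_simp

end PrimitiveDensity

/-! ### Primitive representations of a binary form by a hyperbolic space -/

section PrimitiveDensityTwo

variable {F : Type*} [Field F] [ValuativeRel F] [TopologicalSpace F]
  [IsNonarchimedeanLocalField F] [CharZero F] {ϖ : 𝒪[F]} {k e : ℕ}

/-- Modulo ϖ both Q ≡ T₂₂ and b ≡ R + ᵗQx vanish, so in the frame the columns reduce to (-x, 0, c)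
and (1, 0, 0). They are independent exactly when c does not vanish. -/
theorem isPrimitiveMatrix_fromCols_iff (hϖ : Irreducible ϖ) (he : 1 ≤ e)
    {T : Matrix (Fin 1 ⊕ Fin 1) (Fin 1 ⊕ Fin 1) F} (hT : IsHalfIntegral T)
    (hT1 : MemPowHalfIntegral ϖ 1 T) (hk : 1 ≤ k)
    {X₁ X₂ : Matrix (Fin 2 × Fin k) (Fin 1) 𝒪[F]}
    {U : Matrix ((Fin 1 ⊕ Fin 1) ⊕ (Fin 2 × Fin (k - 1))) (Fin 2 × Fin k) 𝒪[F]}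
    {Q : Matrix (Fin 1) (Fin 1) 𝒪[F]}
    (hU : Uᵀ * splitForm 𝒪[F] 1 (k - 1) * U = polarForm 𝒪[F] k)
    (hUX : U * X₂ = Matrix.fromRows (Matrix.fromRows 1 Q) 0)
    (h : Matrix.fromCols X₁ X₂ ∈ solSet ϖ e (hyp F k) T) :
    IsPrimitiveMatrix (Matrix.fromCols X₁ X₂) ↔ IsPrimitiveMatrix (frameCoord U 1 X₁).1.1 := by
  obtain ⟨V, hV, -⟩ := frame_mul_inverse hU hk
  have hX₂ := fromCols_mem_solSet (isHalfIntegral_hyp (F := F) k).1 hT.1 h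
  obtain ⟨Z, ⟨-, hZd, hZo⟩, hZ⟩ := hT1
  rw [pow_one] at hZ
  have hR : (2 : F) • T.toBlocks₂₁ =
      toField (Matrix.of fun _ _ : Fin 1 =>
        ϖ * (⟨2 * Z (Sum.inr 0) (Sum.inl 0), hZo _ _ (by simp)⟩ : 𝒪[F])) := by
    refine Matrix.ext fun i j => ?_
    rw [Subsingleton.elim i 0, Subsingleton.elim j 0]
    simp only [Matrix.smul_apply, Matrix.toBlocks₂₁, Matrix.of_apply, hZ, toField_apply,
      smul_eq_mul, Subring.coe_mul]
    ring
  have hb := ((fromCols_mem_solSet_iff hT hR hX₂ hU hUX (mul_eq_frameCoord U X₁)).1 h).2 0 0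
  have hX₂2 : ϖ ^ e ∣ ∑ l, X₂ (0, l) 0 * X₂ (1, l) 0 -
      ϖ * (⟨Z (Sum.inr 0) (Sum.inr 0), hZd _⟩ : 𝒪[F]) :=
    (mem_solSet_hyp_column_iff (by
      simp only [Matrix.toBlocks₂₂, Matrix.of_apply, hZ, Matrix.smul_apply]; rfl)).1 hX₂
  have hQ : Q 0 0 = ∑ l, X₂ (0, l) 0 * X₂ (1, l) 0 := by
    have h22 : X₂ᵀ * polarForm 𝒪[F] k * X₂ = Q + Qᵀ := by
      have : X₂ᵀ * polarForm 𝒪[F] k * X₂ =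
          (U * X₂)ᵀ * splitForm 𝒪[F] 1 (k - 1) * (U * X₂) := by
        rw [← hU]
        simp only [Matrix.transpose_mul, Matrix.mul_assoc]
      rw [this, hUX]
      simp [splitForm, Matrix.transpose_fromRows, Matrix.fromCols_mul_fromBlocks,
        Matrix.fromCols_mul_fromRows, add_comm]
    have h00 := congrFun (congrFun h22 0) 0
    rw [polarForm_quadratic_apply, Matrix.add_apply, Matrix.transpose_apply] at h00
    have h2 : (2 : 𝒪[F]) ≠ 0 := by
      intro h; exact two_ne_zero (α := F) (congrArg Subtype.val h)
    -- Only 2Q is visible in the Gram matrix; in characteristic 0 the 2 can be cancelled even if it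
    -- is not a unit.
    refine mul_left_cancel₀ h2 ?_
    rw [two_mul, ← h00, Finset.mul_sum]
    exact Finset.sum_congr rfl fun l _ => by ring
  have hϖ1 : ϖ ∣ ϖ ^ e := dvd_pow_self ϖ (by omega)
  have hQ0 : ϖ ∣ Q 0 0 := by
    rw [hQ]
    have := dvd_add (hϖ1.trans hX₂2) (Dvd.intro (⟨Z (Sum.inr 0) (Sum.inr 0), hZd _⟩ : 𝒪[F]) rfl)
    simpa using this
  have hb0 : ϖ ∣ (frameCoord U 1 X₁).2 0 0 := by
    have h3 : ϖ ∣ (Matrix.of (fun _ _ : Fin 1 =>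
        ϖ * (⟨2 * Z (Sum.inr 0) (Sum.inl 0), hZo _ _ (by simp)⟩ : 𝒪[F])) +
        Qᵀ * (frameCoord U 1 X₁).1.2) 0 0 := by
      rw [Matrix.add_apply, Matrix.mul_apply, Fin.sum_univ_one, Matrix.transpose_apply]
      exact dvd_add (Dvd.intro _ rfl) (hQ0.mul_right _)
    have := dvd_add (hϖ1.trans hb) h3
    simpa using this
  have hres : ∀ a : 𝒪[F], ϖ ∣ a → IsLocalRing.residue 𝒪[F] a = 0 := fun a ha => by
    rwa [IsLocalRing.residue_eq_zero_iff, hϖ.maximalIdeal_eq, Ideal.mem_span_singleton]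
  rw [← isPrimitiveMatrix_mul_left_iff hV, Matrix.mul_fromCols, hUX, mul_eq_frameCoord U X₁,
    isPrimitiveMatrix_iff, isPrimitiveMatrix_iff]
  set x := (frameCoord U 1 X₁).1.2
  set b := (frameCoord U 1 X₁).2
  set c := (frameCoord U 1 X₁).1.1
  have hker : ∀ u : Fin 1 ⊕ Fin 1 → 𝓀[F],
      residueMatrix (Matrix.fromCols (Matrix.fromRows (Matrix.fromRows (-x) b) c)
        (Matrix.fromRows (Matrix.fromRows 1 Q) 0)) *ᵥ u = 0 ↔
      u (Sum.inr 0) = IsLocalRing.residue 𝒪[F] (x 0 0) * u (Sum.inl 0) ∧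
        residueMatrix c *ᵥ (fun i => u (Sum.inl i)) = 0 := by
    intro u
    constructor
    · intro hu
      constructor
      · have := congrFun hu (Sum.inl (Sum.inl 0))
        simp [residueMatrix, Matrix.mulVec, dotProduct] at this
        linear_combination this
      · funext s
        have := congrFun hu (Sum.inr s)
        simpa [residueMatrix, Matrix.mulVec, dotProduct] using this
    · rintro ⟨h1, h2⟩
      funext s
      rcases s with (s | s) | s
      · rw [Subsingleton.elim s 0]
        simp [residueMatrix, Matrix.mulVec, dotProduct, h1]
      · rw [Subsingleton.elim s 0]
        simp [residueMatrix, Matrix.mulVec, dotProduct, hres _ hb0, hres _ hQ0]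
      · have := congrFun h2 s
        simpa [residueMatrix, Matrix.mulVec, dotProduct] using this
  constructor
  · intro hp u hu
    have := hp (Sum.elim u fun _ => IsLocalRing.residue 𝒪[F] (x 0 0) * u 0)
      ((hker _).2 ⟨rfl, hu⟩)
    funext i
    exact congrFun this (Sum.inl i)
  · intro hp u hu
    obtain ⟨h1, h2⟩ := (hker u).1 hu
    have h3 := hp _ h2
    funext s
    rcases s with s | s
    · exact congrFun h3 s
    · rw [Subsingleton.elim s 0, h1, congrFun h3 0]; simp

/-- The last column is treated by the one-column count in H_k. Over it, c is a primitive
representation in H_{k-1} of T(R, A, x), again divisible by ϖ, so its volume does not depend on x;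
the entry b contributes the remaining q^{-e}. -/
theorem compactVol_primitive_two (hϖ : Irreducible ϖ) (he : 1 ≤ e)
    {T : Matrix (Fin 1 ⊕ Fin 1) (Fin 1 ⊕ Fin 1) F} (hT1 : MemPowHalfIntegral ϖ 1 T) :
    compactVol {X : Matrix (Fin 2 × Fin k) (Fin 1 ⊕ Fin 1) 𝒪[F] |
        X ∈ solSet ϖ e (hyp F k) T ∧ IsPrimitiveMatrix X} =
      (((residueCard F : ℝ) ^ e)⁻¹ * ((1 - ((residueCard F : ℝ) ^ k)⁻¹) *
        (1 + residueCard F * ((residueCard F : ℝ) ^ k)⁻¹))) *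
      ((((residueCard F : ℝ) ^ e)⁻¹ * ((1 - ((residueCard F : ℝ) ^ (k - 1))⁻¹) *
        (1 + residueCard F * ((residueCard F : ℝ) ^ (k - 1))⁻¹))) *
        ((residueCard F : ℝ) ^ e)⁻¹) := by
  have hT : IsHalfIntegral T := by
    have := hT1.mono (Nat.zero_le 1)
    rwa [memPowHalfIntegral_zero] at this
  have hT22 : MemPowHalfIntegral ϖ 1 T.toBlocks₂₂ :=
    ((memPowHalfIntegral_blocks hT.1).1 hT1).2.1
  have hH := isHalfIntegral_hyp (F := F) k
  let C : Set (Matrix (Fin 2 × Fin k) (Fin 1) 𝒪[F] × Matrix (Fin 2 × Fin k) (Fin 1) 𝒪[F]) :=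
    {Y | Matrix.fromCols Y.2 Y.1 ∈ solSet ϖ e (hyp F k) T ∧
      IsPrimitiveMatrix (Matrix.fromCols Y.2 Y.1)}
  have hC : IsOpen C := by
    have : Continuous fun Y : Matrix (Fin 2 × Fin k) (Fin 1) 𝒪[F] ×
        Matrix (Fin 2 × Fin k) (Fin 1) 𝒪[F] => Matrix.fromCols Y.2 Y.1 := by
      refine continuous_matrix fun i j => ?_
      rcases j with j | j
      · exact continuous_snd.matrix_elem i j
      · exact continuous_fst.matrix_elem i j
    exact ((isOpen_solSet ϖ hϖ e hH T).preimage this).inter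
      ((isOpen_isPrimitiveMatrix hϖ _ _).preimage this)
  have h1 : {X : Matrix (Fin 2 × Fin k) (Fin 1 ⊕ Fin 1) 𝒪[F] |
        X ∈ solSet ϖ e (hyp F k) T ∧ IsPrimitiveMatrix X} = {X | (X.toCols₂, X.toCols₁) ∈ C} := by
    ext X
    simp only [Set.mem_ofPred_eq, C, Matrix.fromCols_toCols]
  have hprim : ∀ X₁ X₂ : Matrix (Fin 2 × Fin k) (Fin 1) 𝒪[F],
      IsPrimitiveMatrix (Matrix.fromCols X₁ X₂) → IsPrimitiveMatrix X₂ := by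
    intro X₁ X₂ h
    rw [isPrimitiveMatrix_iff] at h ⊢
    intro u hu
    have := h (Sum.elim 0 u) (by
      funext s
      have := congrFun hu s
      simpa [residueMatrix, Matrix.mulVec, dotProduct] using this)
    funext i
    exact congrFun this (Sum.inr i)
  rw [h1, compactVol_splitCols hC, ← compactVol_primitive_one hϖ he hT22,
    ← compactVol_primitive_one (k := k - 1) hϖ he hT22]
  refine compactVol_prod hC ((isOpen_solSet ϖ hϖ e hH _).inter (isOpen_isPrimitiveMatrix hϖ _ _))
    (fun X₂ hX₂ => ?_) (fun X₂ hX₂ => ?_)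
  · obtain ⟨hk, U, Q, hU, hUX⟩ := exists_frame_of_isPrimitive_one hX₂.2
    have hpo := isOpen_isPrimitiveMatrix hϖ (Fin 2 × Fin (k - 1)) (Fin 1)
    have hf := compactVol_fibre hϖ hT hX₂.1 hk hU hUX (hpo.preimage
      (continuous_fst (Y := Matrix (Fin 1) (Fin 1) 𝒪[F])))
    have hset : {x : Matrix (Fin 2 × Fin k) (Fin 1) 𝒪[F] | (X₂, x) ∈ C} =
        {X₁ : Matrix (Fin 2 × Fin k) (Fin 1) 𝒪[F] |
          Matrix.fromCols X₁ X₂ ∈ solSet ϖ e (hyp F k) T ∧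
            (frameCoord U 1 X₁).1 ∈ Prod.fst ⁻¹' {c : Matrix (Fin 2 × Fin (k - 1)) (Fin 1) 𝒪[F] |
              IsPrimitiveMatrix c}} := by
      ext X₁
      exact and_congr_right fun h =>
        isPrimitiveMatrix_fromCols_iff hϖ he hT hT1 hk hU hUX h
    rw [hset, hf, one_mul, one_mul]
    congr 1
    have hMo := (isOpen_modifiedSolSet hϖ (isHalfIntegral_hyp (F := F) (k - 1)) hT e).inter
      (hpo.preimage (continuous_fst (Y := Matrix (Fin 1) (Fin 1) 𝒪[F])))
    -- The factors are exchanged so that Fubini integrates over c for fixed x.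
    let σ : Matrix (Fin 1) (Fin 1) 𝒪[F] × Matrix (Fin 2 × Fin (k - 1)) (Fin 1) 𝒪[F] →+
        Matrix (Fin 2 × Fin (k - 1)) (Fin 1) 𝒪[F] × Matrix (Fin 1) (Fin 1) 𝒪[F] :=
      (AddEquiv.prodComm).toAddMonoidHom
    have hσ := compactVol_preimage_hom σ continuous_swap Prod.swap_surjective hMo
    rw [← hσ, ← one_mul (compactVol {X : Matrix (Fin 2 × Fin (k - 1)) (Fin 1) 𝒪[F] | _}),
      ← compactVol_univ (G := Matrix (Fin 1) (Fin 1) 𝒪[F])]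
    refine compactVol_prod (hMo.preimage continuous_swap) isOpen_univ (fun x _ => ?_)
      (fun x hx => absurd trivial hx)
    rw [compactVol_primitive_one hϖ he hT22, ← compactVol_primitive_one (k := k - 1) hϖ he
      (T := blockSubst T.toBlocks₁₁ ((2 : F) • T.toBlocks₂₁) T.toBlocks₂₂ x)]
    · rfl
    · rw [blockSubst_toBlocks hT.1]
      exact hT1.quadSubst _
  · ext X₁
    simp only [Set.mem_ofPred_eq, Set.mem_empty_iff_false, iff_false, C]
    exact fun h => hX₂ ⟨fromCols_mem_solSet hH.1 hT.1 h.1, hprim _ _ h.2⟩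

theorem MemPowHalfIntegral.reindex {n n' : Type*} (σ : n' ≃ n) {M : Matrix n n F}
    (h : MemPowHalfIntegral ϖ e M) : MemPowHalfIntegral ϖ e (M.submatrix σ σ) := by
  obtain ⟨Z, ⟨hs, hd, ho⟩, rfl⟩ := h
  exact ⟨Z.submatrix σ σ, ⟨hs.submatrix σ, fun i => hd _, fun i j hij =>
    ho _ _ (σ.injective.ne hij)⟩, rfl⟩

theorem memPowHalfIntegral_reindex {n n' : Type*} (σ : n' ≃ n) {M : Matrix n n F} :
    MemPowHalfIntegral ϖ e (M.submatrix σ σ) ↔ MemPowHalfIntegral ϖ e M := by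
  refine ⟨fun h => ?_, fun h => h.reindex σ⟩
  have := h.reindex σ.symm
  simpa using this

theorem compactVol_primitive_two' (hϖ : Irreducible ϖ) (he : 1 ≤ e)
    {T : Matrix (Fin 2) (Fin 2) F} (hT1 : MemPowHalfIntegral ϖ 1 T) :
    compactVol {X : Matrix (Fin 2 × Fin k) (Fin 2) 𝒪[F] |
        X ∈ solSet ϖ e (hyp F k) T ∧ IsPrimitiveMatrix X} =
      (((residueCard F : ℝ) ^ e)⁻¹ * ((1 - ((residueCard F : ℝ) ^ k)⁻¹) *
        (1 + residueCard F * ((residueCard F : ℝ) ^ k)⁻¹))) *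
      ((((residueCard F : ℝ) ^ e)⁻¹ * ((1 - ((residueCard F : ℝ) ^ (k - 1))⁻¹) *
        (1 + residueCard F * ((residueCard F : ℝ) ^ (k - 1))⁻¹))) *
        ((residueCard F : ℝ) ^ e)⁻¹) := by
  let σ : Fin 1 ⊕ Fin 1 ≃ Fin 2 := finSumFinEquiv
  rw [← compactVol_primitive_two hϖ he ((memPowHalfIntegral_reindex σ).2 hT1)]
  let f : Matrix (Fin 2 × Fin k) (Fin 2) 𝒪[F] →+ Matrix (Fin 2 × Fin k) (Fin 1 ⊕ Fin 1) 𝒪[F] :=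
    AddMonoidHom.mk' (fun X : Matrix (Fin 2 × Fin k) (Fin 2) 𝒪[F] => X.submatrix id σ)
      fun _ _ => rfl
  have hf : Continuous f := continuous_id.matrix_submatrix _ _
  have hs : Function.Surjective f := fun Y => ⟨Y.submatrix id σ.symm, by
    refine Matrix.ext fun i j => ?_
    change Y i (σ.symm (σ j)) = Y i j
    rw [Equiv.symm_apply_apply]⟩
  refine Eq.trans ?_ (compactVol_preimage_hom f hf hs ((isOpen_solSet ϖ hϖ e
    (isHalfIntegral_hyp (F := F) k) (T.submatrix σ σ)).inter (isOpen_isPrimitiveMatrix hϖ _ _)))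
  congr 1
  ext X
  refine and_congr ?_ ?_
  · exact (memPowHalfIntegral_reindex (M := quadSubst (hyp F k) (toField X) - T) σ).symm
  · rw [isPrimitiveMatrix_iff, isPrimitiveMatrix_iff]
    have hfX : ∀ u : Fin 1 ⊕ Fin 1 → 𝓀[F], residueMatrix (f X) *ᵥ u =
        residueMatrix X *ᵥ (u ∘ σ.symm) := by
      intro u
      funext s
      simp only [Matrix.mulVec, dotProduct]
      rw [← σ.sum_comp]
      simp only [Function.comp_apply, Equiv.symm_apply_apply]
      rfl
    constructor
    · intro h u hu
      have := h _ ((hfX u).symm.trans hu)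
      funext i
      have := congrFun this (σ i)
      simpa using this
    · intro h u hu
      have h1 := h (u ∘ σ) (by
        rw [hfX, ← hu]
        congr 1
        funext i; simp)
      funext i
      have := congrFun h1 (σ.symm i)
      simpa using this

end PrimitiveDensityTwo

/-! ### Closed formulas for the primitive densities -/

section PrimitiveDensityValue

variable {F : Type*} [Field F] [ValuativeRel F] [TopologicalSpace F]
  [IsNonarchimedeanLocalField F] [CharZero F] {ϖ : 𝒪[F]} {k : ℕ}

theorem primitiveDensitySeq_one (hϖ : Irreducible ϖ) {T : Matrix (Fin 1) (Fin 1) F}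
    (hT : MemPowHalfIntegral ϖ 1 T) {e : ℕ} (he : 1 ≤ e) :
    primitiveDensitySeq ϖ (hyp F k) T e = (1 - (residueCard F : ℝ) ^ (-(k : ℤ))) *
      (1 + (residueCard F : ℝ) ^ (-(k : ℤ) + 1)) := by
  have hq := residueCard_ne_zero F
  rw [primitiveDensitySeq, compactVol_primitive_one hϖ he hT, densityFactor, zpow_add₀ hq,
      _root_.zpow_neg,
    zpow_natCast, zpow_one]
  simp only [Fintype.card_fin]
  norm_num
  field_simp

/-- The three factors q^{-e} cancel against q^{3e}, and the middle factors combine as (1 +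
q^{1-k})(1 - q^{1-k}) = 1 - q^{2-2k}. The sequence is constant from e = 1 on. -/
theorem primitiveDensitySeq_two (hϖ : Irreducible ϖ) {T : Matrix (Fin 2) (Fin 2) F}
    (hT : MemPowHalfIntegral ϖ 1 T) (hk : 1 ≤ k) {e : ℕ} (he : 1 ≤ e) :
    primitiveDensitySeq ϖ (hyp F k) T e = (1 - (residueCard F : ℝ) ^ (-(k : ℤ))) *
      (1 - (residueCard F : ℝ) ^ (-(2 * (k : ℤ)) + 2)) *
      (1 + (residueCard F : ℝ) ^ (-(k : ℤ) + 2)) := by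
  have hq := residueCard_ne_zero F
  obtain ⟨k, rfl⟩ := Nat.exists_eq_add_of_le' hk
  rw [primitiveDensitySeq, compactVol_primitive_two' hϖ he hT, densityFactor]
  simp only [Fintype.card_fin, Nat.add_sub_cancel]
  have e1 : -((k + 1 : ℕ) : ℤ) = -(k : ℤ) - 1 := by push_cast; ring
  have e2 : -(2 * ((k + 1 : ℕ) : ℤ)) + 2 = -(k : ℤ) + -(k : ℤ) := by push_cast; ring
  have e3 : -((k + 1 : ℕ) : ℤ) + 2 = -(k : ℤ) + 1 := by push_cast; ring
  rw [e2, e3, e1, zpow_add₀ hq, zpow_add₀ hq, zpow_sub₀ hq, _root_.zpow_neg, zpow_natCast, zpow_one]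
  norm_num
  rw [pow_succ, pow_mul]
  field_simp
  ring

end PrimitiveDensityValue

/-! ### The modified density as an average over x -/

section ModifiedDensity

variable {F : Type*} [Field F] [ValuativeRel F] [TopologicalSpace F]
  [IsNonarchimedeanLocalField F] [CharZero F] {ϖ : 𝒪[F]} {p r : ℕ}

/-- The mixed block of a symmetric matrix of degree p + r has rp coordinates; its factor q^{rpe}
cancels the volume of the block b in the fibre computation. -/
theorem densityFactor_add (F : Type*) [Field F] [ValuativeRel F] (p r e : ℕ) :
    densityFactor F (p + r) e =
      densityFactor F p e * densityFactor F r e * (residueCard F : ℝ) ^ (r * (p * e)) := by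
  have h : (p + r) * (p + r + 1) / 2 = p * (p + 1) / 2 + r * (r + 1) / 2 + r * p := by
    have h1 : 2 ∣ p * (p + 1) := (Nat.even_mul_succ_self p).two_dvd
    have h2 : 2 ∣ r * (r + 1) := (Nat.even_mul_succ_self r).two_dvd
    obtain ⟨a, ha⟩ := h1
    obtain ⟨b, hb⟩ := h2
    have : (p + r) * (p + r + 1) = 2 * (a + b + r * p) := by linarith
    rw [this, ha, hb]
    simp
  simp only [densityFactor, h, ← pow_add]
  congr 1
  ring

theorem densityFactor_ne_zero (F : Type*) [Field F] [ValuativeRel F] [TopologicalSpace F]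
    [IsNonarchimedeanLocalField F] (n e : ℕ) : densityFactor F n e ≠ 0 :=
  pow_ne_zero _ (residueCard_ne_zero F)

/-- Both sequences have reached their limit at e = 2l + 1, where the two solution sets coincide. -/
theorem localDensity_congr {m n : Type*} [Fintype m] [Fintype n] [DecidableEq n]
    (hϖ : Irreducible ϖ) {S : Matrix m m F} (hS : IsHalfIntegral S) {T T' : Matrix n n F}
    (hT : IsHalfIntegral T) (hT' : IsHalfIntegral T') {l : ℕ} (hl : DetBound ϖ T l)
    (hl' : DetBound ϖ T' l) (h : MemPowHalfIntegral ϖ (2 * l + 1) (T' - T)) :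
    localDensity ϖ S T' = localDensity ϖ S T := by
  rw [← localDensitySeq_eq hϖ hS hT hl le_rfl, ← localDensitySeq_eq hϖ hS hT' hl' le_rfl,
    localDensitySeq, localDensitySeq, solSet_congr h]

/-- The fibre over x is the solution set of S[c] ≡ T(R, A, x), whose density depends only on x
modulo ϖ^{2l+1} because l is uniform in x. The classes all have volume q^{-rp(2l+1)}. -/
theorem modifiedDensitySeq_eq {m : Type*} [Fintype m] (hϖ : Irreducible ϖ) {S : Matrix m m F}
    (hS : IsHalfIntegral S) {T : Matrix (Fin p ⊕ Fin r) (Fin p ⊕ Fin r) F}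
    (hT : IsHalfIntegral T) {l e : ℕ}
    (hl : ∀ x, DetBound ϖ
      (blockSubst T.toBlocks₁₁ ((2 : F) • T.toBlocks₂₁) T.toBlocks₂₂ x) l)
    {Ω : Finset (Matrix (Fin r) (Fin p) 𝒪[F])} (hΩ : IsCosetReps (2 * l + 1) Ω)
    (he : 2 * l + 1 ≤ e) :
    modifiedDensitySeq ϖ S T.toBlocks₁₁ ((2 : F) • T.toBlocks₂₁) T.toBlocks₂₂ e =
      ((residueCard F : ℝ) ^ (r * (p * (2 * l + 1))))⁻¹ * ∑ x ∈ Ω, localDensity ϖ S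
        (blockSubst T.toBlocks₁₁ ((2 : F) • T.toBlocks₂₁) T.toBlocks₂₂ x) := by
  classical
  set b : Matrix (Fin r) (Fin p) 𝒪[F] → Matrix (Fin p) (Fin p) F := fun x =>
    blockSubst T.toBlocks₁₁ ((2 : F) • T.toBlocks₂₁) T.toBlocks₂₂ x with hb
  have hbH : ∀ x, IsHalfIntegral (b x) := fun x => by
    rw [hb]
    simp only
    rw [blockSubst_toBlocks hT.1]
    exact hT.quadSubst _
  have hΩ' : ∀ x : Matrix (Fin r) (Fin p) 𝒪[F],
      ∃! y, y ∈ Ω ∧ ∀ i j, ϖ ^ (2 * l + 1) ∣ x i j - y i j := by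
    intro x
    have := hΩ x
    simpa only [hϖ.maximalIdeal_eq, Ideal.span_singleton_pow, Ideal.mem_span_singleton] using this
  choose ρ hρ hρ' using fun x => hΩ' x
  have hvol : ∀ x y : Matrix (Fin r) (Fin p) 𝒪[F],
      (∀ i j, ϖ ^ (2 * l + 1) ∣ x i j - y i j) →
      compactVol (solSet ϖ e S (b x)) = (densityFactor F p e)⁻¹ * localDensity ϖ S (b y) := by
    intro x y hxy
    obtain ⟨z, hz⟩ : ∃ z, x - y = ϖ ^ (2 * l + 1) • z := dvd_matrix_iff.1 hxy
    have hx : x = y + ϖ ^ (2 * l + 1) • z := by rw [← hz]; abel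
    have h1 : localDensity ϖ S (b x) = localDensity ϖ S (b y) := by
      refine localDensity_congr hϖ hS (hbH y) (hbH x) (hl y) (hl x) ?_
      rw [hx]
      exact blockSubst_sub_mem hT _ _ _
    rw [← h1, ← localDensitySeq_eq hϖ hS (hbH x) (hl x) he, localDensitySeq, Fintype.card_fin,
      inv_mul_cancel_left₀ (densityFactor_ne_zero F p e)]
  have hMo := isOpen_modifiedSolSet hϖ hS hT e
  let h : Matrix m (Fin p) 𝒪[F] × Matrix (Fin r) (Fin p) 𝒪[F] → Ω := fun Y => ⟨ρ Y.2, (hρ Y.2).1⟩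
  let D : Ω → Set (Matrix (Fin r) (Fin p) 𝒪[F]) := fun w =>
    {x | ∀ i j, ϖ ^ (2 * l + 1) ∣ x i j - w.1 i j}
  have hD : ∀ w, IsOpen (D w) := fun w => by
    refine isOpen_of_add_smul_mem ϖ hϖ (2 * l + 1) fun X hX Z i j => ?_
    have := dvd_add (hX i j) (Dvd.intro (Z i j) rfl)
    convert this using 1
    simp only [Matrix.add_apply, Matrix.smul_apply, smul_eq_mul]
    ring
  have hfib : ∀ w, modifiedSolSet ϖ e S T.toBlocks₁₁ ((2 : F) • T.toBlocks₂₁) T.toBlocks₂₂ ∩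
      h ⁻¹' {w} = modifiedSolSet ϖ e S T.toBlocks₁₁ ((2 : F) • T.toBlocks₂₁) T.toBlocks₂₂ ∩
        Prod.snd ⁻¹' D w := by
    intro w
    ext Y
    refine and_congr_right fun _ => ?_
    simp only [Set.mem_preimage, Set.mem_singleton_iff, h, D, Set.mem_ofPred_eq]
    constructor
    · intro hw
      rw [← hw]
      exact (hρ Y.2).2
    · intro hw
      exact Subtype.ext (hρ' Y.2 w.1 ⟨w.2, hw⟩).symm
  have hopen : ∀ w, IsOpen (modifiedSolSet ϖ e S T.toBlocks₁₁ ((2 : F) • T.toBlocks₂₁)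
      T.toBlocks₂₂ ∩ Prod.snd ⁻¹' D w) :=
    fun w => hMo.inter ((hD w).preimage continuous_snd)
  rw [modifiedDensitySeq, compactVol_eq_sum_fiber h (fun w => by rw [hfib w]; exact hopen w)]
  have hw : ∀ w : Ω, compactVol (modifiedSolSet ϖ e S T.toBlocks₁₁ ((2 : F) • T.toBlocks₂₁)
      T.toBlocks₂₂ ∩ h ⁻¹' {w}) = ((residueCard F : ℝ) ^ (r * (p * (2 * l + 1))))⁻¹ *
        ((densityFactor F p e)⁻¹ * localDensity ϖ S (b w.1)) := by
    intro w
    have hDv := compactVol_dvd_sub ϖ hϖ (2 * l + 1) w.1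
    simp only [Fintype.card_fin] at hDv
    let σ : Matrix (Fin r) (Fin p) 𝒪[F] × Matrix m (Fin p) 𝒪[F] →+
        Matrix m (Fin p) 𝒪[F] × Matrix (Fin r) (Fin p) 𝒪[F] :=
      (AddEquiv.prodComm).toAddMonoidHom
    rw [hfib w, ← compactVol_preimage_hom σ continuous_swap Prod.swap_surjective (hopen w), ← hDv]
    refine compactVol_prod ((hopen w).preimage continuous_swap) (hD w) (fun x hx => ?_)
      (fun x hx => ?_)
    · rw [← hvol x w.1 hx]
      congr 1
      ext c
      exact and_iff_left hx
    · ext c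
      simp only [Set.mem_ofPred_eq, Set.mem_empty_iff_false, iff_false]
      exact fun h => hx h.2
  simp only [hw, Fintype.card_fin, ← Finset.mul_sum]
  rw [Finset.sum_coe_sort Ω (fun x => localDensity ϖ S (b x))]
  have := densityFactor_ne_zero F p e
  field_simp
  rfl

end ModifiedDensity

/-! ### The matrices B[1 ⊥ W] and B_x -/

section Lower

variable {F : Type*} [Field F] [ValuativeRel F] [TopologicalSpace F]
  [IsNonarchimedeanLocalField F] [CharZero F] {ϖ : 𝒪[F]} {p r : ℕ}

theorem substLower_eq (B : Matrix (Fin p ⊕ Fin r) (Fin p ⊕ Fin r) F)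
    (W : Matrix (Fin r) (Fin r) 𝒪[F]) :
    substLower B W = quadSubst B (toField (Matrix.fromBlocks 1 0 0 W)) := by
  rw [substLower]
  congr 1
  ext (i | i) (j | j)
  · by_cases h : i = j
    · subst h; simp
    · simp [h]
  · simp
  · simp
  · simp

theorem substLower_mul (B : Matrix (Fin p ⊕ Fin r) (Fin p ⊕ Fin r) F)
    (W V : Matrix (Fin r) (Fin r) 𝒪[F]) :
    substLower B (W * V) =
      quadSubst (substLower B W) (toField (Matrix.fromBlocks 1 0 0 V)) := by
  rw [substLower_eq, substLower_eq, ← quadSubst_mul, ← toField_mul, Matrix.fromBlocks_multiply]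
  simp

theorem IsHalfIntegral.substLower {B : Matrix (Fin p ⊕ Fin r) (Fin p ⊕ Fin r) F}
    (hB : IsHalfIntegral B) (W : Matrix (Fin r) (Fin r) 𝒪[F]) :
    IsHalfIntegral (substLower B W) := by
  rw [substLower_eq]
  exact hB.quadSubst _

theorem det_substLower (B : Matrix (Fin p ⊕ Fin r) (Fin p ⊕ Fin r) F)
    (W : Matrix (Fin r) (Fin r) 𝒪[F]) :
    (substLower B W).det = (W.det : F) ^ 2 * B.det := by
  have h : (toField W).det = (W.det : F) := by
    have := (RingHom.map_det (𝒪[F].subtype) W).symm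
    exact this
  rw [_root_.substLower, quadSubst, Matrix.det_mul, Matrix.det_mul, Matrix.det_transpose,
    Matrix.det_fromBlocks_zero₂₁, Matrix.det_one, one_mul, h]
  ring

theorem toBlocks_substLower_smul (B : Matrix (Fin p ⊕ Fin r) (Fin p ⊕ Fin r) F) :
    (substLower B (ϖ • 1)).toBlocks₁₁ = B.toBlocks₁₁ ∧
    (2 : F) • (substLower B (ϖ • 1)).toBlocks₂₁ = (ϖ : F) • lowerR B ∧
    (substLower B (ϖ • 1)).toBlocks₂₂ = (ϖ : F) ^ 2 • B.toBlocks₂₂ := by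
  have h : substLower B (ϖ • 1) = Matrix.fromBlocks B.toBlocks₁₁ ((ϖ : F) • B.toBlocks₁₂)
      ((ϖ : F) • B.toBlocks₂₁) ((ϖ : F) ^ 2 • B.toBlocks₂₂) := by
    conv_lhs => rw [← Matrix.fromBlocks_toBlocks B]
    rw [substLower, quadSubst, toField_smul, toField_one, Matrix.fromBlocks_transpose,
      Matrix.fromBlocks_multiply, Matrix.fromBlocks_multiply]
    simp [smul_smul, pow_two]
  rw [h]
  refine ⟨by simp, ?_, by simp⟩
  rw [Matrix.toBlocks_fromBlocks₂₁, lowerR, smul_comm]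

/-- The blocks of B[1 ⊥ ϖ] are B^{(p)}, ϖR and ϖ²A, so B_x is the matrix T(R, A, x) attached to T =
B[1 ⊥ ϖ]. -/
theorem shiftedBlock_eq_blockSubst (B : Matrix (Fin p ⊕ Fin r) (Fin p ⊕ Fin r) F)
    (x : Matrix (Fin r) (Fin p) 𝒪[F]) :
    shiftedBlock ϖ B x = blockSubst (substLower B (ϖ • 1)).toBlocks₁₁
      ((2 : F) • (substLower B (ϖ • 1)).toBlocks₂₁) (substLower B (ϖ • 1)).toBlocks₂₂ x := by
  obtain ⟨h1, h2, h3⟩ := toBlocks_substLower_smul (ϖ := ϖ) B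
  rw [h1, h2, h3, shiftedBlock]

theorem isHalfIntegral_shiftedBlock {B : Matrix (Fin p ⊕ Fin r) (Fin p ⊕ Fin r) F}
    (hB : IsHalfIntegral B) (x : Matrix (Fin r) (Fin p) 𝒪[F]) :
    IsHalfIntegral (shiftedBlock ϖ B x) := by
  rw [shiftedBlock_eq_blockSubst, blockSubst_toBlocks (hB.substLower _).1]
  exact (hB.substLower _).quadSubst _

theorem memPowHalfIntegral_lower {B : Matrix (Fin p ⊕ Fin r) (Fin p ⊕ Fin r) F}
    (hB : IsHalfIntegral B) : MemPowHalfIntegral ϖ 1 ((ϖ : F) ^ 2 • B.toBlocks₂₂) := by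
  have h0 := (memPowHalfIntegral_blocks (ϖ := ϖ) hB.1).1 (memPowHalfIntegral_zero.2 hB)
  have : IsHalfIntegral B.toBlocks₂₂ := memPowHalfIntegral_zero.1 h0.2.1
  have h2 : MemPowHalfIntegral ϖ 2 ((ϖ : F) ^ 2 • B.toBlocks₂₂) := ⟨_, this, rfl⟩
  exact h2.mono (by norm_num)

end Lower

/-! ### Integrating an identity of indicator functions -/

section InclusionExclusion

theorem compactVol_eq_of_indicator {G : Type*} [TopologicalSpace G] [AddGroup G]
    [IsTopologicalAddGroup G] [CompactSpace G] {ι : Type*} (Δ : Finset ι) {A : ι → Set G}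
    {C P Z : Set G} (hA : ∀ i, IsOpen (A i)) (hC : IsOpen C) (hP : IsOpen P) (hZ : IsOpen Z)
    (q : ℝ) (h : ∀ x, P.indicator (1 : G → ℝ) x = C.indicator 1 x -
      ∑ i ∈ Δ, (A i).indicator 1 x + q * Z.indicator 1 x) :
    compactVol P = compactVol C - ∑ i ∈ Δ, compactVol (A i) + q * compactVol Z := by
  borelize G
  simp only [compactVol_eq]
  have hint : ∀ {S : Set G}, IsOpen S → MeasureTheory.Integrable (S.indicator (1 : G → ℝ))
      (compactHaar G) := fun hS =>
    (MeasureTheory.integrable_const (1 : ℝ)).indicator hS.measurableSet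
  have hS : ∀ {S : Set G}, IsOpen S → (compactHaar G).real S =
      ∫ x, S.indicator (1 : G → ℝ) x ∂(compactHaar G) := fun hS =>
    (MeasureTheory.integral_indicator_one hS.measurableSet).symm
  have hsum : MeasureTheory.Integrable
      (fun x => ∑ i ∈ Δ, (A i).indicator (1 : G → ℝ) x) (compactHaar G) :=
    MeasureTheory.integrable_finsetSum _ fun i _ => hint (hA i)
  rw [hS hP, hS hC, hS hZ, Finset.sum_congr rfl fun i _ => hS (hA i),
    MeasureTheory.integral_congr_ae (Filter.Eventually.of_forall h),
    MeasureTheory.integral_add (f := fun x => C.indicator (1 : G → ℝ) x -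
      ∑ i ∈ Δ, (A i).indicator 1 x) ((hint hC).sub hsum) ((hint hZ).const_mul q),
    MeasureTheory.integral_sub (hint hC) hsum,
    MeasureTheory.integral_finsetSum _ (fun i _ => hint (hA i)),
    MeasureTheory.integral_const_mul]

end InclusionExclusion

/-! ### Lines of the residue plane and the double coset D_{2,1} -/

section Lines

variable {F : Type*} [Field F] [ValuativeRel F] [TopologicalSpace F]
  [IsNonarchimedeanLocalField F] {ϖ : 𝒪[F]}

theorem doubleCoset_diagonal (ϖ : 𝒪[F]) :
    Matrix.diagonal (fun a : Fin 2 => if a.val < 1 then ϖ else 1) = !![ϖ, 0; 0, 1] := by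
  refine Matrix.ext fun i j => ?_
  fin_cases i <;> fin_cases j <;> simp

/-- `W = g diag(ϖ, 1) h` with `v` the reduction of the second column of `g`. -/
def LineOf (ϖ : 𝒪[F]) (W : Matrix (Fin 2) (Fin 2) 𝒪[F]) (v : Fin 2 → 𝓀[F]) : Prop :=
  ∃ g h : GL (Fin 2) 𝒪[F], W = g.val * !![ϖ, 0; 0, 1] * h.val ∧
    ∀ i, IsLocalRing.residue 𝒪[F] (g.val i 1) = v i

theorem LineOf.mem_doubleCoset {W : Matrix (Fin 2) (Fin 2) 𝒪[F]} {v : Fin 2 → 𝓀[F]}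
    (h : LineOf ϖ W v) : W ∈ doubleCoset ϖ 2 1 := by
  obtain ⟨g, h, hW, -⟩ := h
  exact ⟨g, h, by rw [doubleCoset_diagonal, hW]⟩

theorem LineOf.mul {W : Matrix (Fin 2) (Fin 2) 𝒪[F]} {v : Fin 2 → 𝓀[F]}
    (h : LineOf ϖ W v) (U : GL (Fin 2) 𝒪[F]) : LineOf ϖ (W * U.val) v := by
  obtain ⟨g, h, hW, hv⟩ := h
  exact ⟨g, h * U, by rw [hW, Units.val_mul]; simp only [Matrix.mul_assoc], hv⟩

theorem exists_lineOf {W : Matrix (Fin 2) (Fin 2) 𝒪[F]} (hW : W ∈ doubleCoset ϖ 2 1) :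
    ∃ v, v ≠ 0 ∧ LineOf ϖ W v := by
  obtain ⟨g, h, hW⟩ := hW
  rw [doubleCoset_diagonal] at hW
  refine ⟨_, ?_, g, h, hW, fun i => rfl⟩
  intro h0
  have hg : IsUnit g.val.det := (Matrix.isUnit_iff_isUnit_det _).1 g.isUnit
  rw [Matrix.det_fin_two, ← IsLocalRing.residue_ne_zero_iff_isUnit] at hg
  apply hg
  have h1 := congrFun h0 0
  have h2 := congrFun h0 1
  simp only [Pi.zero_apply] at h1 h2
  rw [map_sub, map_mul, map_mul, h1, h2]
  simp

theorem exists_lineOf_of_ne_zero (ϖ : 𝒪[F]) {v : Fin 2 → 𝓀[F]} (hv : v ≠ 0) :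
    ∃ W, LineOf ϖ W v := by
  obtain ⟨w, hw⟩ : ∃ w : Fin 2 → 𝓀[F], w 0 * v 1 - v 0 * w 1 ≠ 0 := by
    by_contra! h
    apply hv
    funext i
    fin_cases i
    · simpa using h ![0, 1]
    · simpa using h ![1, 0]
  choose a ha using fun i => IsLocalRing.residue_surjective (v i)
  choose b hb using fun i => IsLocalRing.residue_surjective (w i)
  have hu : IsUnit (!![b 0, a 0; b 1, a 1] : Matrix (Fin 2) (Fin 2) 𝒪[F]) := by
    rw [Matrix.isUnit_iff_isUnit_det, Matrix.det_fin_two_of,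
      ← IsLocalRing.residue_ne_zero_iff_isUnit]
    simpa only [map_sub, map_mul, ha, hb] using hw
  refine ⟨_, hu.unit, 1, rfl, fun i => ?_⟩
  fin_cases i
  · exact ha 0
  · exact ha 1

/-- With W = g diag(ϖ, 1) h, the invertible h plays no role and the first column of Xg diag(ϖ, 1) is
divisible anyway; what remains is the second column of Xg, that is X applied to v modulo ϖ. -/
theorem LineOf.dvd_mul_iff (hϖ : Irreducible ϖ) {W : Matrix (Fin 2) (Fin 2) 𝒪[F]}
    {v : Fin 2 → 𝓀[F]} (hW : LineOf ϖ W v) {m : Type*} (X : Matrix m (Fin 2) 𝒪[F]) :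
    (∀ i j, ϖ ∣ (X * W) i j) ↔ residueMatrix X *ᵥ v = 0 := by
  obtain ⟨g, h, rfl, hv⟩ := hW
  have hunit : (∀ i j, ϖ ∣ (X * (g.val * !![ϖ, 0; 0, 1] * h.val)) i j) ↔
      ∀ i j, ϖ ∣ (X * g.val * !![ϖ, 0; 0, 1]) i j := by
    rw [dvd_matrix_iff, dvd_matrix_iff]
    constructor
    · rintro ⟨Y, hY⟩
      refine ⟨Y * (h⁻¹).val, ?_⟩
      rw [← Matrix.smul_mul, ← hY]
      simp [Matrix.mul_assoc]
    · rintro ⟨Y, hY⟩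
      refine ⟨Y * h.val, ?_⟩
      rw [← Matrix.smul_mul, ← hY]
      simp only [Matrix.mul_assoc]
  have hcol : (∀ i j, ϖ ∣ (X * g.val * !![ϖ, 0; 0, 1]) i j) ↔ ∀ i, ϖ ∣ (X * g.val) i 1 := by
    refine forall_congr' fun i => ?_
    rw [Fin.forall_fin_two]
    simp [Matrix.mul_apply (M := X * g.val), Fin.sum_univ_two]
  rw [hunit, hcol, funext_iff]
  refine forall_congr' fun i => ?_
  rw [← Ideal.mem_span_singleton, ← hϖ.maximalIdeal_eq, ← IsLocalRing.residue_eq_zero_iff]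
  simp only [Matrix.mul_apply, Matrix.mulVec, dotProduct, map_sum, map_mul, hv, residueMatrix,
    Matrix.map_apply, Pi.zero_apply]

/-- If the second columns of g and g' are parallel modulo ϖ, then M = g⁻¹g' has upper right entry
divisible by ϖ. So M diag(ϖ, 1) = diag(ϖ, 1) N with N integral and det N = det M, and the right
cosets agree. -/
theorem LineOf.exists_mul_eq (hϖ : Irreducible ϖ) {W W' : Matrix (Fin 2) (Fin 2) 𝒪[F]}
    {v v' : Fin 2 → 𝓀[F]} (hW : LineOf ϖ W v) (hW' : LineOf ϖ W' v')
    (hv : v 0 * v' 1 - v 1 * v' 0 = 0) : ∃ U : GL (Fin 2) 𝒪[F], W' = W * U.val := by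
  obtain ⟨g, h, rfl, hg⟩ := hW
  obtain ⟨g', h', rfl, hg'⟩ := hW'
  set M : GL (Fin 2) 𝒪[F] := g⁻¹ * g' with hM
  have hgM : g'.val = g.val * M.val := by
    rw [← Units.val_mul, hM, mul_inv_cancel_left]
  have hdet : ϖ ∣ g.val 0 1 * g'.val 1 1 - g.val 1 1 * g'.val 0 1 := by
    rw [← Ideal.mem_span_singleton, ← hϖ.maximalIdeal_eq, ← IsLocalRing.residue_eq_zero_iff,
      map_sub, map_mul, map_mul, hg, hg, hg', hg', hv]
  have h01 : ϖ ∣ M.val 0 1 := by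
    have hu : IsUnit g.val.det := (Matrix.isUnit_iff_isUnit_det _).1 g.isUnit
    have h2 : g.val 0 1 * g'.val 1 1 - g.val 1 1 * g'.val 0 1 = -(g.val.det * M.val 0 1) := by
      rw [hgM, Matrix.det_fin_two]
      simp only [Matrix.mul_apply, Fin.sum_univ_two]
      ring
    rw [h2, dvd_neg] at hdet
    exact hu.dvd_mul_left.1 hdet
  obtain ⟨m, hm⟩ := h01
  have hdetM : IsUnit M.val.det := (Matrix.isUnit_iff_isUnit_det _).1 M.isUnit
  have hN : IsUnit (!![M.val 0 0, m; ϖ * M.val 1 0, M.val 1 1] : Matrix (Fin 2) (Fin 2) 𝒪[F]) := by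
    rw [Matrix.isUnit_iff_isUnit_det, Matrix.det_fin_two_of]
    rw [Matrix.det_fin_two, hm] at hdetM
    convert hdetM using 1
    ring
  have hcomm : M.val * !![ϖ, 0; 0, 1] =
      !![ϖ, 0; 0, 1] * !![M.val 0 0, m; ϖ * M.val 1 0, M.val 1 1] := by
    refine Matrix.ext fun i j => ?_
    fin_cases i <;> fin_cases j <;>
      simp [Matrix.mul_apply, Fin.sum_univ_two, hm, mul_comm]
  obtain ⟨N, hN⟩ := hN
  rw [← hN] at hcomm
  refine ⟨h⁻¹ * N * h', ?_⟩
  rw [hgM]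
  have h1 : h.val * (h⁻¹).val = 1 := by rw [← Units.val_mul, mul_inv_cancel, Units.val_one]
  calc g.val * M.val * !![ϖ, 0; 0, 1] * h'.val
      = g.val * (M.val * !![ϖ, 0; 0, 1]) * h'.val := by simp only [Matrix.mul_assoc]
    _ = g.val * !![ϖ, 0; 0, 1] * (h.val * (h⁻¹).val) * N.val * h'.val := by
      rw [hcomm, h1, Matrix.mul_one]; simp only [Matrix.mul_assoc]
    _ = _ := by simp only [Units.val_mul, Matrix.mul_assoc]

/-- Every line of the residue plane comes from a unique representative. -/
theorem existsUnique_lineOf (hϖ : Irreducible ϖ) {Δ : Finset (Matrix (Fin 2) (Fin 2) 𝒪[F])}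
    (hΔ : IsDoubleCosetReps ϖ 2 1 Δ) {v : Fin 2 → 𝓀[F]} (hv : v ≠ 0) :
    ∃! W, W ∈ Δ ∧ ∃ v', v' ≠ 0 ∧ LineOf ϖ W v' ∧ v 0 * v' 1 - v 1 * v' 0 = 0 := by
  obtain ⟨W, hW⟩ := exists_lineOf_of_ne_zero ϖ hv
  obtain ⟨W', ⟨hW'Δ, U, hU⟩, huniq⟩ := hΔ.2 W hW.mem_doubleCoset
  refine ⟨W', ⟨hW'Δ, v, hv, ?_, by ring⟩, ?_⟩
  · have := hW.mul U⁻¹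
    rw [hU, Matrix.mul_assoc, ← Units.val_mul, mul_inv_cancel, Units.val_one,
      Matrix.mul_one] at this
    exact this
  · rintro W'' ⟨hΔ'', v', hv', hline, hpar⟩
    refine huniq W'' ⟨hΔ'', ?_⟩
    exact hline.exists_mul_eq hϖ hW (by linear_combination -hpar)

theorem parallel_of_orthogonal {K : Type*} [Field K] {a v v' : Fin 2 → K} (ha : a ≠ 0)
    (h : a 0 * v 0 + a 1 * v 1 = 0) (h' : a 0 * v' 0 + a 1 * v' 1 = 0) :
    v 0 * v' 1 - v 1 * v' 0 = 0 := by
  by_contra hne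
  apply ha
  funext i
  fin_cases i
  · refine (mul_eq_zero.1 (?_ : a 0 * (v 0 * v' 1 - v 1 * v' 0) = 0)).resolve_right hne
    linear_combination v' 1 * h - v 1 * h'
  · refine (mul_eq_zero.1 (?_ : a 1 * (v 0 * v' 1 - v 1 * v' 0) = 0)).resolve_right hne
    linear_combination v 0 * h' - v' 0 * h

/-- Sending W to its line is a bijection onto the projective line over the residue field. -/
theorem card_isDoubleCosetReps (hϖ : Irreducible ϖ) {Δ : Finset (Matrix (Fin 2) (Fin 2) 𝒪[F])}
    (hΔ : IsDoubleCosetReps ϖ 2 1 Δ) : Δ.card = residueCard F + 1 := by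
  have hpar : ∀ {v v' : Fin 2 → 𝓀[F]} (hv : v ≠ 0) (hv' : v' ≠ 0),
      Projectivization.mk 𝓀[F] v hv = Projectivization.mk 𝓀[F] v' hv' ↔
        v 0 * v' 1 - v 1 * v' 0 = 0 := by
    intro v v' hv hv'
    rw [Projectivization.mk_eq_mk_iff']
    constructor
    · rintro ⟨a, rfl⟩
      simp only [Pi.smul_apply, smul_eq_mul]
      ring
    · intro h
      by_cases h0 : v' 0 = 0
      · have h1 : v' 1 ≠ 0 := by
          intro h1
          apply hv'
          funext i
          fin_cases i
          · exact h0
          · exact h1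
        refine ⟨v 1 / v' 1, ?_⟩
        funext i
        fin_cases i
        · simp only [Fin.zero_eta, Pi.smul_apply, smul_eq_mul, h0, mul_zero]
          rw [h0, mul_zero, sub_zero] at h
          exact ((mul_eq_zero.1 h).resolve_right h1).symm
        · simp [h1]
      · refine ⟨v 0 / v' 0, ?_⟩
        funext i
        fin_cases i
        · simp [h0]
        · simp only [Fin.mk_one, Pi.smul_apply, smul_eq_mul]
          field_simp
          linear_combination h
  choose! ℓ hℓ0 hℓ using fun W (hW : W ∈ Δ) => exists_lineOf (hΔ.1 W hW)
  have hcard : Nat.card (Projectivization 𝓀[F] (Fin 2 → 𝓀[F])) = residueCard F + 1 :=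
    Projectivization.card_of_finrank_two 𝓀[F] (Fin 2 → 𝓀[F]) (by simp)
  rw [← hcard, ← Fintype.card_coe, ← Nat.card_eq_fintype_card]
  refine Nat.card_eq_of_bijective
    (fun W : Δ => Projectivization.mk 𝓀[F] (ℓ W.1) (hℓ0 W.1 W.2)) ⟨fun W W' h => ?_, fun P => ?_⟩
  · have h1 := (hpar _ _).1 h
    obtain ⟨U, -, hU⟩ := existsUnique_lineOf hϖ hΔ (hℓ0 W.1 W.2)
    exact Subtype.ext ((hU W.1 ⟨W.2, _, hℓ0 W.1 W.2, hℓ W.1 W.2, by ring⟩).trans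
      (hU W'.1 ⟨W'.2, _, hℓ0 W'.1 W'.2, hℓ W'.1 W'.2, h1⟩).symm)
  · induction P with | h v hv
    obtain ⟨W, ⟨hW, v', hv', hline, hvv⟩, -⟩ := existsUnique_lineOf hϖ hΔ hv
    refine ⟨⟨W, hW⟩, ?_⟩
    rw [hpar]
    choose a ha using fun i => IsLocalRing.residue_surjective (v' i)
    -- A row whose reduction has kernel the line of v'. Divisibility of AW by ϖ depends on W alone,
    -- so the line chosen for W is also the kernel.
    let A : Matrix (Fin 1) (Fin 2) 𝒪[F] := !![-a 1, a 0]
    have hA : ∀ u, residueMatrix A *ᵥ u = 0 ↔ -v' 1 * u 0 + v' 0 * u 1 = 0 := by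
      intro u
      rw [funext_iff, Fin.forall_fin_one]
      simp [residueMatrix, Matrix.mulVec, dotProduct, A, ha]
    have h1 := (hℓ W hW).dvd_mul_iff hϖ A
    rw [hline.dvd_mul_iff hϖ A, hA, hA] at h1
    have h2 := h1.1 (by ring)
    refine parallel_of_orthogonal (a := ![-v' 1, v' 0]) ?_ h2 ?_
    · intro h
      apply hv'
      funext i
      fin_cases i
      · exact congrFun h 1
      · simpa using congrFun h 0
    · simp only [Matrix.cons_val_zero, Matrix.cons_val_one]
      linear_combination -hvv

open scoped Classical in
/-- The indicator function of the primitive matrices with two columns. -/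
theorem indicator_isPrimitiveMatrix_two (hϖ : Irreducible ϖ)
    {Δ : Finset (Matrix (Fin 2) (Fin 2) 𝒪[F])} (hΔ : IsDoubleCosetReps ϖ 2 1 Δ)
    {m : Type*} [Fintype m] (X : Matrix m (Fin 2) 𝒪[F]) :
    (if IsPrimitiveMatrix X then 1 else 0 : ℝ) =
      1 - ∑ W ∈ Δ, (if ∀ i j, ϖ ∣ (X * W) i j then 1 else 0 : ℝ) +
        residueCard F * (if ∀ i j, ϖ ∣ X i j then 1 else 0 : ℝ) := by
  choose! ℓ hℓ0 hℓ using fun W (hW : W ∈ Δ) => exists_lineOf (hΔ.1 W hW)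
  have hdvd : ∀ W ∈ Δ, ((∀ i j, ϖ ∣ (X * W) i j) ↔ residueMatrix X *ᵥ ℓ W = 0) :=
    fun W hW => (hℓ W hW).dvd_mul_iff hϖ X
  rw [Finset.sum_congr rfl fun W hW => if_congr (hdvd W hW) rfl rfl]
  -- By the rank of X mod ϖ: rank 0 gives 1 - (q + 1) + q = 0, rank 2 kills no line, and rank 1
  -- kills exactly one.
  by_cases hX : ∀ i j, ϖ ∣ X i j
  · have h0 := (residueMatrix_eq_zero_iff hϖ).2 hX
    have hp : ¬ IsPrimitiveMatrix X := by
      rw [isPrimitiveMatrix_iff, h0]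
      intro h
      have := congrFun (h (fun _ => 1) (Matrix.zero_mulVec _)) 0
      exact one_ne_zero this
    rw [if_neg hp, if_pos hX]
    simp only [h0, Matrix.zero_mulVec, if_true, Finset.sum_const, card_isDoubleCosetReps hϖ hΔ]
    simp
  · rw [if_neg hX, mul_zero, add_zero]
    by_cases hp : IsPrimitiveMatrix X
    · rw [if_pos hp, Finset.sum_eq_zero, sub_zero]
      intro W hW
      rw [isPrimitiveMatrix_iff] at hp
      exact if_neg fun h => hℓ0 W hW (hp _ h)
    · rw [if_neg hp]
      have hp' := hp
      rw [isPrimitiveMatrix_iff] at hp'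
      push Not at hp'
      obtain ⟨v, hv, hv0⟩ := hp'
      obtain ⟨W, ⟨hW, v', hv', hline, hvv⟩, huniq⟩ := existsUnique_lineOf hϖ hΔ hv0
      push Not at hX
      obtain ⟨s, j, hs⟩ := hX
      have hrow : (fun j => residueMatrix X s j) ≠ 0 := by
        intro h
        apply hs
        have := congrFun h j
        rwa [← Ideal.mem_span_singleton, ← hϖ.maximalIdeal_eq, ← IsLocalRing.residue_eq_zero_iff]
      have horth : ∀ u, residueMatrix X *ᵥ u = 0 →
          residueMatrix X s 0 * u 0 + residueMatrix X s 1 * u 1 = 0 := by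
        intro u hu
        have := congrFun hu s
        simpa only [Matrix.mulVec, dotProduct, Fin.sum_univ_two, Pi.zero_apply] using this
      have hWX : residueMatrix X *ᵥ ℓ W = 0 := by
        rw [← hdvd W hW, hline.dvd_mul_iff hϖ X]
        funext i
        have hi := congrFun hv i
        simp only [Matrix.mulVec, dotProduct, Fin.sum_univ_two, Pi.zero_apply] at hi ⊢
        by_cases h0 : v 0 = 0
        · have h1 : v 1 ≠ 0 := fun h1 => hv0 (by
            funext i
            fin_cases i
            · exact h0
            · exact h1)
          refine (mul_eq_zero.1 (?_ : v 1 * (residueMatrix X i 0 * v' 0 +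
            residueMatrix X i 1 * v' 1) = 0)).resolve_left h1
          linear_combination v' 1 * hi - residueMatrix X i 0 * hvv
        · refine (mul_eq_zero.1 (?_ : v 0 * (residueMatrix X i 0 * v' 0 +
            residueMatrix X i 1 * v' 1) = 0)).resolve_left h0
          linear_combination v' 0 * hi + residueMatrix X i 1 * hvv
      rw [Finset.sum_eq_single W, if_pos hWX, sub_self]
      · intro W' hW' hne
        refine if_neg fun h => hne ?_
        exact huniq W' ⟨hW', ℓ W', hℓ0 W' hW', hℓ W' hW',
          parallel_of_orthogonal hrow (horth v hv) (horth _ h)⟩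
      · exact fun h => absurd hW h

end Lines

/-! ### Primitive part as a combination of local densities -/

section DensityIdentities

variable {F : Type*} [Field F] [ValuativeRel F] [TopologicalSpace F]
  [IsNonarchimedeanLocalField F] [CharZero F] {ϖ : 𝒪[F]} {p r k : ℕ}

theorem eventually_localDensitySeq_eq (hϖ : Irreducible ϖ) (k : ℕ) {n : Type*} [Fintype n]
    [DecidableEq n] {T : Matrix n n F} (hT : IsHalfIntegral T) (hdet : T.det ≠ 0) :
    ∀ᶠ e in atTop, localDensitySeq ϖ (hyp F k) T e = localDensity ϖ (hyp F k) T := by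
  obtain ⟨l, hl⟩ := exists_detBound hϖ hdet
  filter_upwards [eventually_ge_atTop (2 * l + 1)] with e he
  exact localDensitySeq_eq hϖ (isHalfIntegral_hyp k) hT hl he

theorem converges_localDensitySeq_hyp (hϖ : Irreducible ϖ) (k : ℕ) {n : Type*} [Fintype n]
    [DecidableEq n] {T : Matrix n n F} (hT : IsHalfIntegral T) (hdet : T.det ≠ 0) :
    Converges (localDensitySeq ϖ (hyp F k) T) := by
  obtain ⟨l, hl⟩ := exists_detBound hϖ hdet
  exact converges_localDensitySeq hϖ (isHalfIntegral_hyp k) hT hl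

theorem densityFactor_mul_primitive_part (hϖ : Irreducible ϖ) {e : ℕ}
    {T : Matrix (Fin p ⊕ Fin r) (Fin p ⊕ Fin r) F} (hT : IsHalfIntegral T)
    (hframe : ∀ X₂ : Matrix (Fin 2 × Fin k) (Fin r) 𝒪[F],
      X₂ ∈ solSet ϖ e (hyp F k) T.toBlocks₂₂ → IsPrimitiveMatrix X₂ → r ≤ k ∧
      ∃ (U : Matrix ((Fin r ⊕ Fin r) ⊕ (Fin 2 × Fin (k - r))) (Fin 2 × Fin k) 𝒪[F])
        (Q : Matrix (Fin r) (Fin r) 𝒪[F]),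
        Uᵀ * splitForm 𝒪[F] r (k - r) * U = polarForm 𝒪[F] k ∧
        U * X₂ = Matrix.fromRows (Matrix.fromRows 1 Q) 0) :
    densityFactor F (p + r) e * compactVol {X : Matrix (Fin 2 × Fin k) (Fin p ⊕ Fin r) 𝒪[F] |
        X ∈ solSet ϖ e (hyp F k) T ∧ IsPrimitiveMatrix X.toCols₂} =
      primitiveDensitySeq ϖ (hyp F k) T.toBlocks₂₂ e *
        modifiedDensitySeq ϖ (hyp F (k - r)) T.toBlocks₁₁ ((2 : F) • T.toBlocks₂₁)
          T.toBlocks₂₂ e := by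
  rw [compactVol_primitive_part hϖ hT hframe, densityFactor_add, primitiveDensitySeq,
    modifiedDensitySeq, Fintype.card_fin, Fintype.card_fin]
  have := pow_ne_zero (r * (p * e)) (residueCard_ne_zero F)
  field_simp

/-- The column substitution formula with weight 0 on the first p columns and m = 2k. -/
theorem eventually_divisible_part (hϖ : Irreducible ϖ) (k : ℕ)
    {T : Matrix (Fin p ⊕ Fin r) (Fin p ⊕ Fin r) F} (hT : IsHalfIntegral T) (hdet : T.det ≠ 0)
    (c : Fin r → ℕ) (hc : ∀ i, c i ≤ 1) :
    ∀ᶠ e in atTop, densityFactor F (p + r) e *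
      compactVol {X : Matrix (Fin 2 × Fin k) (Fin p ⊕ Fin r) 𝒪[F] |
        X ∈ solSet ϖ e (hyp F k) (substLower T (Matrix.diagonal fun i => ϖ ^ c i)) ∧
          ∀ i j, ϖ ^ c j ∣ X.toCols₂ i j} =
      (residueCard F : ℝ) ^ ((((p + r : ℕ) : ℤ) - 2 * (k : ℤ) + 1) * ∑ i, (c i : ℤ)) *
        localDensity ϖ (hyp F k) T := by
  obtain ⟨l, hl⟩ := exists_detBound hϖ hdet
  filter_upwards [eventually_ge_atTop (2 * l + 4)] with e he
  have h := densityFactor_mul_compactVol_dvd_columns hϖ (isHalfIntegral_hyp (F := F) k) hT hl he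
    (Sum.elim 0 c) (by rintro (i | i); exacts [Nat.zero_le _, hc i])
  have hD : Matrix.diagonal (fun i => ϖ ^ Sum.elim (0 : Fin p → ℕ) c i) =
      Matrix.fromBlocks 1 0 0 (Matrix.diagonal fun i => ϖ ^ c i) := by
    rw [← Matrix.diagonal_one, Matrix.fromBlocks_diagonal]
    congr 1
    funext i
    rcases i with i | i <;> simp
  rw [hD, ← substLower_eq] at h
  simp only [Fintype.card_sum, Fintype.card_prod, Fintype.card_fin, Fintype.sum_sum_type,
    Sum.elim_inl, Sum.elim_inr, Pi.zero_apply, Nat.cast_zero, Finset.sum_const_zero,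
    zero_add] at h
  have e1 : (((p + r : ℕ) : ℤ) - 2 * (k : ℤ) + 1) = ((p + r : ℕ) : ℤ) + 1 - ((2 * k : ℕ) : ℤ) := by
    push_cast; ring
  rw [e1, ← h]
  congr 2
  ext X
  simp only [Set.mem_ofPred_eq]
  rw [and_comm]
  refine and_congr_left fun _ => forall_congr' fun i => ?_
  rw [Sum.forall]
  simp [Matrix.toCols₂]

theorem substLower_mul_unit (hϖ : Irreducible ϖ) (k : ℕ)
    (B : Matrix (Fin p ⊕ Fin r) (Fin p ⊕ Fin r) F) (W : Matrix (Fin r) (Fin r) 𝒪[F])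
    (h : GL (Fin r) 𝒪[F]) :
    localDensity ϖ (hyp F k) (substLower B (W * h.val)) =
      localDensity ϖ (hyp F k) (substLower B W) := by
  rw [localDensity, localDensity]
  congr 1
  funext e
  have hU : IsUnit (Matrix.fromBlocks 1 0 0 h.val :
      Matrix (Fin p ⊕ Fin r) (Fin p ⊕ Fin r) 𝒪[F]) := by
    rw [Matrix.isUnit_iff_isUnit_det, Matrix.det_fromBlocks_zero₂₁, Matrix.det_one, one_mul]
    exact (Matrix.isUnit_iff_isUnit_det _).1 h.isUnit
  rw [localDensitySeq, localDensitySeq, substLower_mul,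
    compactVol_solSet_quadSubst ϖ hϖ e (isHalfIntegral_hyp k) _ hU]

theorem det_ne_zero_substLower {B : Matrix (Fin p ⊕ Fin r) (Fin p ⊕ Fin r) F} (hB : B.det ≠ 0)
    {W : Matrix (Fin r) (Fin r) 𝒪[F]} (hW : W.det ≠ 0) : (substLower B W).det ≠ 0 := by
  rw [det_substLower]
  exact mul_ne_zero (pow_ne_zero _ (by simpa using hW)) hB

theorem det_smul_one_ne_zero (hϖ : Irreducible ϖ) (r : ℕ) :
    (ϖ • (1 : Matrix (Fin r) (Fin r) 𝒪[F])).det ≠ 0 := by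
  rw [Matrix.det_smul, Matrix.det_one, mul_one]
  exact pow_ne_zero _ hϖ.ne_zero

theorem det_ne_zero_of_mem_doubleCoset (hϖ : Irreducible ϖ) {W : Matrix (Fin 2) (Fin 2) 𝒪[F]}
    (hW : W ∈ doubleCoset ϖ 2 1) : W.det ≠ 0 := by
  obtain ⟨g, h, rfl⟩ := hW
  have hg := (Matrix.isUnit_iff_isUnit_det _).1 g.isUnit
  have hh := (Matrix.isUnit_iff_isUnit_det _).1 h.isUnit
  rw [doubleCoset_diagonal, Matrix.det_mul, Matrix.det_mul, Matrix.det_fin_two_of]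
  simp only [mul_one, mul_zero, sub_zero]
  exact mul_ne_zero (mul_ne_zero hg.ne_zero hϖ.ne_zero) hh.ne_zero

theorem tendsto_of_eventually_eq {u : ℕ → ℝ} {a : ℝ} (h : ∀ᶠ e in atTop, u e = a) :
    Tendsto u atTop (𝓝 a) ∧ limUnder atTop u = a := by
  obtain ⟨N, hN⟩ := eventually_atTop.1 h
  exact limUnder_eq_of_eventually_const hN

/-- A single column is either primitive or divisible by ϖ; the first case gives the product of
densities, the second the term with α(H_k, B). -/
theorem eventually_densityIdentity_one (hϖ : Irreducible ϖ) (k : ℕ)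
    {B : Matrix (Fin p ⊕ Fin 1) (Fin p ⊕ Fin 1) F} (hB : IsHalfIntegral B) (hdet : B.det ≠ 0) :
    ∀ᶠ e in atTop, localDensity ϖ (hyp F k) (substLower B (ϖ • 1)) -
        (residueCard F : ℝ) ^ (((p + 1 : ℕ) : ℤ) - 2 * (k : ℤ) + 1) * localDensity ϖ (hyp F k) B =
      primitiveDensitySeq ϖ (hyp F k) ((ϖ : F) ^ 2 • B.toBlocks₂₂) e *
        modifiedDensitySeq ϖ (hyp F (k - 1)) B.toBlocks₁₁ ((ϖ : F) • lowerR B)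
          ((ϖ : F) ^ 2 • B.toBlocks₂₂) e := by
  have hT := hB.substLower (ϖ • 1)
  have hTdet := det_ne_zero_substLower hdet (det_smul_one_ne_zero hϖ 1)
  obtain ⟨h1, h2, h3⟩ := toBlocks_substLower_smul (ϖ := ϖ) B
  filter_upwards [eventually_localDensitySeq_eq hϖ k hT hTdet,
    eventually_divisible_part hϖ k hB hdet (fun _ => 1) (fun _ => le_rfl)] with e he hd
  have hprim := densityFactor_mul_primitive_part (k := k) (e := e) hϖ hT
    (fun X₂ _ h => exists_frame_of_isPrimitive_one h)
  rw [h1, h2, h3] at hprim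
  have hdiag : (Matrix.diagonal fun _ : Fin 1 => ϖ ^ 1) = ϖ • (1 : Matrix (Fin 1) (Fin 1) 𝒪[F]) :=
      by
    rw [pow_one, Matrix.smul_one_eq_diagonal]
  rw [hdiag] at hd
  simp only [Finset.univ_unique, Finset.sum_const, Finset.card_singleton, Nat.cast_one, one_smul,
    mul_one] at hd
  rw [← he, ← hprim, ← hd, localDensitySeq]
  have hcols : IsOpen {X : Matrix (Fin 2 × Fin k) (Fin p ⊕ Fin 1) 𝒪[F] |
      IsPrimitiveMatrix X.toCols₂} :=
    (isOpen_isPrimitiveMatrix hϖ (Fin 2 × Fin k) (Fin 1)).preimage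
      (continuous_id.matrix_submatrix id Sum.inr)
  rw [← compactVol_inter_add_diff (solSet ϖ e (hyp F k) (substLower B (ϖ • 1))) hcols]
  have hdiff : solSet ϖ e (hyp F k) (substLower B (ϖ • 1)) \
      {X : Matrix (Fin 2 × Fin k) (Fin p ⊕ Fin 1) 𝒪[F] | IsPrimitiveMatrix X.toCols₂} =
      {X | X ∈ solSet ϖ e (hyp F k) (substLower B (ϖ • 1)) ∧ ∀ i j, ϖ ^ 1 ∣ X.toCols₂ i j} := by
    ext X
    simp only [Set.mem_sdiff, Set.mem_ofPred_eq, not_isPrimitiveMatrix_column_iff hϖ, pow_one]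
  rw [hdiff]
  simp only [Fintype.card_sum, Fintype.card_fin]
  rw [mul_add, add_sub_cancel_right]
  rfl

/-- Replacing X by X(1 ⊥ g) moves the divisibility condition to the last column. As diag(ϖ, 1)
diag(1, ϖ) = ϖ, the target becomes that of B[1 ⊥ g diag(ϖ, 1)] with the weights (0, 1) substituted,
to which the divisible column formula applies. -/
theorem compactVol_mul_doubleCoset_dvd (hϖ : Irreducible ϖ) (k e : ℕ)
    {B : Matrix (Fin p ⊕ Fin 2) (Fin p ⊕ Fin 2) F} {W : Matrix (Fin 2) (Fin 2) 𝒪[F]}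
    {g h : GL (Fin 2) 𝒪[F]} (hW : W = g.val * !![ϖ, 0; 0, 1] * h.val) :
    compactVol {X : Matrix (Fin 2 × Fin k) (Fin p ⊕ Fin 2) 𝒪[F] |
        X ∈ solSet ϖ e (hyp F k) (substLower B (ϖ • 1)) ∧ ∀ i j, ϖ ∣ (X.toCols₂ * W) i j} =
      compactVol {X : Matrix (Fin 2 × Fin k) (Fin p ⊕ Fin 2) 𝒪[F] |
        X ∈ solSet ϖ e (hyp F k) (substLower (substLower B (g.val * !![ϖ, 0; 0, 1]))
          (Matrix.diagonal fun i => ϖ ^ (![0, 1] : Fin 2 → ℕ) i)) ∧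
        ∀ i j, ϖ ^ (![0, 1] : Fin 2 → ℕ) j ∣ X.toCols₂ i j} := by
  set G : Matrix (Fin p ⊕ Fin 2) (Fin p ⊕ Fin 2) 𝒪[F] := Matrix.fromBlocks 1 0 0 g.val with hG
  have hGu : IsUnit G := by
    rw [Matrix.isUnit_iff_isUnit_det, hG, Matrix.det_fromBlocks_zero₂₁, Matrix.det_one, one_mul]
    exact (Matrix.isUnit_iff_isUnit_det _).1 g.isUnit
  have hdiag : (Matrix.diagonal fun i => ϖ ^ (![0, 1] : Fin 2 → ℕ) i) =
      (!![1, 0; 0, ϖ] : Matrix (Fin 2) (Fin 2) 𝒪[F]) := by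
    refine Matrix.ext fun i j => ?_
    fin_cases i <;> fin_cases j <;> simp
  have hDD : (!![ϖ, 0; 0, 1] : Matrix (Fin 2) (Fin 2) 𝒪[F]) * !![1, 0; 0, ϖ] = ϖ • 1 := by
    refine Matrix.ext fun i j => ?_
    fin_cases i <;> fin_cases j <;> simp [Matrix.mul_apply, Fin.sum_univ_two]
  have hT : substLower (substLower B (g.val * !![ϖ, 0; 0, 1])) !![1, 0; 0, ϖ] =
      quadSubst (substLower B (ϖ • 1)) (toField G) := by
    rw [hG, ← substLower_mul, substLower_eq (substLower B (g.val * !![ϖ, 0; 0, 1])),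
      ← substLower_mul, Matrix.mul_assoc, hDD, Matrix.mul_smul, Matrix.mul_one, Matrix.smul_mul,
      Matrix.one_mul]
  rw [hdiag, hT]
  have hopen : IsOpen {X : Matrix (Fin 2 × Fin k) (Fin p ⊕ Fin 2) 𝒪[F] |
      X ∈ solSet ϖ e (hyp F k) (quadSubst (substLower B (ϖ • 1)) (toField G)) ∧
        ∀ i j, ϖ ^ (![0, 1] : Fin 2 → ℕ) j ∣ X.toCols₂ i j} :=
    (isOpen_solSet ϖ hϖ e (isHalfIntegral_hyp k) _).inter
      ((isOpen_dvd_columns ϖ hϖ (Fin 2 × Fin k) ![0, 1]).preimage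
        (continuous_id.matrix_submatrix id Sum.inr))
  rw [← compactVol_preimage_mul_right hGu hopen]
  congr 1
  ext X
  refine and_congr ?_ ?_
  · exact (mul_mem_solSet_iff (ϖ := ϖ) (e := e) (S := hyp F k) (T := substLower B (ϖ • 1))
      (X := X) hGu).symm
  · have hcol : (X * G).toCols₂ = X.toCols₂ * g.val := by
      refine Matrix.ext fun i j => ?_
      simp [Matrix.toCols₂, Matrix.mul_apply, hG]
    rw [hcol, hW]
    have hunit : (∀ i j, ϖ ∣ (X.toCols₂ * (g.val * !![ϖ, 0; 0, 1] * h.val)) i j) ↔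
        ∀ i j, ϖ ∣ (X.toCols₂ * g.val * !![ϖ, 0; 0, 1]) i j := by
      rw [dvd_matrix_iff, dvd_matrix_iff]
      constructor
      · rintro ⟨Y, hY⟩
        refine ⟨Y * (h⁻¹).val, ?_⟩
        rw [← Matrix.smul_mul, ← hY]
        simp [Matrix.mul_assoc]
      · rintro ⟨Y, hY⟩
        refine ⟨Y * h.val, ?_⟩
        rw [← Matrix.smul_mul, ← hY]
        simp only [Matrix.mul_assoc]
    rw [hunit]
    refine forall_congr' fun i => ?_
    rw [Fin.forall_fin_two, Fin.forall_fin_two]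
    simp [Matrix.mul_apply (M := X.toCols₂ * g.val), Fin.sum_univ_two]

theorem eventually_densityIdentity_two (hϖ : Irreducible ϖ) (k : ℕ)
    {B : Matrix (Fin p ⊕ Fin 2) (Fin p ⊕ Fin 2) F} (hB : IsHalfIntegral B) (hdet : B.det ≠ 0)
    {Δ : Finset (Matrix (Fin 2) (Fin 2) 𝒪[F])} (hΔ : IsDoubleCosetReps ϖ 2 1 Δ) :
    ∀ᶠ e in atTop, localDensity ϖ (hyp F k) (substLower B (ϖ • 1)) +
        (residueCard F : ℝ) ^ (2 * ((p + 2 : ℕ) : ℤ) - 4 * (k : ℤ) + 3) *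
          localDensity ϖ (hyp F k) B -
        (residueCard F : ℝ) ^ (((p + 2 : ℕ) : ℤ) - 2 * (k : ℤ) + 1) *
          ∑ W ∈ Δ, localDensity ϖ (hyp F k) (substLower B W) =
      primitiveDensitySeq ϖ (hyp F k) ((ϖ : F) ^ 2 • B.toBlocks₂₂) e *
        modifiedDensitySeq ϖ (hyp F (k - 2)) B.toBlocks₁₁ ((ϖ : F) • lowerR B)
          ((ϖ : F) ^ 2 • B.toBlocks₂₂) e := by
  classical
  have hT := hB.substLower (ϖ • 1)
  have hTdet := det_ne_zero_substLower hdet (det_smul_one_ne_zero hϖ 2)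
  obtain ⟨h1, h2, h3⟩ := toBlocks_substLower_smul (ϖ := ϖ) B
  have hW : ∀ W ∈ Δ, ∀ᶠ e in atTop, densityFactor F (p + 2) e *
      compactVol {X : Matrix (Fin 2 × Fin k) (Fin p ⊕ Fin 2) 𝒪[F] |
        X ∈ solSet ϖ e (hyp F k) (substLower B (ϖ • 1)) ∧ ∀ i j, ϖ ∣ (X.toCols₂ * W) i j} =
      (residueCard F : ℝ) ^ (((p + 2 : ℕ) : ℤ) - 2 * (k : ℤ) + 1) *
        localDensity ϖ (hyp F k) (substLower B W) := by
    intro W hWΔ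
    obtain ⟨g, h, hgh⟩ := hΔ.1 W hWΔ
    rw [doubleCoset_diagonal] at hgh
    have hg1 : (g.val * !![ϖ, 0; 0, 1]).det ≠ 0 := by
      refine det_ne_zero_of_mem_doubleCoset hϖ ⟨g, 1, ?_⟩
      rw [doubleCoset_diagonal, Units.val_one, Matrix.mul_one]
    filter_upwards [eventually_divisible_part hϖ k (hB.substLower (g.val * !![ϖ, 0; 0, 1]))
      (det_ne_zero_substLower hdet hg1) ![0, 1] (by
        intro i; fin_cases i <;> simp)] with e he
    -- The unit h on the right does not change the density, so g diag(ϖ, 1) may be replaced by W.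
    rw [compactVol_mul_doubleCoset_dvd hϖ k e hgh, he, hgh, substLower_mul_unit hϖ]
    simp
  filter_upwards [eventually_localDensitySeq_eq hϖ k hT hTdet,
    eventually_divisible_part hϖ k hB hdet (fun _ => 1) (fun _ => le_rfl),
    (Filter.eventually_all_finset Δ).2 hW, eventually_ge_atTop 1] with e he hd hWe he1
  have hprim := densityFactor_mul_primitive_part (k := k) (e := e) hϖ hT
    (fun X₂ hX h => exists_frame_of_isPrimitive_two hϖ he1
      (by rw [h3]; exact memPowHalfIntegral_lower hB) hX h)
  rw [h1, h2, h3] at hprim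
  have hdiag : (Matrix.diagonal fun _ : Fin 2 => ϖ ^ 1) = ϖ • (1 : Matrix (Fin 2) (Fin 2) 𝒪[F]) :=
      by
    rw [pow_one, Matrix.smul_one_eq_diagonal]
  rw [hdiag] at hd
  simp only [pow_one, Finset.sum_const, Finset.card_univ, Fintype.card_fin, Nat.cast_one] at hd
  have hcol : Continuous fun X : Matrix (Fin 2 × Fin k) (Fin p ⊕ Fin 2) 𝒪[F] => X.toCols₂ :=
    continuous_id.matrix_submatrix id Sum.inr
  have hsol := isOpen_solSet ϖ hϖ e (isHalfIntegral_hyp (F := F) k) (substLower B (ϖ • 1))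
  have hdvd := isOpen_dvd_matrix ϖ hϖ 1 (Fin 2 × Fin k) (Fin 2)
  simp only [pow_one] at hdvd
  have hA : ∀ W : Matrix (Fin 2) (Fin 2) 𝒪[F],
      IsOpen {X : Matrix (Fin 2 × Fin k) (Fin p ⊕ Fin 2) 𝒪[F] |
        X ∈ solSet ϖ e (hyp F k) (substLower B (ϖ • 1)) ∧ ∀ i j, ϖ ∣ (X.toCols₂ * W) i j} := by
    intro W
    have hcW : Continuous fun X : Matrix (Fin 2 × Fin k) (Fin p ⊕ Fin 2) 𝒪[F] => X.toCols₂ * W :=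
      hcol.matrix_mul continuous_const
    exact hsol.inter (hdvd.preimage hcW)
  have hP : IsOpen {X : Matrix (Fin 2 × Fin k) (Fin p ⊕ Fin 2) 𝒪[F] |
      X ∈ solSet ϖ e (hyp F k) (substLower B (ϖ • 1)) ∧ IsPrimitiveMatrix X.toCols₂} :=
    hsol.inter ((isOpen_isPrimitiveMatrix hϖ (Fin 2 × Fin k) (Fin 2)).preimage hcol)
  have hie := compactVol_eq_of_indicator Δ
    (A := fun W => {X : Matrix (Fin 2 × Fin k) (Fin p ⊕ Fin 2) 𝒪[F] |
      X ∈ solSet ϖ e (hyp F k) (substLower B (ϖ • 1)) ∧ ∀ i j, ϖ ∣ (X.toCols₂ * W) i j})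
    (C := solSet ϖ e (hyp F k) (substLower B (ϖ • 1)))
    (P := {X : Matrix (Fin 2 × Fin k) (Fin p ⊕ Fin 2) 𝒪[F] |
      X ∈ solSet ϖ e (hyp F k) (substLower B (ϖ • 1)) ∧ IsPrimitiveMatrix X.toCols₂})
    (Z := {X : Matrix (Fin 2 × Fin k) (Fin p ⊕ Fin 2) 𝒪[F] |
      X ∈ solSet ϖ e (hyp F k) (substLower B (ϖ • 1)) ∧ ∀ i j, ϖ ∣ X.toCols₂ i j})
    hA hsol hP
    (hsol.inter (hdvd.preimage hcol)) (residueCard F) (by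
      intro X
      simp only [Set.indicator_apply, Set.mem_ofPred_eq, Pi.one_apply]
      by_cases hX : X ∈ solSet ϖ e (hyp F k) (substLower B (ϖ • 1))
      · simp only [hX, true_and, if_true]
        convert indicator_isPrimitiveMatrix_two hϖ hΔ X.toCols₂
      · simp [hX])
  rw [← he, ← hprim, hie, localDensitySeq, Finset.mul_sum, ← Finset.sum_congr rfl hWe,
    ← Finset.mul_sum]
  simp only [Fintype.card_sum, Fintype.card_fin]
  have hq := residueCard_ne_zero F
  -- Two divisible columns contribute (q^{n-2k+1})², and one more q is the coefficient in the
  -- inclusion-exclusion.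
  have e1 : 2 * ((p + 2 : ℕ) : ℤ) - 4 * (k : ℤ) + 3 =
      (((p + 2 : ℕ) : ℤ) - 2 * (k : ℤ) + 1) * (2 • 1) + 1 := by push_cast; ring
  rw [e1, zpow_add₀ hq, zpow_one, mul_right_comm, ← hd]
  ring

end DensityIdentities

/-! ### Counting representations over a finite ring by characters -/

section CharacterSums

theorem sum_sum_eq_sum_sym2 {n M : Type*} [Fintype n] [DecidableEq n] [AddCommMonoid M]
    (f : n → n → M) (g : Sym2 n → M)
    (hg : ∀ i j, g s(i, j) = if i = j then f i i else f i j + f j i) :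
    ∑ i, ∑ j, f i j = ∑ s, g s := by
  classical
  rw [← Finset.sum_product' (f := f), Finset.univ_product_univ,
    ← Finset.sum_fiberwise Finset.univ (fun x : n × n => s(x.1, x.2))]
  refine Finset.sum_congr rfl fun s _ => ?_
  induction s with | _ i j
  rw [hg]
  have hfib : (Finset.univ.filter fun x : n × n => s(x.1, x.2) = s(i, j)) = {(i, j), (j, i)} := by
    ext ⟨a, b⟩
    simp
  rw [hfib]
  split_ifs with h
  · subst h; simp
  · rw [Finset.sum_pair]
    simp [h]

/-- The symmetric matrix with entries indexed by unordered pairs. -/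
def sym2Matrix {n A : Type*} (R : Sym2 n → A) : Matrix n n A := Matrix.of fun i j => R s(i, j)

/-- The quadratic form coordinates of a pair of rows of a hyperbolic plane. -/
def rowPairing {n A : Type*} [DecidableEq n] [CommRing A] (x y : n → A) (s : Sym2 n) : A :=
  Sym2.lift ⟨fun i j => if i = j then x i * y i else x i * y j + x j * y i, fun i j => by
    by_cases h : i = j
    · subst h; rfl
    · simp only [if_neg h, if_neg (Ne.symm h), add_comm]⟩ s

theorem sum_mul_rowPairing {n A : Type*} [Fintype n] [DecidableEq n] [CommRing A]
    (R : Sym2 n → A) (x y : n → A) :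
    ∑ s, R s * rowPairing x y s = ∑ i, x i * (sym2Matrix R *ᵥ y) i := by
  symm
  simp only [Matrix.mulVec, dotProduct, sym2Matrix, Matrix.of_apply, Finset.mul_sum]
  refine sum_sum_eq_sum_sym2 _ _ fun i j => ?_
  simp only [rowPairing, Sym2.lift_mk]
  split_ifs with h
  · subst h; ring
  · rw [Sym2.eq_swap (a := j) (b := i)]; ring

variable {A : Type*} [CommRing A] [Fintype A] {χ : AddChar A ℂ}

theorem addChar_map_sum {ι : Type*} (χ : AddChar A ℂ) (s : Finset ι) (f : ι → A) :
    χ (∑ i ∈ s, f i) = ∏ i ∈ s, χ (f i) := by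
  classical
  induction s using Finset.induction_on with
  | empty => simp
  | insert a s ha ih => rw [Finset.sum_insert ha, Finset.prod_insert ha, AddChar.map_add_eq_mul, ih]

/-- The sum factors over the coordinates, and primitivity gives orthogonality in each. -/
theorem sum_addChar_pi [DecidableEq A] (hχ : χ.IsPrimitive) {ι : Type*} [Fintype ι]
    [DecidableEq ι] (v : ι → A) :
    ∑ R : ι → A, χ (∑ s, R s * v s) =
      if v = 0 then (Fintype.card A : ℂ) ^ Fintype.card ι else 0 := by
  have h1 : ∀ R : ι → A, χ (∑ s, R s * v s) = ∏ s, χ (R s * v s) := fun R =>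
    addChar_map_sum χ _ _
  simp only [h1]
  rw [← Fintype.piFinset_univ, ← Finset.prod_univ_sum (fun _ => Finset.univ) (fun s a => χ (a * v s))]
  simp only [AddChar.sum_mulShift _ hχ]
  split_ifs with h
  · subst h; simp
  · obtain ⟨s, hs⟩ : ∃ s, v s ≠ 0 := by
      by_contra! h'
      exact h (funext h')
    exact Finset.prod_eq_zero (Finset.mem_univ s) (by rw [if_neg hs, Nat.cast_zero])

/-- The exponent is ᵗx R y, so summing over x first leaves only the y in the kernel of R: a
hyperbolic plane contributes |A|^n |ker R|. -/
theorem sum_addChar_rowPairing (hχ : χ.IsPrimitive) {n : Type*} [Fintype n] [DecidableEq n]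
    (R : Sym2 n → A) :
    ∑ z : (n → A) × (n → A), χ (∑ s, R s * rowPairing z.1 z.2 s) =
      (Fintype.card A : ℂ) ^ Fintype.card n *
        Nat.card {y : n → A // sym2Matrix R *ᵥ y = 0} := by
  classical
  simp only [sum_mul_rowPairing]
  rw [Fintype.sum_prod_type_right]
  simp only [sum_addChar_pi hχ]
  rw [← Finset.sum_filter, Finset.sum_const, nsmul_eq_mul, mul_comm, Nat.card_eq_fintype_card,
    Fintype.card_subtype]

/-- The number of representations by a hyperbolic space over a finite ring, as a character sum. -/
theorem card_mul_eq_sum_addChar (hχ : χ.IsPrimitive) {n : Type*} [Fintype n] [DecidableEq n]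
    (k : ℕ) (t : Sym2 n → A) :
    (Nat.card {z : Fin k → (n → A) × (n → A) // ∑ l, rowPairing (z l).1 (z l).2 = t} : ℂ) *
        (Fintype.card A : ℂ) ^ Fintype.card (Sym2 n) =
      ∑ R : Sym2 n → A, χ (∑ s, R s * t s) *
        ((Fintype.card A : ℂ) ^ Fintype.card n *
          Nat.card {y : n → A // sym2Matrix R *ᵥ y = 0}) ^ k := by
  classical
  -- Orthogonality produces χ(-R·t); replacing R by -R restores the sign and leaves the kernel
  -- unchanged.
  have hneg : ∑ R : Sym2 n → A, χ (∑ s, R s * t s) *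
        ((Fintype.card A : ℂ) ^ Fintype.card n *
          Nat.card {y : n → A // sym2Matrix R *ᵥ y = 0}) ^ k =
      ∑ R : Sym2 n → A, χ (∑ s, (-R) s * t s) *
        ((Fintype.card A : ℂ) ^ Fintype.card n *
          Nat.card {y : n → A // sym2Matrix R *ᵥ y = 0}) ^ k := by
    rw [← Equiv.sum_comp (Equiv.neg (Sym2 n → A))]
    refine Finset.sum_congr rfl fun R _ => ?_
    have : ∀ y, sym2Matrix (-R) *ᵥ y = 0 ↔ sym2Matrix R *ᵥ y = 0 := by
      intro y
      have h : sym2Matrix (-R) = -sym2Matrix R := rfl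
      rw [h, Matrix.neg_mulVec, neg_eq_zero]
    simp only [Equiv.neg_apply, this]
  rw [hneg]
  simp only [← sum_addChar_rowPairing hχ, Fintype.sum_pow, Finset.mul_sum]
  rw [Finset.sum_comm]
  have hterm : ∀ (z : Fin k → (n → A) × (n → A)) (R : Sym2 n → A),
      χ (∑ s, (-R) s * t s) * ∏ l, χ (∑ s, R s * rowPairing (z l).1 (z l).2 s) =
        χ (∑ s, R s * (∑ l, rowPairing (z l).1 (z l).2 - t) s) := by
    intro z R
    rw [← addChar_map_sum, ← AddChar.map_add_eq_mul, Finset.sum_comm, ← Finset.sum_add_distrib]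
    congr 1
    refine Finset.sum_congr rfl fun s _ => ?_
    rw [Pi.sub_apply, Finset.sum_apply, mul_sub, Finset.mul_sum, Pi.neg_apply]
    ring
  simp only [hterm, sum_addChar_pi hχ, sub_eq_zero]
  rw [← Finset.sum_filter, Finset.sum_const, nsmul_eq_mul, Nat.card_eq_fintype_card,
    Fintype.card_subtype]

theorem card_ker_mul_card_range {n : Type*} [Fintype n] (M : Matrix n n A) :
    Nat.card {y : n → A // M *ᵥ y = 0} * Nat.card (Set.range fun y : n → A => M *ᵥ y) =
      Fintype.card A ^ Fintype.card n := by
  classical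
  let f : (n → A) →+ (n → A) := M.mulVecLin.toAddMonoidHom
  have h := AddSubgroup.card_mul_index f.ker
  rw [AddSubgroup.index_ker] at h
  rw [Nat.card_eq_fintype_card (α := n → A), Fintype.card_fun] at h
  exact h

end CharacterSums

/-! ### Characters modulo powers of ϖ -/

section ReducedCharacter

variable {F : Type*} [Field F] [ValuativeRel F] {ϖ : 𝒪[F]} {ψ : AddChar F ℂ}

theorem IsOrderZero.map_integer (hψ : IsOrderZero ψ) {a : F} (ha : a ∈ 𝒪[F]) : ψ a = 1 := by
  have := (hψ a).1 ha 1 (one_mem _)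
  rwa [mul_one] at this

theorem IsOrderZero.map_eq_of_sub_mem (hψ : IsOrderZero ψ) {a b : F} (h : a - b ∈ 𝒪[F]) :
    ψ a = ψ b := by
  have h1 : a = (a - b) + b := by ring
  rw [h1, AddChar.map_add_eq_mul, hψ.map_integer h, one_mul]

theorem IsOrderZero.map_div_eq (hψ : IsOrderZero ψ) (hϖ : ϖ ≠ 0) {e : ℕ} {a b : 𝒪[F]}
    (h : Ideal.Quotient.mk (Ideal.span {ϖ ^ e}) a = Ideal.Quotient.mk _ b) :
    ψ ((a : F) / (ϖ : F) ^ e) = ψ ((b : F) / (ϖ : F) ^ e) := by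
  have hϖ' : (ϖ : F) ≠ 0 := by simpa using hϖ
  rw [Ideal.Quotient.eq, Ideal.mem_span_singleton] at h
  obtain ⟨c, hc⟩ := h
  refine hψ.map_eq_of_sub_mem ?_
  have h2 := congrArg Subtype.val hc
  push_cast at h2
  rw [← sub_div, h2, mul_div_cancel_left₀ _ (pow_ne_zero e hϖ')]
  exact c.2

/-- The additive character of the integers modulo `ϖ ^ e` induced by a character of order zero. -/
noncomputable def quotientChar (hψ : IsOrderZero ψ) (hϖ : ϖ ≠ 0) (e : ℕ) :
    AddChar (𝒪[F] ⧸ Ideal.span {ϖ ^ e}) ℂ where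
  toFun a := ψ (((Quotient.out a : 𝒪[F]) : F) / (ϖ : F) ^ e)
  map_zero_eq_one' := by
    refine (hψ.map_div_eq hϖ (b := 0) (Quotient.out_eq _)).trans ?_
    simp
  map_add_eq_mul' a b := by
    rw [← AddChar.map_add_eq_mul, ← add_div]
    refine hψ.map_div_eq hϖ (b := Quotient.out a + Quotient.out b) ?_
    rw [map_add]
    refine (Quotient.out_eq _).trans ?_
    exact congrArg₂ _ (Quotient.out_eq a).symm (Quotient.out_eq b).symm

theorem quotientChar_mk (hψ : IsOrderZero ψ) (hϖ : ϖ ≠ 0) (e : ℕ) (a : 𝒪[F]) :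
    quotientChar hψ hϖ e (Ideal.Quotient.mk _ a) = ψ ((a : F) / (ϖ : F) ^ e) :=
  hψ.map_div_eq hϖ (Quotient.out_eq _)

/-- If all ψ(ax/ϖ^e) are 1, order zero forces a/ϖ^e to be integral. -/
theorem isPrimitive_quotientChar (hψ : IsOrderZero ψ) (hϖ : ϖ ≠ 0) (e : ℕ) :
    (quotientChar hψ hϖ e).IsPrimitive := by
  have hϖ' : (ϖ : F) ≠ 0 := by simpa using hϖ
  intro a ha h
  obtain ⟨a, rfl⟩ := Ideal.Quotient.mk_surjective a
  apply ha
  have hmem : (a : F) / (ϖ : F) ^ e ∈ 𝒪[F] := by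
    rw [hψ]
    intro x hx
    have h1 := DFunLike.congr_fun h (Ideal.Quotient.mk _ (⟨x, hx⟩ : 𝒪[F]))
    rw [AddChar.mulShift_apply, ← map_mul, quotientChar_mk, AddChar.one_apply] at h1
    rw [← h1]
    push_cast
    congr 1
    ring
  rw [Ideal.Quotient.eq_zero_iff_mem, Ideal.mem_span_singleton]
  refine ⟨⟨_, hmem⟩, Subtype.ext ?_⟩
  push_cast
  field_simp

end ReducedCharacter

/-! ### Local densities of hyperbolic spaces as character sums -/

section DensityCharacterSum

variable {F : Type*} [Field F] [ValuativeRel F] [TopologicalSpace F]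
  [IsNonarchimedeanLocalField F] {ϖ : 𝒪[F]} {ψ : AddChar F ℂ}

theorem rowPairing_map {n A A' : Type*} [DecidableEq n] [CommRing A] [CommRing A'] (f : A →+* A')
    (x y : n → A) (s : Sym2 n) :
    f (rowPairing x y s) = rowPairing (fun i => f (x i)) (fun i => f (y i)) s := by
  induction s with | _ i j
  simp only [rowPairing, Sym2.lift_mk]
  split_ifs <;> simp

/-- The rows of a matrix grouped according to the hyperbolic planes. -/
def hyperbolicPairs (k : ℕ) (V : Type*) : (Fin 2 × Fin k → V) ≃ (Fin k → V × V) where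
  toFun X l := (X (0, l), X (1, l))
  invFun z s := if s.1 = 0 then (z s.2).1 else (z s.2).2
  left_inv X := by
    funext ⟨c, l⟩
    fin_cases c <;> rfl
  right_inv z := by
    funext l
    simp

variable [CharZero F]

theorem symCoord_quadSubst_hyp {n : Type*} [DecidableEq n] {k : ℕ}
    (X : Matrix (Fin 2 × Fin k) n 𝒪[F]) (s : Sym2 n) :
    symCoord (quadSubst (hyp F k) (toField X)) s =
      ((∑ l, rowPairing (X (0, l)) (X (1, l)) s : 𝒪[F]) : F) := by
  induction s with | _ i j
  simp only [symCoord_mk, rowPairing, Sym2.lift_mk]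
  split_ifs with h
  · subst h
    exact quadSubst_hyp_diag X i
  · have hs := (quadSubst_isSymm (isHalfIntegral_hyp (F := F) k).1 (toField X)).apply i j
    rw [hs, ← two_mul, quadSubst_hyp_two_mul]
    congr 1
    exact Finset.sum_congr rfl fun l _ => by ring

theorem mem_solSet_hyp_iff {n : Type*} [Fintype n] [DecidableEq n] {k e : ℕ} {T : Matrix n n F}
    (hT : T.IsSymm) {t : Sym2 n → 𝒪[F]} (ht : ∀ s, symCoord T s = t s)
    (X : Matrix (Fin 2 × Fin k) n 𝒪[F]) :
    X ∈ solSet ϖ e (hyp F k) T ↔ ∀ s, Ideal.Quotient.mk (Ideal.span {ϖ ^ e})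
      (∑ l, rowPairing (X (0, l)) (X (1, l)) s) = Ideal.Quotient.mk _ (t s) := by
  change MemPowHalfIntegral ϖ e _ ↔ _
  rw [memPowHalfIntegral_iff_boxMem, BoxMem,
    and_iff_right ((quadSubst_isSymm (isHalfIntegral_hyp (F := F) k).1 _).sub hT)]
  refine forall_congr' fun s => ?_
  rw [Ideal.Quotient.eq, Ideal.mem_span_singleton, symCoord_sub, Pi.sub_apply,
    symCoord_quadSubst_hyp, ht]
  refine exists_congr fun a => ⟨fun h => Subtype.ext ?_, fun h => ?_⟩
  · push_cast; exact_mod_cast h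
  · exact congrArg Subtype.val h

/-- The sequence defining a local density of a hyperbolic space as a character sum. -/
theorem localDensitySeq_eq_sum_addChar (hψ : IsOrderZero ψ) (hϖ : Irreducible ϖ) {n : Type*}
    [Fintype n] [DecidableEq n] {T : Matrix n n F} (hT : T.IsSymm) {t : Sym2 n → 𝒪[F]}
    (ht : ∀ s, symCoord T s = t s) (k e : ℕ) [Fintype (𝒪[F] ⧸ Ideal.span {ϖ ^ e})] :
    (localDensitySeq ϖ (hyp F k) T e : ℂ) =
      ∑ R : Sym2 n → 𝒪[F] ⧸ Ideal.span {ϖ ^ e},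
        quotientChar hψ hϖ.ne_zero e (∑ s, R s * Ideal.Quotient.mk _ (t s)) *
          ((Nat.card (Set.range fun y : n → 𝒪[F] ⧸ Ideal.span {ϖ ^ e} =>
            sym2Matrix R *ᵥ y) : ℂ)⁻¹) ^ k := by
  have hfact : Fact (Irreducible ϖ) := ⟨hϖ⟩
  have hcardA : Fintype.card (𝒪[F] ⧸ Ideal.span {ϖ ^ e}) = residueCard F ^ e := by
    rw [← Nat.card_eq_fintype_card, card_quotient_pow ϖ hϖ]
  have hA0 : (Fintype.card (𝒪[F] ⧸ Ideal.span {ϖ ^ e}) : ℂ) ≠ 0 := by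
    rw [hcardA]
    push_cast
    exact pow_ne_zero _ (by exact_mod_cast residueCard_ne_zero F)
  let S : Set (Fin 2 × Fin k → n → (𝒪[F] ⧸ Ideal.span {ϖ ^ e})) := {X | ∑ l, rowPairing (X (0,
      l)) (X (1, l)) =
    fun s => Ideal.Quotient.mk _ (t s)}
  have hpre : solSet ϖ e (hyp F k) T =
      columnReduction ϖ (Fin 2 × Fin k) (fun _ : n => e) ⁻¹' S := by
    ext X
    rw [mem_solSet_hyp_iff hT ht]
    change _ ↔ ∑ l, rowPairing (fun j => Ideal.Quotient.mk (Ideal.span {ϖ ^ e}) (X (0, l) j))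
      (fun j => Ideal.Quotient.mk (Ideal.span {ϖ ^ e}) (X (1, l) j)) = _
    rw [funext_iff]
    refine forall_congr' fun s => ?_
    rw [map_sum, Finset.sum_apply]
    simp only [rowPairing_map]
  have hopen := isOpen_dvd_columns ϖ hϖ (Fin 2 × Fin k) (fun _ : n => e)
  have h0 : {X : Matrix (Fin 2 × Fin k) n 𝒪[F] | ∀ i j, ϖ ^ e ∣ X i j} =
      columnReduction ϖ (Fin 2 × Fin k) (fun _ : n => e) ⁻¹' {0} := by
    ext X
    exact columnReduction_eq_zero_iff.symm
  rw [h0] at hopen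
  have hvol := compactVol_preimage_finite _
    (columnReduction_surjective ϖ (Fin 2 × Fin k) (fun _ : n => e)) hopen S
  rw [← hpre] at hvol
  have hS : S.ncard = Nat.card {z : Fin k → (n → (𝒪[F] ⧸ Ideal.span {ϖ ^ e})) × (n →
      (𝒪[F] ⧸ Ideal.span {ϖ ^ e})) //
      ∑ l, rowPairing (z l).1 (z l).2 = fun s => Ideal.Quotient.mk _ (t s)} := by
    rw [← Nat.card_coe_set_eq]
    exact Nat.card_congr ((hyperbolicPairs k (n →
        (𝒪[F] ⧸ Ideal.span {ϖ ^ e}))).subtypeEquiv fun X => Iff.rfl)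
  have hcard : Nat.card (Fin 2 × Fin k → n → (𝒪[F] ⧸ Ideal.span {ϖ ^ e})) =
      Fintype.card (𝒪[F] ⧸ Ideal.span {ϖ ^ e}) ^ (Fintype.card n * (2 * k)) := by
    rw [Nat.card_eq_fintype_card, Fintype.card_fun, Fintype.card_fun, Fintype.card_prod,
      Fintype.card_fin, Fintype.card_fin, ← pow_mul]
  have hmain := card_mul_eq_sum_addChar (isPrimitive_quotientChar hψ hϖ.ne_zero e) k
    (fun s => Ideal.Quotient.mk _ (t s))
  have hvol' : compactVol (solSet ϖ e (hyp F k) T) =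
      (Nat.card {z : Fin k → (n → (𝒪[F] ⧸ Ideal.span {ϖ ^ e})) × (n →
          (𝒪[F] ⧸ Ideal.span {ϖ ^ e})) //
        ∑ l, rowPairing (z l).1 (z l).2 = fun s => Ideal.Quotient.mk _ (t s)} : ℝ) /
      (Fintype.card (𝒪[F] ⧸ Ideal.span {ϖ ^ e}) : ℝ) ^ (Fintype.card n * (2 * k)) := by
    rw [hvol, hS]
    congr 1
    exact_mod_cast hcard
  -- The density factor is exactly the factor |A|^{n(n+1)/2} left by orthogonality, so the two
  -- cancel.
  have hDF : ((densityFactor F (Fintype.card n) e : ℝ) : ℂ) =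
      (Fintype.card (𝒪[F] ⧸ Ideal.span {ϖ ^ e}) : ℂ) ^ Fintype.card (Sym2 n) := by
    rw [densityFactor, hcardA, card_sym2]
    push_cast
    rw [pow_mul]
  rw [localDensitySeq, hvol', Complex.ofReal_mul, hDF, Complex.ofReal_div]
  push_cast
  rw [mul_div_assoc', mul_comm, hmain, Finset.sum_div]
  refine Finset.sum_congr (by ext; simp) fun R _ => ?_
  rw [mul_div_assoc]
  congr 1
  -- Per plane, |A|^n |ker R| divided by the |A|^{2n} of the volume is 1/|range R|.
  have hkr := card_ker_mul_card_range (sym2Matrix R)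
  have hkr' : (Nat.card {y : n → (𝒪[F] ⧸ Ideal.span {ϖ ^ e}) // sym2Matrix R *ᵥ y = 0} : ℂ) *
      (Nat.card (Set.range fun y : n → (𝒪[F] ⧸ Ideal.span {ϖ ^ e}) => sym2Matrix R *ᵥ y) : ℂ) =
      (Fintype.card (𝒪[F] ⧸ Ideal.span {ϖ ^ e}) : ℂ) ^ Fintype.card n := by exact_mod_cast hkr
  have hn0 : (Fintype.card (𝒪[F] ⧸ Ideal.span {ϖ ^ e}) : ℂ) ^ Fintype.card n ≠ 0 :=
      pow_ne_zero _ hA0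
  have hr0 : (Nat.card (Set.range fun y : n →
      (𝒪[F] ⧸ Ideal.span {ϖ ^ e}) => sym2Matrix R *ᵥ y) : ℂ) ≠ 0 := by
    intro h
    rw [h, mul_zero] at hkr'
    exact hn0 hkr'.symm
  rw [← mul_assoc, pow_mul, pow_mul, ← div_pow]
  congr 1
  rw [← hkr'] at hn0 ⊢
  have hk0 := left_ne_zero_of_mul hn0
  field_simp

end DensityCharacterSum

/-! ### The index μ(R) as the order of a quotient of the integral lattice -/

section LatticeIndex

variable {F : Type*} [Field F] [ValuativeRel F]

/-- The integral vectors with integral image. -/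
def integralKernel {n : Type*} [Fintype n] (R : Matrix n n F) : Submodule 𝒪[F] (n → 𝒪[F]) where
  carrier := {v | ∀ i, (R *ᵥ fun j => (v j : F)) i ∈ 𝒪[F]}
  zero_mem' i := by
    have : (R *ᵥ fun j => (((0 : n → 𝒪[F]) j : 𝒪[F]) : F)) i = 0 := by
      simp [Matrix.mulVec, dotProduct]
    rw [this]; exact zero_mem _
  add_mem' {v w} hv hw i := by
    have : (R *ᵥ fun j => (((v + w) j : 𝒪[F]) : F)) i =
        (R *ᵥ fun j => (v j : F)) i + (R *ᵥ fun j => (w j : F)) i := by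
      simp [Matrix.mulVec, dotProduct, mul_add, Finset.sum_add_distrib]
    rw [this]; exact add_mem (hv i) (hw i)
  smul_mem' a v hv i := by
    have : (R *ᵥ fun j => (((a • v) j : 𝒪[F]) : F)) i = a * (R *ᵥ fun j => (v j : F)) i := by
      simp only [Matrix.mulVec, dotProduct, Pi.smul_apply, smul_eq_mul, Finset.mul_sum]
      refine Finset.sum_congr rfl fun j _ => ?_
      push_cast
      ring
    rw [this]; exact mul_mem a.2 (hv i)

theorem mem_integralKernel {n : Type*} [Fintype n] {R : Matrix n n F} {v : n → 𝒪[F]} :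
    v ∈ integralKernel R ↔ ∀ i, (R *ᵥ fun j => (v j : F)) i ∈ 𝒪[F] := Iff.rfl

/-- (RL + L)/L is the image of L under R modulo L, so it is L modulo the vectors with integral
image. -/
theorem latticeIndex_eq_card {n : Type*} [Fintype n] (R : Matrix n n F) :
    latticeIndex R = Nat.card ((n → 𝒪[F]) ⧸ integralKernel R) := by
  let π : (n → F) →+ (n → F) ⧸ stdLattice F n := QuotientAddGroup.mk' (stdLattice F n)
  have hπ : π.ker = stdLattice F n := QuotientAddGroup.ker_mk' _
  let ι : (n → 𝒪[F]) →+ (n → F) :=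
    { toFun := fun v j => (v j : F)
      map_zero' := rfl
      map_add' := fun _ _ => rfl }
  have hι : ι.range = stdLattice F n := by
    ext v
    constructor
    · rintro ⟨w, rfl⟩ i
      exact (w i).2
    · intro hv
      exact ⟨fun i => ⟨v i, hv i⟩, rfl⟩
  let f : (n → F) →+ (n → F) := R.mulVecLin.toAddMonoidHom
  let g : (n → 𝒪[F]) →+ (n → F) ⧸ stdLattice F n := (π.comp f).comp ι
  have hg : g.ker = (integralKernel R).toAddSubgroup := by
    ext v
    rw [AddMonoidHom.mem_ker]
    change π (f (ι v)) = 0 ↔ _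
    rw [← AddMonoidHom.mem_ker, hπ]
    rfl
  have hmap : (AddSubgroup.map f (stdLattice F n) ⊔ stdLattice F n).map π = g.range := by
    have hfL : AddSubgroup.map f (stdLattice F n) = (f.comp ι).range := by
      rw [← hι, AddMonoidHom.map_range]
    rw [AddSubgroup.map_sup, (AddSubgroup.map_eq_bot_iff _).2 hπ.ge, sup_bot_eq, hfL,
      AddMonoidHom.map_range]
    rfl
  have h := AddSubgroup.relIndex_ker (AddSubgroup.map f (stdLattice F n) ⊔ stdLattice F n) π
  rw [hmap, ← AddSubgroup.index_ker, hg, hπ] at h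
  exact h

theorem integralKernel_add {n : Type*} [Fintype n] (R : Matrix n n F) {Z : Matrix n n F}
    (hZ : ∀ i j, Z i j ∈ 𝒪[F]) : integralKernel (R + Z) = integralKernel R := by
  have key : ∀ v : n → 𝒪[F], ∀ i, (Z *ᵥ fun j => (v j : F)) i ∈ 𝒪[F] := fun v i =>
    sum_mem fun j _ => mul_mem (hZ i j) (v j).2
  ext v
  simp only [mem_integralKernel, Matrix.add_mulVec, Pi.add_apply]
  exact forall_congr' fun i => ⟨fun h => by simpa using sub_mem h (key v i),
    fun h => add_mem h (key v i)⟩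

end LatticeIndex

/-! ### Orders and annihilators of finite modules -/

section TorsionModules

variable {F : Type*} [Field F] [ValuativeRel F] [TopologicalSpace F]
  [IsNonarchimedeanLocalField F] {ϖ : 𝒪[F]}

theorem card_torsionBy (hϖ : Irreducible ϖ) (M : Type*) [AddCommGroup M] [Module 𝒪[F] M]
    [Finite M] : ∃ d, Nat.card (Submodule.torsionBy 𝒪[F] M ϖ) = residueCard F ^ d := by
  have hmax : (Ideal.span {ϖ}).IsMaximal := by
    rw [← hϖ.maximalIdeal_eq]; infer_instance
  let := Ideal.Quotient.field (Ideal.span {ϖ})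
  have hcard : Nat.card (𝒪[F] ⧸ Ideal.span {ϖ}) = residueCard F := by
    have := card_quotient_pow ϖ hϖ 1
    rwa [pow_one, pow_one] at this
  exact ⟨_, by rw [← hcard]; exact Module.natCard_eq_pow_finrank⟩

/-- Induction on a bound for the order, passing from M to ϖM: the kernel M[ϖ] of multiplication is a
residue field vector space, nonzero when M is. Hence the order gains at least one factor q for each
further power of ϖ needed to kill M. -/
theorem card_eq_pow_of_torsion (hϖ : Irreducible ϖ) (N : ℕ) :
    ∀ (M : Type*) [AddCommGroup M] [Module 𝒪[F] M] [Finite M],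
      Nat.card M ≤ N → (∀ m : M, ∃ e : ℕ, ϖ ^ e • m = 0) →
      ∃ j, Nat.card M = residueCard F ^ j ∧ ∀ m : M, ϖ ^ j • m = 0 := by
  induction N with
  | zero =>
    intro M _ _ _ hN
    have := Nat.card_pos (α := M)
    omega
  | succ N ih =>
    intro M _ _ _ hN htors
    by_cases hM : ∀ m : M, m = 0
    · refine ⟨0, ?_, fun m => by simp [hM m]⟩
      have : Subsingleton M := ⟨fun a b => by rw [hM a, hM b]⟩
      rw [pow_zero]
      exact Nat.card_unique
    · push Not at hM
      obtain ⟨m, hm⟩ := hM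
      let f : M →ₗ[𝒪[F]] M := LinearMap.lsmul 𝒪[F] M ϖ
      have hprod : Nat.card (Submodule.torsionBy 𝒪[F] M ϖ) * Nat.card (LinearMap.range f) =
          Nat.card M := by
        have h := AddSubgroup.card_mul_index f.toAddMonoidHom.ker
        rw [AddSubgroup.index_ker] at h
        exact h
      obtain ⟨d, hd⟩ := card_torsionBy hϖ M
      have hd1 : 1 ≤ d := by
        rw [Nat.one_le_iff_ne_zero]
        rintro rfl
        rw [pow_zero, Nat.card_eq_one_iff_unique] at hd
        have hz : ∀ e : ℕ, ϖ ^ e • m ≠ 0 := by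
          intro e
          induction e with
          | zero => simpa using hm
          | succ e he =>
            intro h0
            apply he
            have hmem : ϖ ^ e • m ∈ Submodule.torsionBy 𝒪[F] M ϖ := by
              rw [Submodule.mem_torsionBy_iff, smul_smul, ← pow_succ', h0]
            have := hd.1
            exact congrArg Subtype.val (Subsingleton.elim
              (⟨_, hmem⟩ : Submodule.torsionBy 𝒪[F] M ϖ) 0)
        obtain ⟨e, he⟩ := htors m
        exact hz e he
      have hq := one_lt_residueCard F
      have hlt : Nat.card (LinearMap.range f) ≤ N := by
        have h2 : 2 ≤ residueCard F ^ d :=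
          hq.trans_le (by simpa using Nat.pow_le_pow_right (by omega : 0 < residueCard F) hd1)
        have hpos := Nat.card_pos (α := LinearMap.range f)
        rw [hd] at hprod
        have := Nat.mul_le_mul_right (Nat.card (LinearMap.range f)) h2
        omega
      obtain ⟨j, hj, hj0⟩ := ih (LinearMap.range f) hlt (fun x => by
        obtain ⟨e, he⟩ := htors x.1
        exact ⟨e, Subtype.ext he⟩)
      refine ⟨d + j, by rw [← hprod, hd, hj, pow_add], fun x => ?_⟩
      have h1 : ϖ ^ j • ϖ • x = 0 := congrArg Subtype.val (hj0 ⟨f x, x, rfl⟩)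
      obtain ⟨d, rfl⟩ := Nat.exists_eq_add_of_le hd1
      have : 1 + d + j = d + (j + 1) := by ring
      rw [this, pow_add, pow_succ, mul_smul, mul_smul, h1, smul_zero]

variable [CharZero F]

theorem exists_pow_smul_mem (hϖ : Irreducible ϖ) {n : Type*} [Finite n] (R : Matrix n n F) :
    ∃ e : ℕ, ∀ i j, (ϖ : F) ^ e * R i j ∈ 𝒪[F] := by
  have h1 : ∀ a : F, ∃ e : ℕ, (ϖ : F) ^ e * a ∈ 𝒪[F] := by
    intro a
    by_cases ha : a = 0
    · exact ⟨0, by rw [ha, mul_zero]; exact zero_mem _⟩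
    · obtain ⟨l, c, hc⟩ := exists_mul_eq_pow hϖ (inv_ne_zero ha)
      refine ⟨l, ?_⟩
      rw [← hc, mul_assoc, inv_mul_cancel₀ ha, mul_one]
      exact c.2
  choose e he using h1
  have := Fintype.ofFinite n
  refine ⟨∑ i, ∑ j, e (R i j), fun i j => ?_⟩
  have hle : e (R i j) ≤ ∑ i, ∑ j, e (R i j) :=
    (Finset.single_le_sum (f := fun j => e (R i j)) (fun _ _ => Nat.zero_le _)
      (Finset.mem_univ j)).trans
      (Finset.single_le_sum (f := fun i => ∑ j, e (R i j)) (fun _ _ => Nat.zero_le _)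
        (Finset.mem_univ i))
  obtain ⟨b, hb⟩ := Nat.exists_eq_add_of_le' hle
  rw [hb, pow_add, mul_assoc]
  exact mul_mem (pow_mem ϖ.2 b) (he _)

/-- A module of order q^j is killed by ϖ^j; testing on the standard basis vectors bounds the
denominators of R. So the coefficient of X^j in the Siegel series is seen modulo ϖ^e as soon as j ≤
e. -/
theorem pow_mul_mem_of_latticeIndex (hϖ : Irreducible ϖ) {n : Type*} [Fintype n] [DecidableEq n]
    {R : Matrix n n F} {j : ℕ} (h : latticeIndex R = residueCard F ^ j) (i i' : n) :
    (ϖ : F) ^ j * R i i' ∈ 𝒪[F] := by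
  have hq := one_lt_residueCard F
  rw [latticeIndex_eq_card] at h
  have hfin : Finite ((n → 𝒪[F]) ⧸ integralKernel R) :=
    Nat.finite_of_card_ne_zero (by rw [h]; positivity)
  have hsmul : ∀ (a : 𝒪[F]) (v : n → 𝒪[F]),
      a • (Submodule.Quotient.mk v : (n → 𝒪[F]) ⧸ integralKernel R) = 0 ↔
        ∀ i, (a : F) * (R *ᵥ fun j => (v j : F)) i ∈ 𝒪[F] := by
    intro a v
    rw [← Submodule.Quotient.mk_smul, Submodule.Quotient.mk_eq_zero, mem_integralKernel]
    refine forall_congr' fun i => ?_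
    have : (R *ᵥ fun j => (((a • v) j : 𝒪[F]) : F)) i = a * (R *ᵥ fun j => (v j : F)) i := by
      simp only [Matrix.mulVec, dotProduct, Pi.smul_apply, smul_eq_mul, Finset.mul_sum]
      refine Finset.sum_congr rfl fun j _ => ?_
      push_cast
      ring
    rw [this]
  obtain ⟨E, hE⟩ := exists_pow_smul_mem hϖ R
  obtain ⟨j', hj', h0⟩ := card_eq_pow_of_torsion hϖ _ ((n → 𝒪[F]) ⧸ integralKernel R) le_rfl (by
    intro m
    obtain ⟨v, rfl⟩ := Submodule.Quotient.mk_surjective _ m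
    refine ⟨E, (hsmul _ _).2 fun i => ?_⟩
    simp only [Matrix.mulVec, dotProduct, Finset.mul_sum, ← mul_assoc]
    push_cast
    exact sum_mem fun l _ => mul_mem (hE i l) (v l).2)
  have hjj : j' = j := Nat.pow_right_injective hq (hj'.symm.trans h)
  subst hjj
  have := (hsmul _ _).1 (h0 (Submodule.Quotient.mk (Pi.single i' 1))) i
  have hcol : (R *ᵥ fun l => ((Pi.single i' (1 : 𝒪[F]) : n → 𝒪[F]) l : F)) i = R i i' := by
    have : (fun l => ((Pi.single i' (1 : 𝒪[F]) : n → 𝒪[F]) l : F)) = Pi.single i' 1 := by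
      funext l
      by_cases hl : l = i'
      · subst hl; simp
      · simp [hl]
    rw [this, Matrix.mulVec_single_one]
    rfl
  rw [hcol] at this
  push_cast at this
  exact this

theorem exists_latticeIndex_eq_pow (hϖ : Irreducible ϖ) {e : ℕ} {n : Type*} [Fintype n]
    (M : Matrix n n (𝒪[F] ⧸ Ideal.span {ϖ ^ e})) :
    ∃ j, Nat.card (Set.range fun y : n → 𝒪[F] ⧸ Ideal.span {ϖ ^ e} => M *ᵥ y) =
      residueCard F ^ j := by
  have hfact : Fact (Irreducible ϖ) := ⟨hϖ⟩
  let f : (n → 𝒪[F] ⧸ Ideal.span {ϖ ^ e}) →ₗ[𝒪[F]] (n → 𝒪[F] ⧸ Ideal.span {ϖ ^ e}) :=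
    M.mulVecLin.restrictScalars 𝒪[F]
  obtain ⟨j, hj, -⟩ := card_eq_pow_of_torsion hϖ _ (LinearMap.range f) le_rfl (by
    rintro ⟨x, hx⟩
    refine ⟨e, Subtype.ext ?_⟩
    funext i
    obtain ⟨a, ha⟩ := Ideal.Quotient.mk_surjective (x i)
    change ϖ ^ e • x i = 0
    rw [← ha, ← Ideal.Quotient.mk_eq_mk, ← Submodule.Quotient.mk_smul,
      Submodule.Quotient.mk_eq_zero, Ideal.mem_span_singleton]
    exact Dvd.intro _ rfl)
  exact ⟨j, hj⟩

end TorsionModules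

/-! ### The Siegel series interpolates the local densities -/

section SiegelPolynomial

variable {F : Type*} [Field F] [ValuativeRel F] [TopologicalSpace F]
  [IsNonarchimedeanLocalField F] {ϖ : 𝒪[F]} {ψ : AddChar F ℂ}

theorem trace_mul_eq_sum_sym2 {n : Type*} [Fintype n] [DecidableEq n] (B : Matrix n n F)
    {R : Matrix n n F} {r : Sym2 n → F} (hr : ∀ i j, R i j = r s(i, j)) :
    Matrix.trace (B * R) = ∑ s, symCoord B s * r s := by
  simp only [Matrix.trace, Matrix.diag_apply, Matrix.mul_apply]
  refine sum_sum_eq_sum_sym2 _ _ fun i j => ?_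
  simp only [symCoord_mk, hr, Sym2.eq_swap (a := j) (b := i)]
  split_ifs with h
  · subst h; rfl
  · ring

/-- A symmetric matrix with denominator `ϖ ^ e` lifting a symmetric matrix modulo `ϖ ^ e`. -/
noncomputable def symLift (ϖ : 𝒪[F]) (e : ℕ) {n : Type*}
    (w : Sym2 n → 𝒪[F] ⧸ Ideal.span {ϖ ^ e}) : Matrix n n F :=
  Matrix.of fun i j => ((Quotient.out (w s(i, j)) : 𝒪[F]) : F) / (ϖ : F) ^ e

theorem symLift_isSymm (ϖ : 𝒪[F]) (e : ℕ) {n : Type*}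
    (w : Sym2 n → 𝒪[F] ⧸ Ideal.span {ϖ ^ e}) : (symLift ϖ e w).IsSymm := by
  ext i j
  simp only [symLift, Matrix.transpose_apply, Matrix.of_apply, Sym2.eq_swap (a := j) (b := i)]

theorem mk_out_eq (ϖ : 𝒪[F]) (e : ℕ) (a : 𝒪[F] ⧸ Ideal.span {ϖ ^ e}) :
    Ideal.Quotient.mk (Ideal.span {ϖ ^ e}) (Quotient.out a) = a := Quotient.out_eq a

theorem div_pow_mem_integer_iff (hϖ : ϖ ≠ 0) {e : ℕ} {a : 𝒪[F]} :
    (a : F) / (ϖ : F) ^ e ∈ 𝒪[F] ↔ Ideal.Quotient.mk (Ideal.span {ϖ ^ e}) a = 0 := by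
  have hϖ' : (ϖ : F) ≠ 0 := by simpa using hϖ
  rw [Ideal.Quotient.eq_zero_iff_mem, Ideal.mem_span_singleton]
  constructor
  · intro h
    refine ⟨⟨_, h⟩, Subtype.ext ?_⟩
    push_cast
    field_simp
  · rintro ⟨b, rfl⟩
    push_cast
    rw [mul_div_cancel_left₀ _ (pow_ne_zero e hϖ')]
    exact b.2

/-- For integral v, the image under w/ϖ^e is integral exactly when w kills v modulo ϖ^e. -/
theorem latticeIndex_symLift (hϖ : ϖ ≠ 0) {e : ℕ} {n : Type*} [Fintype n]
    (w : Sym2 n → 𝒪[F] ⧸ Ideal.span {ϖ ^ e}) :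
    latticeIndex (symLift ϖ e w) =
      Nat.card (Set.range fun y : n → 𝒪[F] ⧸ Ideal.span {ϖ ^ e} => sym2Matrix w *ᵥ y) := by
  rw [latticeIndex_eq_card]
  let h : (n → 𝒪[F]) →+ (n → 𝒪[F] ⧸ Ideal.span {ϖ ^ e}) :=
    { toFun := fun v => sym2Matrix w *ᵥ fun i => Ideal.Quotient.mk _ (v i)
      map_zero' := by
        simp only [Pi.zero_apply, map_zero]
        exact Matrix.mulVec_zero _
      map_add' := fun v v' => by
        simp only [Pi.add_apply, map_add]
        exact Matrix.mulVec_add _ _ _ }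
  have hker : h.ker = (integralKernel (symLift ϖ e w)).toAddSubgroup := by
    ext v
    rw [AddMonoidHom.mem_ker]
    change h v = 0 ↔ ∀ i, _
    rw [funext_iff]
    refine forall_congr' fun i => ?_
    have h1 : h v i = Ideal.Quotient.mk _ (∑ j, Quotient.out (w s(i, j)) * v j) := by
      rw [map_sum]
      simp only [map_mul, mk_out_eq]
      rfl
    have h2 : (symLift ϖ e w *ᵥ fun j => (v j : F)) i =
        ((∑ j, Quotient.out (w s(i, j)) * v j : 𝒪[F]) : F) / (ϖ : F) ^ e := by
      push_cast
      rw [Finset.sum_div]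
      refine Finset.sum_congr rfl fun j _ => ?_
      simp only [symLift, Matrix.of_apply]
      ring
    rw [h1, h2, div_pow_mem_integer_iff hϖ]
    rfl
  have hrange : (h.range : Set (n → 𝒪[F] ⧸ Ideal.span {ϖ ^ e})) =
      Set.range fun y : n → 𝒪[F] ⧸ Ideal.span {ϖ ^ e} => sym2Matrix w *ᵥ y := by
    ext x
    constructor
    · rintro ⟨v, rfl⟩
      exact ⟨_, rfl⟩
    · rintro ⟨y, rfl⟩
      refine ⟨fun i => Quotient.out (y i), ?_⟩
      change sym2Matrix w *ᵥ _ = _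
      congr 1
      funext i
      exact mk_out_eq ϖ e (y i)
  have h3 := AddSubgroup.index_ker h
  rw [hker] at h3
  rw [← hrange]
  exact h3

variable [CharZero F]

theorem trace_mul_mem_integer {n : Type*} [Fintype n] [DecidableEq n] {B : Matrix n n F}
    {t : Sym2 n → 𝒪[F]} (ht : ∀ s, symCoord B s = t s) {Z : Matrix n n F} (hZ : Z.IsSymm)
    (hZi : ∀ i j, Z i j ∈ 𝒪[F]) : Matrix.trace (B * Z) ∈ 𝒪[F] := by
  have hr : ∀ i j, Z i j = Sym2.lift ⟨fun i j => Z i j, fun i j => hZ.apply j i⟩ s(i, j) :=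
    fun i j => rfl
  rw [trace_mul_eq_sum_sym2 B hr]
  refine sum_mem fun s _ => ?_
  induction s with | _ i j
  rw [ht]
  exact mul_mem (t _).2 (hZi i j)

theorem psi_trace_symLift (hψ : IsOrderZero ψ) (hϖ : ϖ ≠ 0) {e : ℕ} {n : Type*} [Fintype n]
    [DecidableEq n] {B : Matrix n n F} {t : Sym2 n → 𝒪[F]} (ht : ∀ s, symCoord B s = t s)
    (w : Sym2 n → 𝒪[F] ⧸ Ideal.span {ϖ ^ e}) :
    ψ (Matrix.trace (B * symLift ϖ e w)) =
      quotientChar hψ hϖ e (∑ s, w s * Ideal.Quotient.mk _ (t s)) := by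
  have h1 : ∑ s, w s * Ideal.Quotient.mk _ (t s) =
      Ideal.Quotient.mk (Ideal.span {ϖ ^ e}) (∑ s, Quotient.out (w s) * t s) := by
    rw [map_sum]
    simp only [map_mul, mk_out_eq]
  rw [h1, quotientChar_mk, trace_mul_eq_sum_sym2 B (R := symLift ϖ e w)
    (r := fun s => ((Quotient.out (w s) : 𝒪[F]) : F) / (ϖ : F) ^ e) fun i j => rfl]
  congr 1
  push_cast
  rw [Finset.sum_div]
  refine Finset.sum_congr rfl fun s _ => ?_
  rw [ht]
  ring

theorem coeff_siegelSeries (hψ : IsOrderZero ψ) (hϖ : Irreducible ϖ) {n : Type*} [Fintype n]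
    [DecidableEq n] {B : Matrix n n F} {t : Sym2 n → 𝒪[F]} (ht : ∀ s, symCoord B s = t s)
    {j e : ℕ} (hj : j ≤ e) [Fintype (𝒪[F] ⧸ Ideal.span {ϖ ^ e})] :
    PowerSeries.coeff j (siegelSeries ψ B) =
      ∑ w : Sym2 n → 𝒪[F] ⧸ Ideal.span {ϖ ^ e},
        if Nat.card (Set.range fun y : n → 𝒪[F] ⧸ Ideal.span {ϖ ^ e} => sym2Matrix w *ᵥ y) =
          residueCard F ^ j then
          quotientChar hψ hϖ.ne_zero e (∑ s, w s * Ideal.Quotient.mk _ (t s)) else 0 := by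
  classical
  have hϖ0 : (ϖ : F) ≠ 0 := by simpa using hϖ.ne_zero
  let Φ : (Sym2 n → 𝒪[F] ⧸ Ideal.span {ϖ ^ e}) → symGroup F n ⧸ symGroupInt F n :=
    fun w => QuotientAddGroup.mk ⟨symLift ϖ e w, symLift_isSymm ϖ e w⟩
  let f : symGroup F n ⧸ symGroupInt F n → ℂ := fun c =>
    if latticeIndex c.out.val = residueCard F ^ j then ψ (Matrix.trace (B * c.out.val)) else 0
  have hout : ∀ w, ∃ Z : Matrix n n F, Z.IsSymm ∧ (∀ i j, Z i j ∈ 𝒪[F]) ∧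
      (Φ w).out.val = symLift ϖ e w + Z := by
    intro w
    obtain ⟨Z, hZ⟩ := QuotientAddGroup.mk_out_eq_add (symGroupInt F n)
      ⟨symLift ϖ e w, symLift_isSymm ϖ e w⟩
    exact ⟨Z.1.1, Z.1.2, Z.2, congrArg Subtype.val hZ⟩
  have hΦ : Function.Injective Φ := by
    intro w w' h
    rw [QuotientAddGroup.eq] at h
    funext s
    induction s with | _ i i'
    have h1 : (-(symLift ϖ e w) + symLift ϖ e w') i i' ∈ 𝒪[F] := h i i'
    have h2 : (-(symLift ϖ e w) + symLift ϖ e w') i i' =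
        ((Quotient.out (w' s(i, i')) - Quotient.out (w s(i, i')) : 𝒪[F]) : F) /
          (ϖ : F) ^ e := by
      simp only [symLift, Matrix.add_apply, Matrix.neg_apply, Matrix.of_apply]
      push_cast
      ring
    rw [h2, div_pow_mem_integer_iff hϖ.ne_zero, map_sub, mk_out_eq, mk_out_eq, sub_eq_zero] at h1
    exact h1.symm
  -- Classes of index q^j have denominator dividing ϖ^j, hence ϖ^e, and so come from symmetric
  -- matrices modulo ϖ^e.
  have hsupp : Function.support f ⊆ Set.range Φ := by
    intro c hc
    have hc' : latticeIndex c.out.val = residueCard F ^ j := by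
      by_contra h
      exact hc (if_neg h)
    have hint : ∀ i i', (ϖ : F) ^ e * c.out.val i i' ∈ 𝒪[F] := by
      intro i i'
      obtain ⟨b, rfl⟩ := Nat.exists_eq_add_of_le' hj
      rw [pow_add, mul_assoc]
      exact mul_mem (pow_mem ϖ.2 b) (pow_mul_mem_of_latticeIndex hϖ hc' i i')
    have hsymm : c.out.val.IsSymm := c.out.2
    let a : Sym2 n → 𝒪[F] := Sym2.lift ⟨fun i i' => ⟨(ϖ : F) ^ e * c.out.val i i', hint i i'⟩,
      fun i i' => Subtype.ext (congrArg (fun z => (ϖ : F) ^ e * z) (hsymm.apply i' i))⟩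
    refine ⟨fun s => Ideal.Quotient.mk _ (a s), ?_⟩
    conv_rhs => rw [← QuotientAddGroup.out_eq' c]
    rw [QuotientAddGroup.eq]
    intro i i'
    change (-(symLift ϖ e fun s => Ideal.Quotient.mk _ (a s)) + c.out.val) i i' ∈ 𝒪[F]
    have h2 : (-(symLift ϖ e fun s => Ideal.Quotient.mk _ (a s)) + c.out.val) i i' =
        ((a s(i, i') - Quotient.out (Ideal.Quotient.mk (Ideal.span {ϖ ^ e}) (a s(i, i'))) :
          𝒪[F]) : F) / (ϖ : F) ^ e := by
      have h3 : (a s(i, i') : F) = (ϖ : F) ^ e * c.out.val i i' := rfl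
      simp only [symLift, Matrix.add_apply, Matrix.neg_apply, Matrix.of_apply]
      push_cast
      rw [h3]
      field_simp
      ring
    rw [h2, div_pow_mem_integer_iff hϖ.ne_zero, map_sub, mk_out_eq, sub_self]
  have hval : ∀ w, f (Φ w) =
      if Nat.card (Set.range fun y : n → 𝒪[F] ⧸ Ideal.span {ϖ ^ e} => sym2Matrix w *ᵥ y) =
          residueCard F ^ j then
          quotientChar hψ hϖ.ne_zero e (∑ s, w s * Ideal.Quotient.mk _ (t s)) else 0 := by
    intro w
    obtain ⟨Z, hZs, hZi, hZ⟩ := hout w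
    have h1 : latticeIndex (Φ w).out.val = Nat.card (Set.range fun y : n → 𝒪[F] ⧸
        Ideal.span {ϖ ^ e} => sym2Matrix w *ᵥ y) := by
      rw [hZ, latticeIndex_eq_card, integralKernel_add _ hZi, ← latticeIndex_eq_card,
        latticeIndex_symLift hϖ.ne_zero]
    have h2 : ψ (Matrix.trace (B * (Φ w).out.val)) =
        quotientChar hψ hϖ.ne_zero e (∑ s, w s * Ideal.Quotient.mk _ (t s)) := by
      rw [← psi_trace_symLift hψ hϖ.ne_zero ht, hZ, Matrix.mul_add, Matrix.trace_add]
      refine hψ.map_eq_of_sub_mem ?_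
      rw [add_sub_cancel_left]
      exact trace_mul_mem_integer ht hZs hZi
    simp only [f, h1, h2]
  have hcoeff : PowerSeries.coeff j (siegelSeries ψ B) = ∑ᶠ c, f c := by
    rw [siegelSeries, PowerSeries.coeff_mk]
  rw [hcoeff, ← finsum_mem_univ, ← finsum_mem_inter_support, Set.univ_inter,
    ← Set.inter_eq_right.2 hsupp, finsum_mem_inter_support, finsum_mem_range hΦ,
    finsum_eq_sum_of_fintype]
  exact Finset.sum_congr rfl fun w _ => hval w

/-- Each R modulo ϖ^e has image of order q^{j(R)}, so its term is a constant times (q^{-k})^{j(R)}.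
Coefficients are compared only up to degree e, where all classes are present at this level. -/
theorem exists_polynomial_level (hψ : IsOrderZero ψ) (hϖ : Irreducible ϖ) {n : Type*} [Fintype n]
    [DecidableEq n] {B : Matrix n n F} (hB : IsHalfIntegral B) (e : ℕ) :
    ∃ P : Polynomial ℂ,
      (∀ k, (localDensitySeq ϖ (hyp F k) B e : ℂ) = P.eval ((residueCard F : ℂ) ^ k)⁻¹) ∧
      ∀ j ≤ e, P.coeff j = PowerSeries.coeff j (siegelSeries ψ B) := by
  have hfact : Fact (Irreducible ϖ) := ⟨hϖ⟩
  have := Fintype.ofFinite (𝒪[F] ⧸ Ideal.span {ϖ ^ e})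
  have hbox := (memPowHalfIntegral_iff_boxMem (ϖ := ϖ)).1 (memPowHalfIntegral_zero.2 hB)
  choose t ht using hbox.2
  simp only [pow_zero, one_mul] at ht
  choose j hj using fun w : Sym2 n → 𝒪[F] ⧸ Ideal.span {ϖ ^ e} =>
    exists_latticeIndex_eq_pow hϖ (sym2Matrix w)
  refine ⟨∑ w : Sym2 n → 𝒪[F] ⧸ Ideal.span {ϖ ^ e},
    Polynomial.C (quotientChar hψ hϖ.ne_zero e (∑ s, w s * Ideal.Quotient.mk _ (t s))) *
      Polynomial.X ^ j w, fun k => ?_, fun i hi => ?_⟩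
  · rw [localDensitySeq_eq_sum_addChar hψ hϖ hB.1 ht, Polynomial.eval_finsetSum]
    refine Finset.sum_congr rfl fun w _ => ?_
    rw [hj w, Polynomial.eval_mul, Polynomial.eval_C, Polynomial.eval_pow, Polynomial.eval_X]
    push_cast
    rw [inv_pow, inv_pow, ← pow_mul, ← pow_mul, mul_comm (j w)]
  · rw [coeff_siegelSeries hψ hϖ ht hi, Polynomial.finsetSum_coeff]
    refine Finset.sum_congr rfl fun w _ => ?_
    rw [Polynomial.coeff_C_mul_X_pow, hj w]
    have hq := Nat.pow_right_injective (one_lt_residueCard F)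
    by_cases h : i = j w
    · rw [if_pos h, if_pos (by rw [h])]
    · rw [if_neg h, if_neg fun h' => h (hq h').symm]

theorem polynomial_eq_of_eval_pow {q : ℕ} (hq : 1 < q) (N : ℕ) {P Q : Polynomial ℂ}
    (h : ∀ k, N ≤ k → P.eval ((q : ℂ) ^ k)⁻¹ = Q.eval ((q : ℂ) ^ k)⁻¹) : P = Q := by
  refine Polynomial.eq_of_infinite_eval_eq P Q ?_
  have hinj : Function.Injective fun k : ℕ => ((q : ℂ) ^ (N + k))⁻¹ := by
    intro a b hab
    have h1 := inv_injective hab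
    have h2 : q ^ (N + a) = q ^ (N + b) := by exact_mod_cast h1
    exact Nat.add_left_cancel (Nat.pow_right_injective hq h2)
  refine (Set.infinite_range_of_injective hinj).mono ?_
  rintro _ ⟨k, rfl⟩
  exact h _ (Nat.le_add_right N k)

/-- The Siegel series is a polynomial interpolating the local densities. -/
theorem exists_siegelSeries_polynomial (hψ : IsOrderZero ψ) (hϖ : Irreducible ϖ) {n : Type*}
    [Fintype n] [DecidableEq n] {B : Matrix n n F} (hB : IsHalfIntegral B) (hdet : B.det ≠ 0) :
    ∃ P : Polynomial ℂ, siegelSeries ψ B = (P : PowerSeries ℂ) ∧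
      ∀ k, (localDensity ϖ (hyp F k) B : ℂ) = P.eval ((residueCard F : ℂ) ^ k)⁻¹ := by
  obtain ⟨l, hl⟩ := exists_detBound hϖ hdet
  choose P hP hPc using exists_polynomial_level hψ hϖ hB
  -- The threshold 2l + 1 does not involve k, so the level polynomials agree at all the points
  -- q^{-k}.
  have hconst : ∀ e, 2 * l + 1 ≤ e → P e = P (2 * l + 1) := by
    intro e he
    refine polynomial_eq_of_eval_pow (one_lt_residueCard F) 0 fun k _ => ?_
    rw [← hP, ← hP, localDensitySeq_eq hϖ (isHalfIntegral_hyp k) hB hl he,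
      localDensitySeq_eq hϖ (isHalfIntegral_hyp k) hB hl le_rfl]
  refine ⟨P (2 * l + 1), ?_, fun k => ?_⟩
  -- The coefficient of degree i is read off at level max(i, 2l + 1).
  · ext i
    rw [Polynomial.coeff_coe, ← hconst _ (le_max_right i (2 * l + 1)), hPc _ _ (le_max_left _ _)]
  · rw [← hP, localDensitySeq_eq hϖ (isHalfIntegral_hyp k) hB hl le_rfl]

end SiegelPolynomial

/-! ### Dependence of γ_q on the determinant modulo squares -/

section Gamma

theorem isSquare_sq_mul_iff {K : Type*} [Field K] {a : K} (ha : a ≠ 0) (D : K) :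
    IsSquare (a ^ 2 * D) ↔ IsSquare D := by
  constructor
  · rintro ⟨b, hb⟩
    refine ⟨b / a, ?_⟩
    field_simp
    rw [← sq] at hb
    rw [← hb]
    ring
  · rintro ⟨b, rfl⟩
    exact ⟨a * b, by ring⟩

theorem sqrtExt_sq_mul_le {K : Type*} [Field K] {a : K} (ha : a ≠ 0) (D : K) :
    sqrtExt (a ^ 2 * D) ≤ sqrtExt D := by
  rw [sqrtExt, IntermediateField.adjoin_le_iff]
  intro z hz
  have ha' : algebraMap K (AlgebraicClosure K) a ≠ 0 := by simpa using ha
  have h1 : (algebraMap K (AlgebraicClosure K) a)⁻¹ * z ∈ sqrtExt D := by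
    refine IntermediateField.subset_adjoin K _ ?_
    simp only [Set.mem_ofPred_eq, map_mul, map_pow] at hz ⊢
    rw [mul_pow, hz]
    field_simp
  have h2 := mul_mem ((sqrtExt D).algebraMap_mem a) h1
  rwa [mul_inv_cancel_left₀ ha'] at h2

theorem sqrtExt_sq_mul {K : Type*} [Field K] {a : K} (ha : a ≠ 0) (D : K) :
    sqrtExt (a ^ 2 * D) = sqrtExt D := by
  refine le_antisymm (sqrtExt_sq_mul_le ha D) ?_
  have h := sqrtExt_sq_mul_le (inv_ne_zero ha) (a ^ 2 * D)
  rwa [← mul_assoc, ← mul_pow, inv_mul_cancel₀ ha, one_pow, one_mul] at h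

variable {F : Type*} [Field F] [ValuativeRel F] [TopologicalSpace F]
  [IsNonarchimedeanLocalField F]

/-- Apart from the degree, γ_q sees B only through the field generated by the square root of D_B,
which a square factor does not change. -/
theorem gammaPoly_congr {n : Type*} [Fintype n] [DecidableEq n] {B B' : Matrix n n F} {a : F}
    (ha : a ≠ 0) (h : B'.det = a ^ 2 * B.det) : gammaPoly B' = gammaPoly B := by
  have h1 : formDiscr B' = a ^ 2 * formDiscr B := by
    rw [formDiscr, formDiscr, h]
    ring
  have h2 : xiInv B' = xiInv B := by
    rw [xiInv, xiInv, h1]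
    rw [isSquare_sq_mul_iff ha, sqrtExt_sq_mul ha]
  rw [gammaPoly, gammaPoly, h2]

theorem gammaPoly_mul_inv {n : Type*} [Fintype n] [DecidableEq n] (B : Matrix n n F) :
    gammaPoly B * (gammaPoly B)⁻¹ = 1 := by
  refine PowerSeries.mul_inv_cancel _ ?_
  rw [gammaPoly]
  split_ifs <;> simp [map_prod]

theorem gammaPoly_substLower [CharZero F] {p r : ℕ} (B : Matrix (Fin p ⊕ Fin r) (Fin p ⊕ Fin r) F)
    {W : Matrix (Fin r) (Fin r) 𝒪[F]} (hW : W.det ≠ 0) :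
    gammaPoly (substLower B W) = gammaPoly B :=
  gammaPoly_congr (by simpa using hW) (det_substLower B W)

theorem rescale_gammaPoly_mul_siegelF (ψ : AddChar F ℂ) {n : Type*} [Fintype n] [DecidableEq n]
    (B : Matrix n n F) (a : ℂ) :
    PowerSeries.rescale a (gammaPoly B) * PowerSeries.rescale a (siegelF ψ B) =
      PowerSeries.rescale a (siegelSeries ψ B) := by
  rw [← map_mul, siegelF, mul_left_comm, gammaPoly_mul_inv, mul_one]

theorem coe_comp_C_mul_X (P : Polynomial ℂ) (a : ℂ) :
    ((P.comp (Polynomial.C a * Polynomial.X) : Polynomial ℂ) : PowerSeries ℂ) =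
      PowerSeries.rescale a (P : PowerSeries ℂ) := by
  ext n
  rw [PowerSeries.coeff_rescale, Polynomial.coeff_coe, Polynomial.coeff_coe,
    Polynomial.comp_C_mul_X_coeff, mul_comm]

end Gamma

/-! ### From density identities at all k to identities of power series -/

section Interpolation

/-- With X = q^{-k} every term is a polynomial in X, a density at k - 1 being a value at qX;
infinitely many k determine the polynomials. -/
theorem powerSeries_induction_one {ι : Type*} {q : ℕ} (hq : 1 < q) (p : ℕ) (c : ℝ)
    {a b : ℕ → ℝ} {d : ι → ℕ → ℝ} {Ω : Finset ι} {P Q : Polynomial ℂ} {R : ι → Polynomial ℂ}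
    (hP : ∀ k, (b k : ℂ) = P.eval ((q : ℂ) ^ k)⁻¹) (hQ : ∀ k, (a k : ℂ) = Q.eval ((q : ℂ) ^ k)⁻¹)
    (hR : ∀ x k, (d x k : ℂ) = (R x).eval ((q : ℂ) ^ k)⁻¹)
    (h : ∀ k, a k - (q : ℝ) ^ (((p + 1 : ℕ) : ℤ) - 2 * (k : ℤ) + 1) * b k =
      c * (1 - (q : ℝ) ^ (-(k : ℤ))) * (1 + (q : ℝ) ^ (-(k : ℤ) + 1)) * ∑ x ∈ Ω, d x (k - 1)) :
    (Q : PowerSeries ℂ) =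
      PowerSeries.C ((q : ℂ) ^ (p + 2)) * PowerSeries.X ^ 2 * (P : PowerSeries ℂ) +
      PowerSeries.C (c : ℂ) * ∑ x ∈ Ω,
        (1 - PowerSeries.X) * (1 + PowerSeries.C (q : ℂ) * PowerSeries.X) *
          PowerSeries.rescale (q : ℂ) (R x : PowerSeries ℂ) := by
  have hq0 : (q : ℂ) ≠ 0 := by exact_mod_cast (by omega : q ≠ 0)
  have key : Q = Polynomial.C ((q : ℂ) ^ (p + 2)) * Polynomial.X ^ 2 * P +
      Polynomial.C (c : ℂ) * ∑ x ∈ Ω, (1 - Polynomial.X) *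
        (1 + Polynomial.C (q : ℂ) * Polynomial.X) *
          (R x).comp (Polynomial.C (q : ℂ) * Polynomial.X) := by
    -- Starting at k = 1 makes k - 1 a genuine subtraction.
    refine polynomial_eq_of_eval_pow hq 1 fun k hk => ?_
    obtain ⟨j, rfl⟩ := Nat.exists_eq_add_of_le' hk
    have h := congrArg (fun z : ℝ => (z : ℂ)) (h (j + 1))
    push_cast at h
    rw [hP, hQ, sub_eq_iff_eq_add'] at h
    simp only [hR] at h
    have e1 : (q : ℂ) ^ ((p : ℤ) + 1 - 2 * ((j : ℤ) + 1) + 1) =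
        (q : ℂ) ^ (p + 2) * (((q : ℂ) ^ (j + 1))⁻¹) ^ 2 := by
      rw [show (p : ℤ) + 1 - 2 * ((j : ℤ) + 1) + 1 =
        ((p + 2 : ℕ) : ℤ) - (((j + 1) * 2 : ℕ) : ℤ) by push_cast; ring, zpow_sub₀ hq0,
        zpow_natCast, zpow_natCast, inv_pow, pow_mul, div_eq_mul_inv]
    have e2 : (q : ℂ) ^ (-((j : ℤ) + 1)) = ((q : ℂ) ^ (j + 1))⁻¹ := by
      rw [_root_.zpow_neg]
      norm_cast
    have e3 : (q : ℂ) ^ (-((j : ℤ) + 1) + 1) = (q : ℂ) * ((q : ℂ) ^ (j + 1))⁻¹ := by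
      rw [zpow_add_one₀ hq0, e2, mul_comm]
    have e4 : (q : ℂ) * ((q : ℂ) ^ (j + 1))⁻¹ = ((q : ℂ) ^ j)⁻¹ := by
      rw [pow_succ, mul_inv, mul_comm, mul_assoc, inv_mul_cancel₀ hq0, mul_one]
    rw [e1, e3, e2] at h
    rw [h]
    simp only [Polynomial.eval_add, Polynomial.eval_mul, Polynomial.eval_C, Polynomial.eval_pow,
      Polynomial.eval_X, Polynomial.eval_finsetSum, Polynomial.eval_sub, Polynomial.eval_one,
      Polynomial.eval_comp, ← Finset.mul_sum]
    rw [e4]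
    ring
  have key' := congrArg (Polynomial.coeToPowerSeries.ringHom (R := ℂ)) key
  rw [map_add, map_mul, map_mul, map_mul, map_sum] at key'
  simpa only [Polynomial.coeToPowerSeries.ringHom_apply, Polynomial.coe_mul, Polynomial.coe_add,
    Polynomial.coe_sub, Polynomial.coe_one, Polynomial.coe_C, Polynomial.coe_X,
    Polynomial.coe_pow, coe_comp_C_mul_X] using key'

theorem powerSeries_induction_two {ι κ : Type*} {q : ℕ} (hq : 1 < q) (p : ℕ) (c : ℝ)
    {a b : ℕ → ℝ} {d : ι → ℕ → ℝ} {f : κ → ℕ → ℝ} {Ω : Finset ι} {Δ : Finset κ}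
    {P Q : Polynomial ℂ} {R : ι → Polynomial ℂ} {V : κ → Polynomial ℂ}
    (hP : ∀ k, (b k : ℂ) = P.eval ((q : ℂ) ^ k)⁻¹) (hQ : ∀ k, (a k : ℂ) = Q.eval ((q : ℂ) ^ k)⁻¹)
    (hR : ∀ x k, (d x k : ℂ) = (R x).eval ((q : ℂ) ^ k)⁻¹)
    (hV : ∀ W ∈ Δ, ∀ k, (f W k : ℂ) = (V W).eval ((q : ℂ) ^ k)⁻¹)
    (h : ∀ k, 1 ≤ k → a k + (q : ℝ) ^ (2 * ((p + 2 : ℕ) : ℤ) - 4 * (k : ℤ) + 3) * b k -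
        (q : ℝ) ^ (((p + 2 : ℕ) : ℤ) - 2 * (k : ℤ) + 1) * ∑ W ∈ Δ, f W k =
      c * (1 - (q : ℝ) ^ (-(k : ℤ))) * (1 - (q : ℝ) ^ (-(2 * (k : ℤ)) + 2)) *
        (1 + (q : ℝ) ^ (-(k : ℤ) + 2)) * ∑ x ∈ Ω, d x (k - 2)) :
    (Q : PowerSeries ℂ) =
      -(PowerSeries.C ((q : ℂ) ^ (2 * (p + 2) + 3)) * PowerSeries.X ^ 4 * (P : PowerSeries ℂ)) +
      PowerSeries.C ((q : ℂ) ^ (p + 3)) * PowerSeries.X ^ 2 * ∑ W ∈ Δ, (V W : PowerSeries ℂ) +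
      PowerSeries.C (c : ℂ) * ∑ x ∈ Ω,
        (1 - PowerSeries.X) * (1 - PowerSeries.C ((q : ℂ) ^ 2) * PowerSeries.X ^ 2) *
          (1 + PowerSeries.C ((q : ℂ) ^ 2) * PowerSeries.X) *
          PowerSeries.rescale ((q : ℂ) ^ 2) (R x : PowerSeries ℂ) := by
  have hq0 : (q : ℂ) ≠ 0 := by exact_mod_cast (by omega : q ≠ 0)
  have key : Q = -(Polynomial.C ((q : ℂ) ^ (2 * (p + 2) + 3)) * Polynomial.X ^ 4 * P) +
      Polynomial.C ((q : ℂ) ^ (p + 3)) * Polynomial.X ^ 2 * ∑ W ∈ Δ, V W +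
      Polynomial.C (c : ℂ) * ∑ x ∈ Ω, (1 - Polynomial.X) *
        (1 - Polynomial.C ((q : ℂ) ^ 2) * Polynomial.X ^ 2) *
        (1 + Polynomial.C ((q : ℂ) ^ 2) * Polynomial.X) *
          (R x).comp (Polynomial.C ((q : ℂ) ^ 2) * Polynomial.X) := by
    -- Starting at k = 2 makes k - 2 a genuine subtraction.
    refine polynomial_eq_of_eval_pow hq 2 fun k hk => ?_
    obtain ⟨j, rfl⟩ := Nat.exists_eq_add_of_le' hk
    have h := congrArg (fun z : ℝ => (z : ℂ)) (h (j + 2) (by omega))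
    push_cast at h
    rw [hP, hQ, Finset.sum_congr rfl fun W hW => hV W hW _] at h
    simp only [hR] at h
    have e0 : (q : ℂ) ^ (2 * ((p : ℤ) + 2) - 4 * ((j : ℤ) + 2) + 3) =
        (q : ℂ) ^ (2 * (p + 2) + 3) * (((q : ℂ) ^ (j + 2))⁻¹) ^ 4 := by
      rw [show 2 * ((p : ℤ) + 2) - 4 * ((j : ℤ) + 2) + 3 =
        ((2 * (p + 2) + 3 : ℕ) : ℤ) - (((j + 2) * 4 : ℕ) : ℤ) by push_cast; ring, zpow_sub₀ hq0,
        zpow_natCast, zpow_natCast, inv_pow, pow_mul _ (j + 2), div_eq_mul_inv]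
    have e1 : (q : ℂ) ^ ((p : ℤ) + 2 - 2 * ((j : ℤ) + 2) + 1) =
        (q : ℂ) ^ (p + 3) * (((q : ℂ) ^ (j + 2))⁻¹) ^ 2 := by
      rw [show (p : ℤ) + 2 - 2 * ((j : ℤ) + 2) + 1 =
        ((p + 3 : ℕ) : ℤ) - (((j + 2) * 2 : ℕ) : ℤ) by push_cast; ring, zpow_sub₀ hq0,
        zpow_natCast, zpow_natCast, inv_pow, pow_mul, div_eq_mul_inv]
    have e2 : (q : ℂ) ^ (-((j : ℤ) + 2)) = ((q : ℂ) ^ (j + 2))⁻¹ := by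
      rw [_root_.zpow_neg]
      norm_cast
    have e3 : (q : ℂ) ^ (-((j : ℤ) + 2) + 2) = (q : ℂ) ^ 2 * ((q : ℂ) ^ (j + 2))⁻¹ := by
      rw [zpow_add₀ hq0, e2, mul_comm]
      norm_cast
    have e5 : (q : ℂ) ^ (-(2 * ((j : ℤ) + 2)) + 2) =
        (q : ℂ) ^ 2 * (((q : ℂ) ^ (j + 2))⁻¹) ^ 2 := by
      rw [zpow_add₀ hq0, mul_comm (2 : ℤ), ← neg_mul, _root_.zpow_mul, e2, mul_comm]
      norm_cast
    have e4 : (q : ℂ) ^ 2 * ((q : ℂ) ^ (j + 2))⁻¹ = ((q : ℂ) ^ j)⁻¹ := by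
      rw [pow_add, mul_inv, mul_comm, mul_assoc, inv_mul_cancel₀ (pow_ne_zero 2 hq0), mul_one]
    rw [e0, e1, e5, e3, e2] at h
    simp only [Polynomial.eval_add, Polynomial.eval_mul, Polynomial.eval_C, Polynomial.eval_pow,
      Polynomial.eval_X, Polynomial.eval_finsetSum, Polynomial.eval_sub, Polynomial.eval_one,
      Polynomial.eval_comp, Polynomial.eval_neg, ← Finset.mul_sum]
    rw [e4] at h ⊢
    linear_combination h
  have key' := congrArg (Polynomial.coeToPowerSeries.ringHom (R := ℂ)) key
  rw [map_add, map_add, map_neg, map_mul _ (_ * _) (Finset.sum _ _), map_mul _ _ (Finset.sum Ω _),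
    map_sum, map_sum] at key'
  simpa only [Polynomial.coeToPowerSeries.ringHom_apply, Polynomial.coe_mul, Polynomial.coe_add,
    Polynomial.coe_sub, Polynomial.coe_one, Polynomial.coe_C, Polynomial.coe_X,
    Polynomial.coe_pow, coe_comp_C_mul_X] using key'

end Interpolation

/-! ### Induction formulas for local densities -/

section Induction

variable {F : Type*} [Field F] [ValuativeRel F] [TopologicalSpace F]
  [IsNonarchimedeanLocalField F] [CharZero F] {ϖ : 𝒪[F]} {p r : ℕ}

theorem modifiedDensitySeq_eq_sum_shiftedBlock (hϖ : Irreducible ϖ) (k : ℕ)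
    {B : Matrix (Fin p ⊕ Fin r) (Fin p ⊕ Fin r) F} (hB : IsHalfIntegral B) {l : ℕ}
    (hl : ∀ x : Matrix (Fin r) (Fin p) 𝒪[F], DetBound ϖ (shiftedBlock ϖ B x) l)
    {Ω : Finset (Matrix (Fin r) (Fin p) 𝒪[F])} (hΩ : IsCosetReps (2 * l + 1) Ω) {e : ℕ}
    (he : 2 * l + 1 ≤ e) :
    modifiedDensitySeq ϖ (hyp F k) B.toBlocks₁₁ ((ϖ : F) • lowerR B)
        ((ϖ : F) ^ 2 • B.toBlocks₂₂) e =
      ((residueCard F : ℝ) ^ (r * (p * (2 * l + 1))))⁻¹ *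
        ∑ x ∈ Ω, localDensity ϖ (hyp F k) (shiftedBlock ϖ B x) := by
  have h := modifiedDensitySeq_eq hϖ (isHalfIntegral_hyp (F := F) k) (hB.substLower (ϖ • 1))
    (fun x => by rw [← shiftedBlock_eq_blockSubst]; exact hl x) hΩ he
  obtain ⟨h1, h2, h3⟩ := toBlocks_substLower_smul (ϖ := ϖ) B
  simp only [← shiftedBlock_eq_blockSubst] at h
  rwa [h1, h2, h3] at h

theorem detBound_shiftedBlock (hϖ : Irreducible ϖ)
    {B : Matrix (Fin p ⊕ Fin r) (Fin p ⊕ Fin r) F} {l : ℕ} {x : Matrix (Fin r) (Fin p) 𝒪[F]}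
    (h : OrdLE ϖ ((2 : F) • shiftedBlock ϖ B x).det l) : DetBound ϖ (shiftedBlock ϖ B x) l :=
  exists_mul_eq_of_ordLE hϖ.ne_zero h

theorem DetBound.det_ne_zero (hϖ : Irreducible ϖ) {n : Type*} [Fintype n] [DecidableEq n]
    {T : Matrix n n F} {l : ℕ} (h : DetBound ϖ T l) : T.det ≠ 0 := by
  obtain ⟨c, hc⟩ := h
  intro h0
  rw [Matrix.det_smul, h0, mul_zero, mul_zero] at hc
  exact pow_ne_zero l (by simpa using hϖ.ne_zero : (ϖ : F) ≠ 0) hc.symm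

theorem localDensity_induction_one (hϖ : Irreducible ϖ) (k : ℕ)
    {B : Matrix (Fin p ⊕ Fin 1) (Fin p ⊕ Fin 1) F} (hB : IsHalfIntegral B) (hdet : B.det ≠ 0)
    {l : ℕ} (hl : ∀ x : Matrix (Fin 1) (Fin p) 𝒪[F], DetBound ϖ (shiftedBlock ϖ B x) l)
    {Ω : Finset (Matrix (Fin 1) (Fin p) 𝒪[F])} (hΩ : IsCosetReps (2 * l + 1) Ω) :
    localDensity ϖ (hyp F k) (substLower B (ϖ • 1)) -
        (residueCard F : ℝ) ^ (((p + 1 : ℕ) : ℤ) - 2 * (k : ℤ) + 1) *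
          localDensity ϖ (hyp F k) B =
      (residueCard F : ℝ) ^ (-(((2 * l + 1 : ℕ) : ℤ) * (p : ℤ))) *
        (1 - (residueCard F : ℝ) ^ (-(k : ℤ))) * (1 + (residueCard F : ℝ) ^ (-(k : ℤ) + 1)) *
          ∑ x ∈ Ω, localDensity ϖ (hyp F (k - 1)) (shiftedBlock ϖ B x) := by
  -- All sequences are eventually constant, so one sufficiently large level e suffices.
  obtain ⟨e, h, he⟩ := ((eventually_densityIdentity_one hϖ k hB hdet).and
    (eventually_ge_atTop (2 * l + 1))).exists
  rw [h, primitiveDensitySeq_one hϖ (memPowHalfIntegral_lower hB) (by omega),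
    modifiedDensitySeq_eq_sum_shiftedBlock hϖ (k - 1) hB hl hΩ he]
  have : ((residueCard F : ℝ) ^ (1 * (p * (2 * l + 1))))⁻¹ =
      (residueCard F : ℝ) ^ (-(((2 * l + 1 : ℕ) : ℤ) * (p : ℤ))) := by
    rw [_root_.zpow_neg, ← Nat.cast_mul, zpow_natCast, one_mul, mul_comm p]
  rw [this]
  ring

theorem localDensity_induction_two (hϖ : Irreducible ϖ) {k : ℕ} (hk : 1 ≤ k)
    {B : Matrix (Fin p ⊕ Fin 2) (Fin p ⊕ Fin 2) F} (hB : IsHalfIntegral B) (hdet : B.det ≠ 0)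
    {l : ℕ} (hl : ∀ x : Matrix (Fin 2) (Fin p) 𝒪[F], DetBound ϖ (shiftedBlock ϖ B x) l)
    {Ω : Finset (Matrix (Fin 2) (Fin p) 𝒪[F])} (hΩ : IsCosetReps (2 * l + 1) Ω)
    {Δ : Finset (Matrix (Fin 2) (Fin 2) 𝒪[F])} (hΔ : IsDoubleCosetReps ϖ 2 1 Δ) :
    localDensity ϖ (hyp F k) (substLower B (ϖ • 1)) +
          (residueCard F : ℝ) ^ (2 * ((p + 2 : ℕ) : ℤ) - 4 * (k : ℤ) + 3) *
            localDensity ϖ (hyp F k) B -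
        (residueCard F : ℝ) ^ (((p + 2 : ℕ) : ℤ) - 2 * (k : ℤ) + 1) *
          ∑ W ∈ Δ, localDensity ϖ (hyp F k) (substLower B W) =
      (residueCard F : ℝ) ^ (-(2 * ((2 * l + 1 : ℕ) : ℤ) * (p : ℤ))) *
        (1 - (residueCard F : ℝ) ^ (-(k : ℤ))) *
        (1 - (residueCard F : ℝ) ^ (-(2 * (k : ℤ)) + 2)) *
        (1 + (residueCard F : ℝ) ^ (-(k : ℤ) + 2)) *
          ∑ x ∈ Ω, localDensity ϖ (hyp F (k - 2)) (shiftedBlock ϖ B x) := by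
  obtain ⟨e, h, he⟩ := ((eventually_densityIdentity_two hϖ k hB hdet hΔ).and
    (eventually_ge_atTop (2 * l + 1))).exists
  rw [h, primitiveDensitySeq_two hϖ (memPowHalfIntegral_lower hB) hk (by omega),
    modifiedDensitySeq_eq_sum_shiftedBlock hϖ (k - 2) hB hl hΩ he]
  have : ((residueCard F : ℝ) ^ (2 * (p * (2 * l + 1))))⁻¹ =
      (residueCard F : ℝ) ^ (-(2 * ((2 * l + 1 : ℕ) : ℤ) * (p : ℤ))) := by
    rw [_root_.zpow_neg, mul_assoc, ← Nat.cast_mul, mul_comm p, pow_mul', ← zpow_natCast,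
      ← zpow_natCast, ← _root_.zpow_mul, mul_comm]
    norm_cast
  rw [this]
  ring

end Induction

/-! ### Induction formulas for F(B, X) -/

section SiegelInduction

variable {F : Type*} [Field F] [ValuativeRel F] [TopologicalSpace F]
  [IsNonarchimedeanLocalField F] [CharZero F] {ϖ : 𝒪[F]} {p r : ℕ}

theorem siegelF_induction_one {ψ : AddChar F ℂ} (hψ : IsOrderZero ψ) (hϖ : Irreducible ϖ)
    {B : Matrix (Fin p ⊕ Fin 1) (Fin p ⊕ Fin 1) F} (hB : IsHalfIntegral B) (hdet : B.det ≠ 0)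
    {l : ℕ} (hl : ∀ x : Matrix (Fin 1) (Fin p) 𝒪[F], DetBound ϖ (shiftedBlock ϖ B x) l)
    {Ω : Finset (Matrix (Fin 1) (Fin p) 𝒪[F])} (hΩ : IsCosetReps (2 * l + 1) Ω) :
    siegelF ψ (substLower B (ϖ • 1)) =
      PowerSeries.C ((residueCard F : ℂ) ^ (p + 2)) * PowerSeries.X ^ 2 * siegelF ψ B +
      PowerSeries.C ((residueCard F : ℂ) ^ (-(((2 * l + 1 : ℕ) : ℤ) * (p : ℤ)))) *
        ∑ x ∈ Ω,
          ((1 - PowerSeries.X) * (1 + PowerSeries.C (residueCard F : ℂ) * PowerSeries.X) *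
              PowerSeries.rescale (residueCard F : ℂ) (gammaPoly (shiftedBlock ϖ B x)) *
              (gammaPoly B)⁻¹) *
            PowerSeries.rescale (residueCard F : ℂ) (siegelF ψ (shiftedBlock ϖ B x)) := by
  obtain ⟨P, hP, hPk⟩ := exists_siegelSeries_polynomial hψ hϖ hB hdet
  obtain ⟨Q, hQ, hQk⟩ := exists_siegelSeries_polynomial hψ hϖ (hB.substLower (ϖ • 1))
    (det_ne_zero_substLower hdet (det_smul_one_ne_zero hϖ 1))
  choose R hR hRk using fun x : Matrix (Fin 1) (Fin p) 𝒪[F] =>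
    exists_siegelSeries_polynomial hψ hϖ (isHalfIntegral_shiftedBlock (ϖ := ϖ) hB x)
      ((hl x).det_ne_zero hϖ)
  have key := powerSeries_induction_one (one_lt_residueCard F) p _ hPk hQk hRk
    fun k => localDensity_induction_one hϖ k hB hdet hl hΩ
  simp only [← hP, ← hQ, ← hR] at key
  rw [siegelF, gammaPoly_substLower B (det_smul_one_ne_zero hϖ 1), key, add_mul, siegelF,
    mul_assoc _ (Finset.sum _ _), Finset.sum_mul]
  rw [Complex.ofReal_zpow, Complex.ofReal_natCast, mul_assoc (_ * _)]
  refine congrArg₂ (· + ·) rfl (congrArg₂ (· * ·) rfl (Finset.sum_congr rfl fun x _ => ?_))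
  -- After division by γ_q(B, X), only the series of B_x needs its own factor, b(B_x, qX) = γ_q(B_x,
  -- qX)F(B_x, qX).
  rw [← rescale_gammaPoly_mul_siegelF]
  generalize PowerSeries.rescale (residueCard F : ℂ) (gammaPoly (shiftedBlock ϖ B x)) = g
  generalize PowerSeries.rescale (residueCard F : ℂ) (siegelF ψ (shiftedBlock ϖ B x)) = f
  generalize (gammaPoly B)⁻¹ = h
  ring

theorem siegelF_induction_two {ψ : AddChar F ℂ} (hψ : IsOrderZero ψ) (hϖ : Irreducible ϖ)
    {B : Matrix (Fin p ⊕ Fin 2) (Fin p ⊕ Fin 2) F} (hB : IsHalfIntegral B) (hdet : B.det ≠ 0)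
    {l : ℕ} (hl : ∀ x : Matrix (Fin 2) (Fin p) 𝒪[F], DetBound ϖ (shiftedBlock ϖ B x) l)
    {Ω : Finset (Matrix (Fin 2) (Fin p) 𝒪[F])} (hΩ : IsCosetReps (2 * l + 1) Ω)
    {Δ : Finset (Matrix (Fin 2) (Fin 2) 𝒪[F])} (hΔ : IsDoubleCosetReps ϖ 2 1 Δ) :
    siegelF ψ (substLower B (ϖ • 1)) =
      -(PowerSeries.C ((residueCard F : ℂ) ^ (2 * (p + 2) + 3)) * PowerSeries.X ^ 4 *
          siegelF ψ B) +
      PowerSeries.C ((residueCard F : ℂ) ^ (p + 3)) * PowerSeries.X ^ 2 *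
        ∑ W ∈ Δ, siegelF ψ (substLower B W) +
      PowerSeries.C ((residueCard F : ℂ) ^ (-(2 * ((2 * l + 1 : ℕ) : ℤ) * (p : ℤ)))) *
        ∑ x ∈ Ω,
          ((1 - PowerSeries.X) *
              (1 - PowerSeries.C ((residueCard F : ℂ) ^ 2) * PowerSeries.X ^ 2) *
              (1 + PowerSeries.C ((residueCard F : ℂ) ^ 2) * PowerSeries.X) *
              PowerSeries.rescale ((residueCard F : ℂ) ^ 2) (gammaPoly (shiftedBlock ϖ B x)) *
              (gammaPoly B)⁻¹) *
            PowerSeries.rescale ((residueCard F : ℂ) ^ 2) (siegelF ψ (shiftedBlock ϖ B x)) := by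
  have hΔdet : ∀ W ∈ Δ, W.det ≠ 0 := fun W hW => det_ne_zero_of_mem_doubleCoset hϖ (hΔ.1 W hW)
  obtain ⟨P, hP, hPk⟩ := exists_siegelSeries_polynomial hψ hϖ hB hdet
  obtain ⟨Q, hQ, hQk⟩ := exists_siegelSeries_polynomial hψ hϖ (hB.substLower (ϖ • 1))
    (det_ne_zero_substLower hdet (det_smul_one_ne_zero hϖ 2))
  choose R hR hRk using fun x : Matrix (Fin 2) (Fin p) 𝒪[F] =>
    exists_siegelSeries_polynomial hψ hϖ (isHalfIntegral_shiftedBlock (ϖ := ϖ) hB x)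
      ((hl x).det_ne_zero hϖ)
  choose! V hV hVk using fun (W : Matrix (Fin 2) (Fin 2) 𝒪[F]) (hW : W ∈ Δ) =>
    exists_siegelSeries_polynomial hψ hϖ (hB.substLower W)
      (det_ne_zero_substLower hdet (hΔdet W hW))
  have key := powerSeries_induction_two (one_lt_residueCard F) p _ hPk hQk hRk hVk
    fun k hk => localDensity_induction_two hϖ hk hB hdet hl hΩ hΔ
  simp only [← hP, ← hQ, ← hR] at key
  have hVs : ∑ W ∈ Δ, siegelF ψ (substLower B W) =
      (∑ W ∈ Δ, (V W : PowerSeries ℂ)) * (gammaPoly B)⁻¹ := by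
    rw [Finset.sum_mul]
    refine Finset.sum_congr rfl fun W hW => ?_
    rw [siegelF, gammaPoly_substLower B (hΔdet W hW), hV W hW]
  rw [hVs, siegelF, gammaPoly_substLower B (det_smul_one_ne_zero hϖ 2), key, add_mul, add_mul,
    siegelF, mul_assoc _ (Finset.sum Ω _), Finset.sum_mul Ω]
  rw [Complex.ofReal_zpow, Complex.ofReal_natCast, neg_mul, mul_assoc (_ * _),
    mul_assoc (_ * _) (Finset.sum _ _)]
  refine congrArg₂ (· + ·) rfl (congrArg₂ (· * ·) rfl (Finset.sum_congr rfl fun x _ => ?_))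
  rw [← rescale_gammaPoly_mul_siegelF]
  generalize PowerSeries.rescale ((residueCard F : ℂ) ^ 2) (gammaPoly (shiftedBlock ϖ B x)) = g
  generalize PowerSeries.rescale ((residueCard F : ℂ) ^ 2) (siegelF ψ (shiftedBlock ϖ B x)) = f
  generalize (gammaPoly B)⁻¹ = h
  ring

end SiegelInduction

/-! ### The main theorem -/

theorem theorem5p2 {F : Type*} [Field F] [ValuativeRel F] [TopologicalSpace F]
    [IsNonarchimedeanLocalField F] [CharZero F]
    (ϖ : 𝒪[F]) (hϖ : Irreducible ϖ) (ψ : AddChar F ℂ) (hψ : IsOrderZero ψ)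
    (q : ℕ) (hq : q = residueCard F) :
    -- rank one: degree `n = p + 1`
    (∀ (p : ℕ) (B : Matrix (Fin p ⊕ Fin 1) (Fin p ⊕ Fin 1) F),
      IsHalfIntegral B → B.det ≠ 0 →
      (∃ l₀ : ℕ, 0 < l₀ ∧ ∀ x : Matrix (Fin 1) (Fin p) 𝒪[F],
        OrdLE ϖ ((2 : F) • shiftedBlock ϖ B x).det l₀) →
      ∃ m₀ : ℕ, 0 < m₀ ∧ ∀ Ω : Finset (Matrix (Fin 1) (Fin p) 𝒪[F]), IsCosetReps m₀ Ω →
        (∀ k : ℕ, p + 1 ≤ 2 * k →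
          -- all the limits exist
          (Converges (localDensitySeq ϖ (hyp F k) (substLower B (ϖ • 1))) ∧
            Converges (localDensitySeq ϖ (hyp F k) B) ∧
            Converges (primitiveDensitySeq ϖ (hyp F k) ((ϖ : F) ^ 2 • B.toBlocks₂₂)) ∧
            Converges (modifiedDensitySeq ϖ (hyp F (k - 1)) B.toBlocks₁₁
              ((ϖ : F) • lowerR B) ((ϖ : F) ^ 2 • B.toBlocks₂₂)) ∧
            ∀ x : Matrix (Fin 1) (Fin p) 𝒪[F],
              Converges (localDensitySeq ϖ (hyp F (k - 1)) (shiftedBlock ϖ B x))) ∧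
          localDensity ϖ (hyp F k) (substLower B (ϖ • 1))
              - (q : ℝ) ^ (((p + 1 : ℕ) : ℤ) - 2 * (k : ℤ) + 1) * localDensity ϖ (hyp F k) B
            = primitiveDensity ϖ (hyp F k) ((ϖ : F) ^ 2 • B.toBlocks₂₂) *
                modifiedDensity ϖ (hyp F (k - 1)) B.toBlocks₁₁
                  ((ϖ : F) • lowerR B) ((ϖ : F) ^ 2 • B.toBlocks₂₂) ∧
          primitiveDensity ϖ (hyp F k) ((ϖ : F) ^ 2 • B.toBlocks₂₂) *
                modifiedDensity ϖ (hyp F (k - 1)) B.toBlocks₁₁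
                  ((ϖ : F) • lowerR B) ((ϖ : F) ^ 2 • B.toBlocks₂₂)
            = (q : ℝ) ^ (-((m₀ : ℤ) * (p : ℤ))) *
                (1 - (q : ℝ) ^ (-(k : ℤ))) * (1 + (q : ℝ) ^ (-(k : ℤ) + 1)) *
                ∑ x ∈ Ω, localDensity ϖ (hyp F (k - 1)) (shiftedBlock ϖ B x)) ∧
        siegelF ψ (substLower B (ϖ • 1)) =
          PowerSeries.C ((q : ℂ) ^ (p + 2)) * PowerSeries.X ^ 2 * siegelF ψ B +
          PowerSeries.C ((q : ℂ) ^ (-((m₀ : ℤ) * (p : ℤ)))) *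
            ∑ x ∈ Ω,
              ((1 - PowerSeries.X) * (1 + PowerSeries.C (q : ℂ) * PowerSeries.X) *
                  PowerSeries.rescale (q : ℂ) (gammaPoly (shiftedBlock ϖ B x)) *
                  (gammaPoly B)⁻¹) *
                PowerSeries.rescale (q : ℂ) (siegelF ψ (shiftedBlock ϖ B x))) ∧
    -- rank two: degree `n = p + 2`
    (∀ (p : ℕ) (B : Matrix (Fin p ⊕ Fin 2) (Fin p ⊕ Fin 2) F),
      IsHalfIntegral B → B.det ≠ 0 →
      (∃ l₀ : ℕ, 0 < l₀ ∧ ∀ x : Matrix (Fin 2) (Fin p) 𝒪[F],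
        OrdLE ϖ ((2 : F) • shiftedBlock ϖ B x).det l₀) →
      ∃ m₀ : ℕ, 0 < m₀ ∧ ∀ Ω : Finset (Matrix (Fin 2) (Fin p) 𝒪[F]), IsCosetReps m₀ Ω →
        ∀ Δ : Finset (Matrix (Fin 2) (Fin 2) 𝒪[F]), IsDoubleCosetReps ϖ 2 1 Δ →
        (∀ k : ℕ, p + 2 ≤ 2 * k →
          -- all the limits exist
          (Converges (localDensitySeq ϖ (hyp F k) (substLower B (ϖ • 1))) ∧
            Converges (localDensitySeq ϖ (hyp F k) B) ∧
            (∀ W ∈ doubleCoset ϖ 2 1,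
              Converges (localDensitySeq ϖ (hyp F k) (substLower B W))) ∧
            Converges (primitiveDensitySeq ϖ (hyp F k) ((ϖ : F) ^ 2 • B.toBlocks₂₂)) ∧
            Converges (modifiedDensitySeq ϖ (hyp F (k - 2)) B.toBlocks₁₁
              ((ϖ : F) • lowerR B) ((ϖ : F) ^ 2 • B.toBlocks₂₂)) ∧
            ∀ x : Matrix (Fin 2) (Fin p) 𝒪[F],
              Converges (localDensitySeq ϖ (hyp F (k - 2)) (shiftedBlock ϖ B x))) ∧
          localDensity ϖ (hyp F k) (substLower B (ϖ • 1))
              + (q : ℝ) ^ (2 * ((p + 2 : ℕ) : ℤ) - 4 * (k : ℤ) + 3) * localDensity ϖ (hyp F k) B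
              - (q : ℝ) ^ (((p + 2 : ℕ) : ℤ) - 2 * (k : ℤ) + 1) *
                ∑ W ∈ Δ, localDensity ϖ (hyp F k) (substLower B W)
            = primitiveDensity ϖ (hyp F k) ((ϖ : F) ^ 2 • B.toBlocks₂₂) *
                modifiedDensity ϖ (hyp F (k - 2)) B.toBlocks₁₁
                  ((ϖ : F) • lowerR B) ((ϖ : F) ^ 2 • B.toBlocks₂₂) ∧
          primitiveDensity ϖ (hyp F k) ((ϖ : F) ^ 2 • B.toBlocks₂₂) *
                modifiedDensity ϖ (hyp F (k - 2)) B.toBlocks₁₁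
                  ((ϖ : F) • lowerR B) ((ϖ : F) ^ 2 • B.toBlocks₂₂)
            = (q : ℝ) ^ (-(2 * (m₀ : ℤ) * (p : ℤ))) *
                (1 - (q : ℝ) ^ (-(k : ℤ))) * (1 - (q : ℝ) ^ (-(2 * (k : ℤ)) + 2)) *
                (1 + (q : ℝ) ^ (-(k : ℤ) + 2)) *
                ∑ x ∈ Ω, localDensity ϖ (hyp F (k - 2)) (shiftedBlock ϖ B x)) ∧
        siegelF ψ (substLower B (ϖ • 1)) =
          -(PowerSeries.C ((q : ℂ) ^ (2 * (p + 2) + 3)) * PowerSeries.X ^ 4 * siegelF ψ B) +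
          PowerSeries.C ((q : ℂ) ^ (p + 3)) * PowerSeries.X ^ 2 *
            ∑ W ∈ Δ, siegelF ψ (substLower B W) +
          PowerSeries.C ((q : ℂ) ^ (-(2 * (m₀ : ℤ) * (p : ℤ)))) *
            ∑ x ∈ Ω,
              ((1 - PowerSeries.X) *
                  (1 - PowerSeries.C ((q : ℂ) ^ 2) * PowerSeries.X ^ 2) *
                  (1 + PowerSeries.C ((q : ℂ) ^ 2) * PowerSeries.X) *
                  PowerSeries.rescale ((q : ℂ) ^ 2) (gammaPoly (shiftedBlock ϖ B x)) *
                  (gammaPoly B)⁻¹) *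
                PowerSeries.rescale ((q : ℂ) ^ 2) (siegelF ψ (shiftedBlock ϖ B x))) := by
  subst hq
  refine ⟨fun p B hB hdet hl => ?_, fun p B hB hdet hl => ?_⟩
  · obtain ⟨l, -, hl⟩ := hl
    replace hl := fun x => detBound_shiftedBlock hϖ (hl x)
    -- m₀ is the level from which all densities α(H, B_x) are stationary, for every k at once.
    refine ⟨2 * l + 1, by omega, fun Ω hΩ => ⟨fun k _ => ?_,
        siegelF_induction_one hψ hϖ hB hdet hl hΩ⟩⟩
    have hmod := tendsto_of_eventually_eq ((eventually_ge_atTop (2 * l + 1)).mono fun e he =>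
      modifiedDensitySeq_eq_sum_shiftedBlock hϖ (k - 1) hB hl hΩ he)
    have hprim := tendsto_of_eventually_eq ((eventually_ge_atTop 1).mono fun e he =>
      primitiveDensitySeq_one (k := k) hϖ (memPowHalfIntegral_lower hB) he)
    have hind := localDensity_induction_one hϖ k hB hdet hl hΩ
    have hprod : primitiveDensity ϖ (hyp F k) ((ϖ : F) ^ 2 • B.toBlocks₂₂) *
        modifiedDensity ϖ (hyp F (k - 1)) B.toBlocks₁₁ ((ϖ : F) • lowerR B)
          ((ϖ : F) ^ 2 • B.toBlocks₂₂) =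
        localDensity ϖ (hyp F k) (substLower B (ϖ • 1)) -
          (residueCard F : ℝ) ^ (((p + 1 : ℕ) : ℤ) - 2 * (k : ℤ) + 1) *
            localDensity ϖ (hyp F k) B := by
      obtain ⟨e, h, he⟩ := ((eventually_densityIdentity_one hϖ k hB hdet).and
        (eventually_ge_atTop (2 * l + 1))).exists
      rw [primitiveDensity, modifiedDensity, hprim.2, hmod.2, h,
        primitiveDensitySeq_one hϖ (memPowHalfIntegral_lower hB) (by omega),
        modifiedDensitySeq_eq_sum_shiftedBlock hϖ (k - 1) hB hl hΩ he]
    exact ⟨⟨converges_localDensitySeq_hyp hϖ k (hB.substLower _)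
        (det_ne_zero_substLower hdet (det_smul_one_ne_zero hϖ 1)),
      converges_localDensitySeq_hyp hϖ k hB hdet, ⟨_, hprim.1⟩, ⟨_, hmod.1⟩,
      fun x => converges_localDensitySeq_hyp hϖ _ (isHalfIntegral_shiftedBlock hB x)
        ((hl x).det_ne_zero hϖ)⟩, hprod.symm, hprod.trans hind⟩
  · obtain ⟨l, -, hl⟩ := hl
    replace hl := fun x => detBound_shiftedBlock hϖ (hl x)
    refine ⟨2 * l + 1, by omega, fun Ω hΩ Δ hΔ =>
      ⟨fun k hk => ?_, siegelF_induction_two hψ hϖ hB hdet hl hΩ hΔ⟩⟩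
    have hk1 : 1 ≤ k := by omega
    have hmod := tendsto_of_eventually_eq ((eventually_ge_atTop (2 * l + 1)).mono fun e he =>
      modifiedDensitySeq_eq_sum_shiftedBlock hϖ (k - 2) hB hl hΩ he)
    have hprim := tendsto_of_eventually_eq ((eventually_ge_atTop 1).mono fun e he =>
      primitiveDensitySeq_two (k := k) hϖ (memPowHalfIntegral_lower hB) hk1 he)
    have hind := localDensity_induction_two hϖ hk1 hB hdet hl hΩ hΔ
    have hprod : primitiveDensity ϖ (hyp F k) ((ϖ : F) ^ 2 • B.toBlocks₂₂) *
        modifiedDensity ϖ (hyp F (k - 2)) B.toBlocks₁₁ ((ϖ : F) • lowerR B)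
          ((ϖ : F) ^ 2 • B.toBlocks₂₂) =
        localDensity ϖ (hyp F k) (substLower B (ϖ • 1)) +
            (residueCard F : ℝ) ^ (2 * ((p + 2 : ℕ) : ℤ) - 4 * (k : ℤ) + 3) *
              localDensity ϖ (hyp F k) B -
          (residueCard F : ℝ) ^ (((p + 2 : ℕ) : ℤ) - 2 * (k : ℤ) + 1) *
            ∑ W ∈ Δ, localDensity ϖ (hyp F k) (substLower B W) := by
      obtain ⟨e, h, he⟩ := ((eventually_densityIdentity_two hϖ k hB hdet hΔ).and
        (eventually_ge_atTop (2 * l + 1))).exists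
      rw [primitiveDensity, modifiedDensity, hprim.2, hmod.2, h,
        primitiveDensitySeq_two hϖ (memPowHalfIntegral_lower hB) hk1 (by omega),
        modifiedDensitySeq_eq_sum_shiftedBlock hϖ (k - 2) hB hl hΩ he]
    exact ⟨⟨converges_localDensitySeq_hyp hϖ k (hB.substLower _)
        (det_ne_zero_substLower hdet (det_smul_one_ne_zero hϖ 2)),
      converges_localDensitySeq_hyp hϖ k hB hdet,
      fun W hW => converges_localDensitySeq_hyp hϖ k (hB.substLower W)
        (det_ne_zero_substLower hdet (det_ne_zero_of_mem_doubleCoset hϖ hW)),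
      ⟨_, hprim.1⟩, ⟨_, hmod.1⟩,
      fun x => converges_localDensitySeq_hyp hϖ _ (isHalfIntegral_shiftedBlock hB x)
        ((hl x).det_ne_zero hϖ)⟩, hprod.symm, hprod.trans hind⟩
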